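/- Let $n\ge 1$, $\gamma>0$, $-1<\delta<\frac{n-1}{2}$ and $\frac{n-1}{2}-\delta\le\lambda\le\gamma$. For $R>0$ let $S_R^{\delta,\gamma}f=B_R*f$ be the generalized Bochner–Riesz mean on $\mathbb R^n$ with kernel $$B_R(x)=\int_{\mathbb R^n}\Big(1-\frac{|\xi|^\gamma}{R^\gamma}\Big)_+^{\delta}e^{2\pi i\xi\cdot x}\,d\xi ,$$ so that $(S_R^{\delta,\gamma}f)^\wedge(\xi)=(1-|\xi|^\gamma/R^\gamma)_+^\delta\,\widehat f(\xi)$; if the convolution integral does not converge absolutely, it is understood as $$(S_R^{\delta,\gamma}f)(x)=\lim_{\varepsilon\to0^+}\int_{\mathbb R^n} B_R(y)e^{-\varepsilon|y|^2}f(x-y)\,dy .$$ For $1\le p<\infty$, we say that $f\in I_\lambda(L^p)(\mathbb R^n)$ with $I_{-\lambda}f=g$ if $g\in L^p(\mathbb R^n)$, if $f$ is a measurable function that is integrable against $(1+|x|)^{-N}$ for some $N$, and if $\widehat f=|\xi|^{-\lambda}\widehat g$ in the sense that $\int f\,\widehat\psi=\int g\,(|\cdot|^{-\lambda}\psi)^\wedge$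 for every Schwartz function $\psi$ with $\psi(\xi)=O(|\xi|^\lambda)$ as $\xi\to0$. For $0\le\alpha<n$ let $$(M_\alpha g)(x)=\sup_Q |Q|^{\alpha/n-1}\int_Q|g(y)|\,dy ,$$ the supremum being over all cubes $Q$ centered at $x$ with sides parallel to the axes, and let $M=M_0$. For $0<\alpha<n$ let $I_\alpha$ be the Riesz potential with Fourier multiplier $|\xi|^{-\alpha}$, that is $$I_\alpha(|g|)(x)=\pi^{\alpha-n/2}\,\frac{\Gamma((n-\alpha)/2)}{\Gamma(\alpha/2)}\int_{\mathbb R^n}\frac{|g(y)|}{|x-y|^{n-\alpha}}\,dy\in[0,\infty].$$ Then there is a constant $C>0$, depending only on $n,\delta,\gamma,\lambda$, such that for every $1\le p<\infty$, every $f\in I_\lambda(L^p)(\mathbb R^n)$ and $g=I_{-\lambda}f$, for almost every $x\in\mathbb R^n$, $$\sup_{R>1}\Big|R^{\lambda+\delta-\frac{n-1}{2}}\big\{(S_R^{\delta,\gamma}f)(x)-f(x)\big\}\Big|\le C\Big((M_{\frac{n-1}{2}-\delta}\,g)(x)+I_{\frac{n-1}{2}-\delta}(|g|)(x)+(Mg)(x)\Big),$$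 where $(S_R^{\delta,\gamma}f)(x)$ exists for all $R>1$ whenever the right-hand side is finite (otherwise the inequality is void). -/

import Mathlib

open MeasureTheory Filter Topology FourierTransform
open scoped NNReal ENNReal SchwartzMap

noncomputable section

namespace BochnerRiesz

/-- Euclidean space `ℝⁿ`. -/
abbrev Space (n : ℕ) := EuclideanSpace ℝ (Fin n)

/-- The truncated power `t₊ ^ δ`: it is `t ^ δ` for `t > 0` and `0` for `t ≤ 0`
(also when `δ ≤ 0`). -/
def posPow (δ t : ℝ) : ℝ := if 0 < t then t ^ δ else 0

/-- The multiplier `(1 - |ξ|^γ / R^γ)₊ ^ δ`. -/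
def multiplier {n : ℕ} (δ γ R : ℝ) (ξ : Space n) : ℂ :=
  (posPow δ (1 - ‖ξ‖ ^ γ / R ^ γ) : ℝ)

/-- The kernel `B_R(x) = ∫ (1 - |ξ|^γ / R^γ)₊ ^ δ e^{2πi ξ·x} dξ`. -/
def kernel {n : ℕ} (δ γ R : ℝ) : Space n → ℂ :=
  𝓕⁻ (multiplier δ γ R : Space n → ℂ)

/-- The Gauss regularization `∫ B_R(y) e^{-ε|y|²} f(x - y) dy` of the convolution `(B_R * f)(x)`.
On the Fourier side the multiplier is replaced by its convolution with a Gaussian of width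
`√ε`, which is smooth and so can be multiplied with the Fourier transform of any tempered `f`. -/
def regularizedMean {n : ℕ} (δ γ R : ℝ) (f : Space n → ℂ) (x : Space n) (ε : ℝ) : ℂ :=
  ∫ y : Space n, kernel δ γ R y * (Real.exp (-ε * ‖y‖ ^ 2) : ℝ) * f (x - y)

/-- The mean `(S_R f)(x)` exists. -/
def MeanExists {n : ℕ} (δ γ R : ℝ) (f : Space n → ℂ) (x : Space n) : Prop :=
  ∃ s : ℂ, Tendsto (regularizedMean δ γ R f x) (𝓝[>] 0) (𝓝 s)

/-- The generalized Bochner-Riesz mean `(S_R f)(x) = (B_R * f)(x)`, the convolution being the limit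
of its Gauss regularizations. By dominated convergence this is the ordinary convolution whenever
`y ↦ B_R(y) f(x - y)` is integrable, for example for Schwartz functions `f`. -/
def mean {n : ℕ} (δ γ R : ℝ) (f : Space n → ℂ) (x : Space n) : ℂ :=
  limUnder (𝓝[>] 0) (regularizedMean δ γ R f x)

/-- The maximal function `sup_{R > 1} |R^(lam + δ - (n-1)/2) ((S_R f)(x) - f(x))|`. -/
def maximalMean {n : ℕ} (δ γ lam : ℝ) (f : Space n → ℂ) (x : Space n) : ℝ≥0∞ :=
  ⨆ (R : ℝ) (_ : 1 < R),
    ‖((R ^ (lam + δ - ((n : ℝ) - 1) / 2) : ℝ) : ℂ) * (mean δ γ R f x - f x)‖ₑ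

/-- A measurable function that is integrable against some negative power of `1 + |x|`, so that it
is a tempered distribution. -/
def IsTempered {n : ℕ} (f : Space n → ℂ) : Prop :=
  ∃ N : ℕ, Integrable (fun x => (((1 + ‖x‖) ^ N)⁻¹ : ℝ) • f x)

/-- `f = I_lam g`, that is `f̂ = |ξ|^(-lam) ĝ`, as tempered distributions: the identity is tested
against all Schwartz functions `ψ` for which `|ξ|^(-lam) ψ` stays bounded at the origin. -/
def IsRieszPotential {n : ℕ} (lam : ℝ) (f g : Space n → ℂ) : Prop :=
  ∀ ψ : 𝓢(Space n, ℂ),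
    ((fun ξ => ψ ξ) =O[𝓝 0] fun ξ => ‖ξ‖ ^ lam) →
      ∫ x, f x * 𝓕 (fun ξ => ψ ξ) x =
        ∫ x, g x * 𝓕 (fun ξ : Space n => ((‖ξ‖ ^ (-lam) : ℝ) : ℂ) * ψ ξ) x

/-- `f ∈ I_lam(L^p)` and `g = I_{-lam} f`. -/
structure IsRieszSobolev {n : ℕ} (lam : ℝ) (p : ℝ≥0∞) (f g : Space n → ℂ) : Prop where
  tempered : IsTempered f
  memLp : MemLp g p volume
  potential : IsRieszPotential lam f g

/-- The cube with center `x`, diameter `l`, and sides parallel to the axes. -/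
def cube {n : ℕ} (x : Space n) (l : ℝ) : Set (Space n) :=
  {y | ∀ i, |y i - x i| ≤ l / (2 * Real.sqrt n)}

/-- The fractional maximal function
`(M_α g)(x) = sup_Q |Q|^(α/n - 1) ∫_Q |g|` over the cubes `Q` centered at `x`. -/
def fractionalMaximal {n : ℕ} (α : ℝ) (g : Space n → ℂ) (x : Space n) : ℝ≥0∞ :=
  ⨆ (l : ℝ) (_ : 0 < l), volume (cube x l) ^ (α / n - 1) * ∫⁻ y in cube x l, ‖g y‖ₑ

/-- The Hardy-Littlewood maximal function `M g = M_0 g`. -/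
def hardyLittlewood {n : ℕ} (g : Space n → ℂ) (x : Space n) : ℝ≥0∞ :=
  fractionalMaximal 0 g x

/-- The Riesz potential `I_α(|g|)(x) = c ∫ |g(y)| |x - y|^(α - n) dy`, for `0 < α < n`. The
constant is the one for which the operator has the Fourier multiplier `|ξ|^(-α)`. -/
def rieszPotentialAbs {n : ℕ} (α : ℝ) (g : Space n → ℂ) (x : Space n) : ℝ≥0∞ :=
  ENNReal.ofReal
      (Real.pi ^ (α - (n : ℝ) / 2) * Real.Gamma (((n : ℝ) - α) / 2) / Real.Gamma (α / 2)) *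
    ∫⁻ y, ‖g y‖ₑ * ENNReal.ofReal (‖x - y‖ ^ (α - (n : ℝ)))

/-- The majorant `M_α g + I_α(|g|) + M g` with `α = (n-1)/2 - δ`. -/
def majorant {n : ℕ} (δ : ℝ) (g : Space n → ℂ) (x : Space n) : ℝ≥0∞ :=
  fractionalMaximal (((n : ℝ) - 1) / 2 - δ) g x +
    rieszPotentialAbs (((n : ℝ) - 1) / 2 - δ) g x + hardyLittlewood g x

end BochnerRiesz

end

open MeasureTheory Filter Topology FourierTransform
open scoped NNReal ENNReal SchwartzMap

noncomputable section

namespace BochnerRiesz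

/-! ### Scale-invariant symbol estimates. -/

section SymbolBound

variable {V W F : Type*} [NormedAddCommGroup V] [NormedSpace ℝ V] [NormedAddCommGroup W]
  [NormedSpace ℝ W] [NormedAddCommGroup F] [NormedSpace ℝ F]

/-! Put α = (n-1)/2 - δ, so that 0 < α < n and α ≤ lam ≤ γ. Of the three terms of the majorant only
the Riesz potential is needed: R^(lam-α) |S_R f(x) - f(x)| is at most C ∫ |g(y)| |x-y|^(α-n) dy at
every x where that integral is finite and mollifications of f converge to f(x). Passing to f(x +
·/R) and R^(-lam) g(x + ·/R) reduces this to x = 0 and R = 1 (`IsRieszPotential.comp_affine`,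
`regularizedMean_eq`); the power of R is exactly the scaling of the integral.

Let m = (1-|ξ|^γ)₊^δ. Formally S_1 f(0) - f(0) = ∫ g 𝓕(|ξ|^(-lam) (m-1)), and this kernel should be
O(|y|^(α-n)) for three reasons. At the origin the symbol has order γ - lam ≥ 0. The singularity on
the unit sphere produces decay |y|^(-(n+1)/2-δ) = |y|^(α-n). The tail -|ξ|^(-lam) is dominated at
high frequency by |ξ|^(-α), because lam ≥ α.

The formal identity is not available as it stands: f is only tempered, 𝓕 m is not a test function,
and g determines f only up to distributions with spectrum at the origin. Hence every pairing is
split by a cutoff θ supported in |ξ| ≤ 1/16 (`integral_mul_fourier_eq`), and 𝓕 m is damped by a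
Gaussian.

High frequencies pass to g. The symbol |ξ|^(-lam) (1-θ) is the transform of a function integrable
against (1+|x|)^n (`exists_fourier_eq_rpow_mul_one_sub_cutoff`), and convolution with it preserves
the decay of 𝓕 m (`exists_norm_fourier_multiplier_le`, `norm_integral_mul_add_le`).

At low frequencies m = 1 + (m-u-1) + u, where u is m-1 localized at the origin. The constant 1 gives
the low-frequency part of f(0). The middle term vanishes on a neighbourhood of the support of θ and
disappears as the damping is removed (`tendsto_integral_fourier_lowCutoff_mul_heatKernel`). The
transform v of u decays like |z|^(-n-γ), and its moments of order below k = ⌈lam⌉ vanish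
(`integral_mul_characterTaylor_eq_zero`). So the Taylor polynomial of degree < k may be subtracted
from the character; what remains vanishes to order k ≥ lam at ξ = 0, is an admissible test function,
and passes to g. The resulting kernel is at most a multiple of |z|^β (|y|^(α-n) + |z+y|^(α-n)) for a
β slightly below lam (`exists_norm_fourier_remainderSymbol_le`), and |v(z)| |z|^β is integrable with
room to spare.

Finally f(0) is the limit of mollifications of f, and the same splitting compares it with its
low-frequency part (`exists_norm_sub_integral_mul_fourier_lowCutoff_le`). -/

/-- The scale invariant bound `‖D^k f(x)‖ ‖x‖^k ≤ A` for all `k ≤ K`. -/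
def SymbolBound (K : ℕ) (A : ℝ) (f : V → F) (x : V) : Prop :=
  ContDiffAt ℝ K f x ∧ ∀ k ≤ K, ‖iteratedFDeriv ℝ k f x‖ * ‖x‖ ^ k ≤ A

theorem SymbolBound.mono {K : ℕ} {A B : ℝ} {f : V → F} {x : V} (h : SymbolBound K A f x)
    (hAB : A ≤ B) : SymbolBound K B f x :=
  ⟨h.1, fun k hk => (h.2 k hk).trans hAB⟩

theorem SymbolBound.nonneg {K : ℕ} {A : ℝ} {f : V → F} {x : V} (h : SymbolBound K A f x) :
    0 ≤ A :=
  le_trans (by positivity) (h.2 0 (Nat.zero_le _))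

theorem SymbolBound.norm_le {K : ℕ} {A : ℝ} {f : V → F} {x : V} (h : SymbolBound K A f x) :
    ‖f x‖ ≤ A := by
  simpa using h.2 0 (Nat.zero_le _)

theorem SymbolBound.congr {K : ℕ} {A : ℝ} {f g : V → F} {x : V} (h : SymbolBound K A f x)
    (hfg : g =ᶠ[𝓝 x] f) : SymbolBound K A g x := by
  refine ⟨h.1.congr_of_eventuallyEq hfg, fun k hk => ?_⟩
  rw [(hfg.iteratedFDeriv ℝ k).eq_of_nhds]
  exact h.2 k hk

theorem exists_symbolBound {K : ℕ} {f : V → F} {x : V} (h : ContDiffAt ℝ K f x) :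
    ∃ A, SymbolBound K A f x :=
  ⟨∑ k ∈ Finset.range (K + 1), ‖iteratedFDeriv ℝ k f x‖ * ‖x‖ ^ k, h, fun k hk =>
    Finset.single_le_sum (f := fun k => ‖iteratedFDeriv ℝ k f x‖ * ‖x‖ ^ k)
      (fun _ _ => by positivity) (Finset.mem_range.2 (Nat.lt_succ_of_le hk))⟩

/-- Applied to the unit sphere and to the interval [1, 2]; invariance under dilations then carries
the bounds to all scales. -/
theorem exists_symbolBound_of_isCompact {K : ℕ} {f : V → F} {S : Set V} (hS : IsCompact S)
    (h : ∀ x ∈ S, ContDiffAt ℝ K f x) : ∃ A, 0 ≤ A ∧ ∀ x ∈ S, SymbolBound K A f x := by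
  have hc : ∀ k ≤ K, ContinuousOn (fun x => ‖iteratedFDeriv ℝ k f x‖ * ‖x‖ ^ k) S := by
    intro k hk x hx
    have : ContinuousAt (iteratedFDeriv ℝ k f) x := by
      obtain ⟨u, hu, hfu⟩ := (h x hx).contDiffOn (m := K) le_rfl (by simp)
      obtain ⟨v, hvu, hvo, hxv⟩ := mem_nhds_iff.1 hu
      have h1 := (hfu.mono (hvu.trans (by simp))).continuousOn_iteratedFDerivWithin
        (m := k) (by exact_mod_cast hk) hvo.uniqueDiffOn
      exact ((h1.congr fun y hy => (iteratedFDerivWithin_of_isOpen k hvo hy).symm)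
        ).continuousAt (hvo.mem_nhds hxv)
    exact (this.norm.mul (continuous_norm.continuousAt.pow k)).continuousWithinAt
  choose! M hM using fun k hk => (hS.bddAbove_image (hc k hk))
  refine ⟨∑ k ∈ Finset.range (K + 1), |M k|, by positivity, fun x hx => ⟨h x hx, fun k hk => ?_⟩⟩
  calc _ ≤ M k := hM k hk (Set.mem_image_of_mem _ hx)
    _ ≤ |M k| := le_abs_self _
    _ ≤ _ := Finset.single_le_sum (f := fun k => |M k|) (fun _ _ => abs_nonneg _)
      (Finset.mem_range.2 (Nat.lt_succ_of_le hk))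

theorem SymbolBound.add {K : ℕ} {A B : ℝ} {f g : V → F} {x : V} (hf : SymbolBound K A f x)
    (hg : SymbolBound K B g x) : SymbolBound K (A + B) (fun y => f y + g y) x := by
  refine ⟨hf.1.add hg.1, fun k hk => ?_⟩
  have hk' : (k : WithTop ℕ∞) ≤ K := by exact_mod_cast hk
  have : iteratedFDeriv ℝ k (fun y => f y + g y) x = _ :=
    iteratedFDeriv_add_apply (hf.1.of_le hk') (hg.1.of_le hk')
  rw [this]
  have := hf.2 k hk
  have := hg.2 k hk
  have := mul_le_mul_of_nonneg_right
    (norm_add_le (iteratedFDeriv ℝ k f x) (iteratedFDeriv ℝ k g x)) (by positivity : 0 ≤ ‖x‖ ^ k)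
  linarith

/-- Leibniz' rule, with ‖x‖^k distributed as ‖x‖^i ‖x‖^(k-i); the binomial coefficients add up to
the factor 2^K. -/
theorem SymbolBound.mul {K : ℕ} {A B : ℝ} {f g : V → ℂ} {x : V} (hf : SymbolBound K A f x)
    (hg : SymbolBound K B g x) : SymbolBound K (2 ^ K * A * B) (fun y => f y * g y) x := by
  refine ⟨hf.1.mul hg.1, fun k hk => ?_⟩
  have hA := hf.nonneg
  have hB := hg.nonneg
  have hk' : (k : WithTop ℕ∞) ≤ K := by exact_mod_cast hk
  obtain ⟨u, hu, hfu⟩ := hf.1.contDiffOn (m := K) le_rfl (by simp)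
  obtain ⟨v, hv, hgv⟩ := hg.1.contDiffOn (m := K) le_rfl (by simp)
  obtain ⟨s, hsu, hso, hxs⟩ := mem_nhds_iff.1 (inter_mem hu hv)
  have h1 := norm_iteratedFDerivWithin_mul_le (x := x) (n := k)
    (hfu.mono (fun y hy => by simpa using (hsu hy).1))
    (hgv.mono (fun y hy => by simpa using (hsu hy).2)) hso.uniqueDiffOn hxs hk'
  simp only [iteratedFDerivWithin_of_isOpen _ hso hxs] at h1
  calc _ ≤ (∑ i ∈ Finset.range (k + 1), (k.choose i : ℝ) * ‖iteratedFDeriv ℝ i f x‖ *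
        ‖iteratedFDeriv ℝ (k - i) g x‖) * ‖x‖ ^ k := by gcongr
    _ = ∑ i ∈ Finset.range (k + 1), (k.choose i : ℝ) * (‖iteratedFDeriv ℝ i f x‖ * ‖x‖ ^ i) *
        (‖iteratedFDeriv ℝ (k - i) g x‖ * ‖x‖ ^ (k - i)) := by
      rw [Finset.sum_mul]
      refine Finset.sum_congr rfl fun i hi => ?_
      have : ‖x‖ ^ k = ‖x‖ ^ i * ‖x‖ ^ (k - i) := by
        rw [← pow_add]; congr 1; have := Finset.mem_range.1 hi; omega
      rw [this]; ring
    _ ≤ ∑ i ∈ Finset.range (k + 1), (k.choose i : ℝ) * A * B := by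
      refine Finset.sum_le_sum fun i hi => ?_
      have hi' := Finset.mem_range.1 hi
      have := hf.2 i (by omega)
      have := hg.2 (k - i) (by omega)
      gcongr
    _ = 2 ^ k * A * B := by
      rw [← Finset.sum_mul, ← Finset.sum_mul]
      congr 2
      exact_mod_cast Nat.sum_range_choose k
    _ ≤ 2 ^ K * A * B := by gcongr; norm_num

/-- The chain rule produces |c|^k, which is exactly absorbed by ‖c • x‖^k. The constant is
unchanged, so symbol estimates need only be checked at unit scale. -/
theorem symbolBound_comp_smul {K : ℕ} {A c : ℝ} {f : V → F} {x : V} (hc : c ≠ 0)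
    (h : SymbolBound K A f (c • x)) : SymbolBound K A (fun y => f (c • y)) x := by
  let e : V ≃L[ℝ] V := ContinuousLinearEquiv.smulLeft (Units.mk0 c hc)
  have he : ∀ y, e y = c • y := fun y => rfl
  refine ⟨h.1.comp x (contDiffAt_id.const_smul c), fun k hk => ?_⟩
  have h1 : iteratedFDeriv ℝ k (f ∘ e) x =
      (iteratedFDeriv ℝ k f (e x)).compContinuousLinearMap fun _ => (e : V →L[ℝ] V) := by
    have := e.iteratedFDerivWithin_comp_right f (s := Set.univ) uniqueDiffOn_univ (x := x)
      (Set.mem_univ _) k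
    simpa [iteratedFDerivWithin_univ] using this
  have h2 : ‖iteratedFDeriv ℝ k (f ∘ e) x‖ ≤ ‖iteratedFDeriv ℝ k f (c • x)‖ * |c| ^ k := by
    rw [h1]
    refine (ContinuousMultilinearMap.norm_compContinuousLinearMap_le _ _).trans ?_
    rw [Finset.prod_const, Finset.card_univ, Fintype.card_fin, he]
    gcongr
    refine ContinuousLinearMap.opNorm_le_bound _ (abs_nonneg _) fun y => ?_
    rw [ContinuousLinearEquiv.coe_coe, he, norm_smul, Real.norm_eq_abs]
  calc _ ≤ ‖iteratedFDeriv ℝ k f (c • x)‖ * |c| ^ k * ‖x‖ ^ k := by gcongr; exact h2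
    _ = ‖iteratedFDeriv ℝ k f (c • x)‖ * ‖c • x‖ ^ k := by
      rw [norm_smul, mul_pow, Real.norm_eq_abs, mul_assoc]
    _ ≤ A := h.2 k hk

/-- The Faà di Bruno bound, applied with the geometric majorant (D/‖x‖)^i for the inner derivatives
of order i. Since D ≥ 1, a bound by D for each i is also a bound by D^i. -/
theorem symbolBound_comp {K : ℕ} {C D : ℝ} {g : W → F} {f : V → W} {x : V} (hx : x ≠ 0)
    (hD : 1 ≤ D) (hg : ContDiffAt ℝ K g (f x)) (hf : ContDiffAt ℝ K f x)
    (hgC : ∀ k ≤ K, ‖iteratedFDeriv ℝ k g (f x)‖ ≤ C)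
    (hfD : ∀ k ≤ K, 1 ≤ k → ‖iteratedFDeriv ℝ k f x‖ * ‖x‖ ^ k ≤ D) :
    SymbolBound K (K.factorial * C * D ^ K) (fun y => g (f y)) x := by
  refine ⟨hg.comp x hf, fun k hk => ?_⟩
  have hk' : (k : WithTop ℕ∞) ≤ K := by exact_mod_cast hk
  have hxn : 0 < ‖x‖ := norm_pos_iff.2 hx
  have hC : 0 ≤ C := le_trans (norm_nonneg _) (hgC 0 (Nat.zero_le _))
  obtain ⟨u, hu, hgu⟩ := hg.contDiffOn (m := K) le_rfl (by simp)
  obtain ⟨v, hv, hfv⟩ := hf.contDiffOn (m := K) le_rfl (by simp)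
  obtain ⟨t, htu, hto, hxt⟩ := mem_nhds_iff.1 hu
  obtain ⟨s, hsv, hso, hxs⟩ :=
    mem_nhds_iff.1 (inter_mem hv (hf.continuousAt.preimage_mem_nhds (hto.mem_nhds hxt)))
  have h1 := norm_iteratedFDerivWithin_comp_le (n := k) (C := C) (D := D / ‖x‖)
    (hgu.mono (fun y hy => by simpa using (htu hy)))
    (hfv.mono (fun y hy => by simpa using (hsv hy).1)) hk' hto.uniqueDiffOn hso.uniqueDiffOn
    (fun y hy => (hsv hy).2) hxs
    (fun i hi => by
      rw [iteratedFDerivWithin_of_isOpen _ hto hxt]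
      exact hgC i (hi.trans hk))
    (fun i hi1 hi => by
      rw [iteratedFDerivWithin_of_isOpen _ hso hxs, div_pow, le_div_iff₀ (by positivity)]
      exact (hfD i (hi.trans hk) hi1).trans (le_self_pow₀ hD (by omega)))
  rw [iteratedFDerivWithin_of_isOpen _ hso hxs] at h1
  calc _ ≤ (k.factorial * C * (D / ‖x‖) ^ k) * ‖x‖ ^ k := by gcongr; exact h1
    _ = k.factorial * C * D ^ k := by rw [div_pow]; field_simp
    _ ≤ _ := by
      have : (k.factorial : ℝ) ≤ K.factorial := by exact_mod_cast Nat.factorial_le hk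
      gcongr

/-- Rescaling by r = ‖x‖ writes f(‖y‖) as f(r ·) composed with y ↦ ‖r⁻¹ y‖. The outer function is
then differentiated at 1 and the norm at a point of the unit sphere, where compactness bounds its
derivatives. -/
theorem exists_symbolBound_comp_norm {H : Type*} [NormedAddCommGroup H] [InnerProductSpace ℝ H]
    [FiniteDimensional ℝ H] (K : ℕ) : ∃ M : ℝ, 0 ≤ M ∧ ∀ (f : ℝ → F) (A : ℝ) (x : H), x ≠ 0 →
      SymbolBound K A f ‖x‖ → SymbolBound K (M * A) (fun y : H => f ‖y‖) x := by
  have hN : ∀ x ∈ Metric.sphere (0 : H) 1, ContDiffAt ℝ K (fun y : H => ‖y‖) x := fun x hx =>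
    contDiffAt_norm ℝ (by rintro rfl; simp at hx)
  obtain ⟨D, hD0, hD⟩ := exists_symbolBound_of_isCompact (isCompact_sphere (0 : H) 1) hN
  refine ⟨K.factorial * (D + 1) ^ K, by positivity, fun f A x hx hf => ?_⟩
  have hr : 0 < ‖x‖ := norm_pos_iff.2 hx
  set r := ‖x‖ with hrdef
  have h1 : SymbolBound K A (fun t : ℝ => f (r • t)) 1 :=
    symbolBound_comp_smul hr.ne' (by simpa using hf)
  have hω : r⁻¹ • x ∈ Metric.sphere (0 : H) 1 := by
    simp only [mem_sphere_zero_iff_norm, norm_smul, norm_inv, Real.norm_eq_abs, abs_of_pos hr]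
    rw [← hrdef]; field_simp
  have h2 : SymbolBound K D (fun y : H => ‖r⁻¹ • y‖) x :=
    symbolBound_comp_smul (inv_ne_zero hr.ne') (hD _ hω)
  have hx1 : ‖r⁻¹ • x‖ = 1 := by simpa using hω
  have h3 := symbolBound_comp (K := K) (C := A) (D := D + 1) (g := fun t : ℝ => f (r • t))
    (f := fun y : H => ‖r⁻¹ • y‖) hx (by linarith) (by rw [hx1]; exact h1.1) h2.1
    (fun k hk => by simpa [hx1] using h1.2 k hk)
    (fun k hk _ => (h2.2 k hk).trans (by linarith))
  refine (h3.congr ?_).mono (le_of_eq (by ring))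
  refine Filter.Eventually.of_forall fun y => ?_
  simp only [norm_smul, norm_inv, Real.norm_eq_abs, abs_of_pos hr, smul_eq_mul]
  congr 1
  field_simp

/-- By homogeneity the bound at r is the bound at 1 multiplied by r^a. -/
theorem exists_symbolBound_rpow (K : ℕ) (a : ℝ) : ∃ C : ℝ, 0 ≤ C ∧ ∀ r : ℝ, 0 < r →
    SymbolBound K (C * r ^ a) (fun t : ℝ => ((t ^ a : ℝ) : ℂ)) r := by
  have h : ContDiffAt ℝ K (fun t : ℝ => ((t ^ a : ℝ) : ℂ)) 1 :=
    Complex.ofRealCLM.contDiff.contDiffAt.comp _ (Real.contDiffAt_rpow_const (Or.inl one_ne_zero))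
  obtain ⟨C, hC⟩ := exists_symbolBound h
  refine ⟨C, hC.nonneg, fun r hr => ?_⟩
  have h1 : SymbolBound K C (fun t : ℝ => (((r⁻¹ • t) ^ a : ℝ) : ℂ)) r :=
    symbolBound_comp_smul (f := fun t : ℝ => ((t ^ a : ℝ) : ℂ)) (inv_ne_zero hr.ne')
      (by simpa [hr.ne'] using hC)
  have h2 : SymbolBound K (C * r ^ a) (fun t : ℝ => (r ^ a : ℝ) • (((r⁻¹ • t) ^ a : ℝ) : ℂ)) r := by
    refine ⟨h1.1.const_smul (r ^ a), fun k hk => ?_⟩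
    have hk' : (k : WithTop ℕ∞) ≤ K := by exact_mod_cast hk
    rw [iteratedFDeriv_const_smul_apply' (h1.1.of_le hk'), norm_smul, Real.norm_of_nonneg
      (by positivity)]
    have := mul_le_mul_of_nonneg_left (h1.2 k hk) (by positivity : 0 ≤ r ^ a)
    linarith
  refine h2.congr ?_
  filter_upwards [lt_mem_nhds hr] with t ht
  rw [smul_eq_mul, Real.mul_rpow (by positivity) ht.le, Real.inv_rpow hr.le, Complex.real_smul,
    ← Complex.ofReal_mul]
  congr 1
  have : r ^ a ≠ 0 := (Real.rpow_pos_of_pos hr a).ne'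
  field_simp

end SymbolBound

/-! ### Smooth cutoffs, uniformly over dilations. -/

/-- A smooth cutoff on the line: `1` on `(-∞, 1]` and `0` on `[2, ∞)`. -/
def cutoff (t : ℝ) : ℝ := Real.smoothTransition (2 - t)

theorem contDiff_cutoff {m : ℕ∞} : ContDiff ℝ m cutoff :=
  Real.smoothTransition.contDiff.comp (contDiff_const.sub contDiff_id)

theorem cutoff_of_le_one {t : ℝ} (h : t ≤ 1) : cutoff t = 1 :=
  Real.smoothTransition.one_of_one_le (by linarith)

theorem cutoff_of_two_le {t : ℝ} (h : 2 ≤ t) : cutoff t = 0 :=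
  Real.smoothTransition.zero_of_nonpos (by linarith)

theorem cutoff_nonneg (t : ℝ) : 0 ≤ cutoff t := Real.smoothTransition.nonneg _

theorem cutoff_le_one (t : ℝ) : cutoff t ≤ 1 := Real.smoothTransition.le_one _

theorem contDiff_ofReal_cutoff {m : ℕ∞} : ContDiff ℝ m (fun t => (cutoff t : ℂ)) :=
  Complex.ofRealCLM.contDiff.comp contDiff_cutoff

theorem symbolBound_const {V : Type*} [NormedAddCommGroup V] [NormedSpace ℝ V] (K : ℕ) (c : ℂ)
    (x : V) : SymbolBound K ‖c‖ (fun _ : V => c) x := by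
  refine ⟨contDiffAt_const, fun k _ => ?_⟩
  rcases Nat.eq_zero_or_pos k with rfl | hk
  · simp
  · rw [iteratedFDeriv_const_of_ne hk.ne']; simp

/-- The cutoff is locally constant unless c r lies in [1, 2], a compact set; dilation invariance
makes the constant independent of c. -/
theorem exists_symbolBound_cutoff (K : ℕ) : ∃ C : ℝ, 1 ≤ C ∧ ∀ c r : ℝ, 0 < c → 0 < r →
    SymbolBound K C (fun t : ℝ => (cutoff (c * t) : ℂ)) r := by
  obtain ⟨C, hC0, hC⟩ := exists_symbolBound_of_isCompact (K := K) (isCompact_Icc (a := (1 : ℝ)) (b := 2))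
    (f := fun t : ℝ => (cutoff t : ℂ)) (fun x _ => (contDiff_ofReal_cutoff (m := K)).contDiffAt)
  refine ⟨C + 1, by linarith, fun c r hc hr => ?_⟩
  refine symbolBound_comp_smul (f := fun t : ℝ => (cutoff t : ℂ)) hc.ne' ?_
  rw [smul_eq_mul]
  have hcr : 0 < c * r := by positivity
  rcases lt_or_ge (c * r) 1 with h | h
  · refine ((symbolBound_const K 1 (c * r)).congr ?_).mono (by simpa using hC0)
    filter_upwards [gt_mem_nhds h] with t ht
    simp [cutoff_of_le_one ht.le]
  rcases le_or_gt (c * r) 2 with h' | h'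
  · exact (hC _ ⟨h, h'⟩).mono (by linarith)
  · refine ((symbolBound_const K 0 (c * r)).congr ?_).mono (by simp; linarith)
    filter_upwards [lt_mem_nhds h'] with t ht
    simp [cutoff_of_two_le ht.le]

/-! ### Decay of the Fourier transform of symbols. -/

section FourierDecay

variable {H : Type*} [NormedAddCommGroup H] [InnerProductSpace ℝ H] [FiniteDimensional ℝ H]
  [MeasurableSpace H] [BorelSpace H]

theorem norm_fourier_le_integral_norm (f : H → ℂ) (y : H) : ‖𝓕 f y‖ ≤ ∫ x, ‖f x‖ :=
  VectorFourier.norm_fourierIntegral_le_integral_norm _ _ _ f y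

theorem fourier_add_of_integrable {f g : H → ℂ} (hf : Integrable f) (hg : Integrable g) (y : H) :
    𝓕 (fun x => f x + g x) y = 𝓕 f y + 𝓕 g y := by
  have hi : ∀ {h : H → ℂ}, Integrable h → Integrable fun v =>
      Complex.exp (((-2 * Real.pi * inner ℝ v y : ℝ) : ℂ) * Complex.I) • h v := fun hh => by
    simpa [Circle.smul_def, Real.fourierChar_apply] using
      (Real.fourierIntegral_convergent_iff y).2 hh
  rw [Real.fourier_eq', Real.fourier_eq', Real.fourier_eq', ← integral_add (hi hf) (hi hg)]
  simp only [smul_add]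

/-- The transform of D^K f is evaluated on the diagonal (y, …, y), which yields the factor (2π
‖y‖²)^K; cancelling ‖y‖^K and dropping (2π)^K ≥ 1 leaves the bound. -/
theorem pow_mul_norm_fourier_le {K : ℕ} {f : H → ℂ} (hf : ContDiff ℝ K f)
    (hc : HasCompactSupport f) (y : H) :
    ‖y‖ ^ K * ‖𝓕 f y‖ ≤ ∫ x, ‖iteratedFDeriv ℝ K f x‖ := by
  rcases eq_or_ne y 0 with rfl | hy
  · rcases Nat.eq_zero_or_pos K with rfl | hK
    · simpa using norm_fourier_le_integral_norm f 0
    · rw [norm_zero, zero_pow hK.ne', zero_mul]; positivity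
  have h1 := Real.fourier_iteratedFDeriv (N := K) hf (fun m hm =>
    (hf.continuous_iteratedFDeriv (by exact_mod_cast hm)).integrable_of_hasCompactSupport
      (hc.iteratedFDeriv m)) (n := K) le_rfl
  have h2 : ‖𝓕 (iteratedFDeriv ℝ K f) y‖ ≤ ∫ x, ‖iteratedFDeriv ℝ K f x‖ :=
    VectorFourier.norm_fourierIntegral_le_integral_norm _ _ _ _ y
  have h3 := (𝓕 (iteratedFDeriv ℝ K f) y).le_opNorm (fun _ => y)
  rw [h1] at h3
  simp only [VectorFourier.fourierPowSMulRight_apply, Finset.prod_const, Finset.card_univ,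
    Fintype.card_fin, norm_smul, norm_pow, norm_neg, norm_mul, Complex.norm_ofNat,
    Complex.norm_real, Complex.norm_I, mul_one, neg_apply] at h3
  have hyy : ‖innerSL ℝ y y‖ = ‖y‖ ^ 2 := by
    rw [innerSL_apply_apply, real_inner_self_eq_norm_sq, norm_pow, norm_norm]
  rw [hyy] at h3
  have hy0 : 0 < ‖y‖ ^ K := by positivity
  have hpi : 1 ≤ (2 * ‖Real.pi‖) ^ K := by
    apply one_le_pow₀
    rw [Real.norm_of_nonneg Real.pi_nonneg]; linarith [Real.pi_gt_three]
  have h4 : ‖y‖ ^ K * (‖y‖ ^ K * ‖𝓕 f y‖) ≤ ‖y‖ ^ K * ∫ x, ‖iteratedFDeriv ℝ K f x‖ :=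
    calc _ = 1 * ((‖y‖ ^ 2) ^ K * ‖𝓕 f y‖) := by rw [← pow_mul]; ring
      _ ≤ (2 * ‖Real.pi‖) ^ K * ((‖y‖ ^ 2) ^ K * ‖𝓕 f y‖) := by gcongr
      _ ≤ _ := h3
      _ ≤ _ := by rw [mul_comm]; gcongr; simpa [h1] using h2
  exact le_of_mul_le_mul_left h4 hy0

theorem integrableOn_ball_norm_rpow [Nontrivial H] {a : ℝ} (ha : a < Module.finrank ℝ H) (r : ℝ) :
    IntegrableOn (fun x : H => ‖x‖ ^ (-a)) (Metric.ball 0 r) := by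
  rw [integrableOn_fun_norm_addHaar volume (f := fun t : ℝ => t ^ (-a))]
  have hd : 1 ≤ Module.finrank ℝ H := Module.finrank_pos
  rcases le_or_gt r 0 with hr | hr
  · simp [Set.Ioo_eq_empty_of_le hr]
  have : IntegrableOn (fun t : ℝ => t ^ (((Module.finrank ℝ H : ℝ) - 1) - a)) (Set.Ioo 0 r) :=
    (intervalIntegral.integrableOn_Ioo_rpow_iff hr).2 (by linarith)
  refine this.congr_fun (fun t ht => ?_) measurableSet_Ioo
  simp only [smul_eq_mul]
  rw [sub_eq_add_neg, Real.rpow_add ht.1, ← Real.rpow_natCast, Nat.cast_sub hd, Nat.cast_one]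

theorem fourier_comp_smul (f : H → ℂ) {c : ℝ} (hc : 0 < c) (y : H) :
    𝓕 (fun x => f (c • x)) y = ((c⁻¹ ^ Module.finrank ℝ H : ℝ) : ℂ) * 𝓕 f (c⁻¹ • y) := by
  rw [Real.fourier_eq', Real.fourier_eq']
  have := Measure.integral_comp_smul (volume : Measure H)
    (fun x => Complex.exp (((-2 * Real.pi * inner ℝ x (c⁻¹ • y) : ℝ) : ℂ) * Complex.I) • f x) c
  rw [abs_of_pos (by positivity), ← inv_pow, Complex.real_smul] at this
  rw [← this]
  refine integral_congr_ae (Eventually.of_forall fun x => ?_)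
  simp only [inner_smul_left, inner_smul_right]
  congr 5
  simp only [conj_trivial]
  field_simp

end FourierDecay

/-- By dilation it is enough to treat ‖y‖ = 1. The part of σ in |ξ| ≤ 2 is integrable since α < n.
On the rest, K derivatives bring the size down to |ξ|^(-α-K), integrable at infinity since n - α <
K. -/
theorem exists_norm_fourier_le_of_symbolBound {n K : ℕ} (hn : 1 ≤ n) {α : ℝ} (hαn : α < n)
    (hK : n - α < K) : ∃ C : ℝ, 0 ≤ C ∧ ∀ (σ : Space n → ℂ) (A : ℝ), 0 ≤ A → Integrable σ →
      (∀ ξ, ξ ≠ 0 → SymbolBound K (A * ‖ξ‖ ^ (-α)) σ ξ) →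
      ∀ y, y ≠ 0 → ‖𝓕 σ y‖ ≤ C * A * ‖y‖ ^ (α - n) := by
  have : Nonempty (Fin n) := ⟨⟨0, hn⟩⟩
  obtain ⟨M, hM0, hM⟩ := exists_symbolBound_comp_norm (F := ℂ) (H := Space n) K
  obtain ⟨Cκ, hCκ1, hCκ⟩ := exists_symbolBound_cutoff K
  have hκ : ∀ (c : ℝ), 0 < c → ∀ ξ : Space n, ξ ≠ 0 →
      SymbolBound K (M * Cκ) (fun ξ : Space n => (cutoff (c * ‖ξ‖) : ℂ)) ξ := fun c hc ξ hξ =>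
    hM (fun t => (cutoff (c * t) : ℂ)) Cκ ξ hξ (hCκ c _ hc (norm_pos_iff.2 hξ))
  have hK0 : 0 < K := by
    rw [← Nat.cast_pos (α := ℝ)]; linarith
  have hn0 : (0 : ℝ) ≤ n := n.cast_nonneg
  have hfr : Module.finrank ℝ (Space n) = n := by simp
  have hI1 : IntegrableOn (fun x : Space n => ‖x‖ ^ (-α)) (Metric.ball 0 2) :=
    integrableOn_ball_norm_rpow (by rw [hfr]; exact hαn) 2
  have hI2 : Integrable (fun x : Space n => (1 + ‖x‖) ^ (-(α + K))) :=
    integrable_one_add_norm (by rw [hfr]; linarith)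
  set B₁ : ℝ := ∫ x in Metric.ball (0 : Space n) 2, ‖x‖ ^ (-α) with hB₁
  set B₂ : ℝ := ∫ x : Space n, (1 + ‖x‖) ^ (-(α + K)) with hB₂
  have hB₁0 : 0 ≤ B₁ := integral_nonneg fun x => by positivity
  have hB₂0 : 0 ≤ B₂ := integral_nonneg fun x => by positivity
  set D : ℝ := 2 ^ K * (1 + M * Cκ) * 2 ^ (α + K) with hD
  have hD0 : 0 ≤ D := by positivity
  -- Unit frequency and compact support; the constant does not see the size of the support.
  have hcp : ∀ (σ : Space n → ℂ) (A : ℝ), 0 ≤ A → HasCompactSupport σ → Integrable σ →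
      (∀ ξ, ξ ≠ 0 → SymbolBound K (A * ‖ξ‖ ^ (-α)) σ ξ) →
      ∀ y, ‖y‖ = 1 → ‖𝓕 σ y‖ ≤ A * (B₁ + D * B₂) := by
    intro σ A hA hcs hint hσ y hy
    have hlow : ‖𝓕 (fun ξ : Space n => (cutoff ‖ξ‖ : ℂ) * σ ξ) y‖ ≤ A * B₁ := by
      refine (VectorFourier.norm_fourierIntegral_le_integral_norm _ _ _ _ y).trans ?_
      rw [hB₁, ← integral_const_mul, ← integral_indicator measurableSet_ball]
      refine integral_mono_of_nonneg (Eventually.of_forall fun x => norm_nonneg _)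
        (IntegrableOn.integrable_indicator (hI1.const_mul A) measurableSet_ball) ?_
      have : ∀ᵐ x : Space n, x ≠ 0 := by
        simp [ae_iff, measure_singleton]
      filter_upwards [this] with ξ hξ
      by_cases h2 : ‖ξ‖ < 2
      · rw [Set.indicator_of_mem (by simpa using h2), norm_mul, Complex.norm_real,
          Real.norm_of_nonneg (cutoff_nonneg _)]
        calc _ ≤ 1 * (A * ‖ξ‖ ^ (-α)) := by
              gcongr
              · exact cutoff_le_one _
              · exact (hσ ξ hξ).norm_le
          _ = _ := one_mul _
      · rw [Set.indicator_of_notMem (by simpa using h2), cutoff_of_two_le (not_lt.1 h2)]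
        simp
    set h : Space n → ℂ := fun ξ => (1 + (-1) * (cutoff (1 * ‖ξ‖) : ℂ)) * σ ξ with hh
    have hsmall : ∀ ξ : Space n, ‖ξ‖ < 1 → h =ᶠ[𝓝 ξ] fun _ => 0 := by
      intro ξ hξ
      filter_upwards [(isOpen_lt continuous_norm continuous_const).mem_nhds hξ] with z hz
      simp [hh, cutoff_of_le_one (le_of_lt hz)]
    have hSB : ∀ ξ, ξ ≠ 0 → SymbolBound K (2 ^ K * (1 + M * Cκ) * (A * ‖ξ‖ ^ (-α))) h ξ := by
      intro ξ hξ
      refine SymbolBound.mul ?_ (hσ ξ hξ)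
      have h1 := hκ 1 one_pos ξ hξ
      have h2 : SymbolBound K (M * Cκ) (fun ξ : Space n => (-1) * (cutoff (1 * ‖ξ‖) : ℂ)) ξ := by
        refine ⟨contDiffAt_const.mul h1.1, fun k hk => ?_⟩
        have hk' : (k : WithTop ℕ∞) ≤ K := by exact_mod_cast hk
        have : (fun ξ : Space n => (-1 : ℂ) * (cutoff (1 * ‖ξ‖) : ℂ)) =
            -(fun ξ : Space n => (cutoff (1 * ‖ξ‖) : ℂ)) := by ext; simp
        rw [this, iteratedFDeriv_neg, Pi.neg_apply, norm_neg]
        exact h1.2 k hk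
      have := (symbolBound_const K (1 : ℂ) ξ).add h2
      simpa using this
    have hcd : ContDiff ℝ K h := by
      rw [contDiff_iff_contDiffAt]
      intro ξ
      rcases eq_or_ne ξ 0 with rfl | hξ
      · exact contDiffAt_const.congr_of_eventuallyEq (hsmall 0 (by simp))
      · exact (hSB ξ hξ).1
    have hhc : HasCompactSupport h := hcs.mul_left
    have hhigh : ‖𝓕 h y‖ ≤ A * (D * B₂) := by
      have h1 := pow_mul_norm_fourier_le hcd hhc y
      rw [hy, one_pow, one_mul] at h1
      refine h1.trans ?_
      rw [hB₂, ← integral_const_mul, ← integral_const_mul]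
      refine integral_mono_of_nonneg (Eventually.of_forall fun x => norm_nonneg _)
        ((hI2.const_mul D).const_mul A) (Eventually.of_forall fun ξ => ?_)
      simp only
      rcases lt_or_ge ‖ξ‖ 1 with hlt | hge
      · rw [((hsmall ξ hlt).iteratedFDeriv ℝ K).eq_of_nhds]
        rw [iteratedFDeriv_const_of_ne (by omega)]
        simp only [Pi.zero_apply, norm_zero]
        positivity
      · have hξ : ξ ≠ 0 := by rintro rfl; simp at hge; linarith
        have hpos : 0 < ‖ξ‖ := norm_pos_iff.2 hξ
        have h2 := (hSB ξ hξ).2 K le_rfl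
        rw [← le_div_iff₀ (by positivity)] at h2
        refine h2.trans ?_
        have h3 : ‖ξ‖ ^ (-α) / ‖ξ‖ ^ K = ‖ξ‖ ^ (-(α + K)) := by
          rw [← Real.rpow_natCast, ← Real.rpow_sub hpos]; congr 1; ring
        have h4 : ‖ξ‖ ^ (-(α + K)) ≤ 2 ^ (α + K) * (1 + ‖ξ‖) ^ (-(α + K)) := by
          have : (1 + ‖ξ‖) / 2 ≤ ‖ξ‖ := by linarith
          calc _ ≤ ((1 + ‖ξ‖) / 2) ^ (-(α + K)) :=
                Real.rpow_le_rpow_of_nonpos (by positivity) this (by linarith)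
            _ = _ := by
                rw [Real.div_rpow (by positivity) (by norm_num), Real.rpow_neg (by norm_num : (0:ℝ) ≤ 2)]
                field_simp
        calc 2 ^ K * (1 + M * Cκ) * (A * ‖ξ‖ ^ (-α)) / ‖ξ‖ ^ K
            = 2 ^ K * (1 + M * Cκ) * A * (‖ξ‖ ^ (-α) / ‖ξ‖ ^ K) := by ring
          _ ≤ 2 ^ K * (1 + M * Cκ) * A * (2 ^ (α + K) * (1 + ‖ξ‖) ^ (-(α + K))) := by
              rw [h3]; gcongr
          _ = _ := by rw [hD]; ring
    have hsum : 𝓕 σ y = 𝓕 (fun ξ : Space n => (cutoff ‖ξ‖ : ℂ) * σ ξ) y + 𝓕 h y := by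
      have hi1 : Integrable (fun ξ : Space n => (cutoff ‖ξ‖ : ℂ) * σ ξ) := by
        refine hint.bdd_mul (c := 1) ?_ (Eventually.of_forall fun x => ?_)
        · exact ((contDiff_ofReal_cutoff (m := 0)).continuous.comp
            continuous_norm).aestronglyMeasurable
        · rw [Complex.norm_real, Real.norm_of_nonneg (cutoff_nonneg _)]
          exact cutoff_le_one _
      have hi2 : Integrable h := hcd.continuous.integrable_of_hasCompactSupport hhc
      rw [← fourier_add_of_integrable hi1 hi2]
      refine congrFun (congrArg _ (funext fun x => ?_)) y
      simp only [hh, one_mul]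
      ring
    rw [hsum]
    refine (norm_add_le _ _).trans ?_
    linarith
  have hunit : ∀ (σ : Space n → ℂ) (A : ℝ), 0 ≤ A → Integrable σ →
      (∀ ξ, ξ ≠ 0 → SymbolBound K (A * ‖ξ‖ ^ (-α)) σ ξ) →
      ∀ y, ‖y‖ = 1 → ‖𝓕 σ y‖ ≤ 2 ^ K * (M * Cκ) * A * (B₁ + D * B₂) := by
    intro σ A hA hint hσ y hy
    -- Truncations at radius of order N+1 obey the symbol bounds uniformly in N, so compact support
    -- is removed by dominated convergence.
    let σ' : ℕ → Space n → ℂ := fun N ξ => (cutoff ((N + 1 : ℝ)⁻¹ * ‖ξ‖) : ℂ) * σ ξ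
    have hb : ∀ N, ‖𝓕 (σ' N) y‖ ≤ 2 ^ K * (M * Cκ) * A * (B₁ + D * B₂) := by
      intro N
      have hN : (0 : ℝ) < (N + 1 : ℝ)⁻¹ := by positivity
      refine hcp (σ' N) (2 ^ K * (M * Cκ) * A) (by positivity) ?_ ?_ ?_ y hy
      · refine HasCompactSupport.intro (isCompact_closedBall (0 : Space n) (2 * (N + 1))) ?_
        intro x hx
        have h2 : (2 : ℝ) ≤ (N + 1 : ℝ)⁻¹ * ‖x‖ := by
          rw [mem_closedBall_zero_iff, not_le] at hx
          rw [inv_mul_eq_div, le_div_iff₀ (by positivity)]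
          exact hx.le
        simp [σ', cutoff_of_two_le h2]
      · refine hint.bdd_mul (c := 1) ?_ (Eventually.of_forall fun x => ?_)
        · exact ((contDiff_ofReal_cutoff (m := 0)).continuous.comp
            (continuous_const.mul continuous_norm)).aestronglyMeasurable
        · rw [Complex.norm_real, Real.norm_of_nonneg (cutoff_nonneg _)]
          exact cutoff_le_one _
      · intro ξ hξ
        exact ((hκ _ hN ξ hξ).mul (hσ ξ hξ)).mono (le_of_eq (by ring))
    have ht : Tendsto (fun N => 𝓕 (σ' N) y) atTop (𝓝 (𝓕 σ y)) := by
      simp only [Real.fourier_eq']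
      have he : Continuous fun v : Space n =>
          Complex.exp (((-2 * Real.pi * inner ℝ v y : ℝ) : ℂ) * Complex.I) := by fun_prop
      refine tendsto_integral_of_dominated_convergence (fun x => ‖σ x‖) (fun N => ?_) hint.norm
        (fun N => Eventually.of_forall fun x => ?_) (Eventually.of_forall fun x => ?_)
      · refine AEStronglyMeasurable.smul he.aestronglyMeasurable (AEStronglyMeasurable.mul ?_ hint.1)
        exact ((contDiff_ofReal_cutoff (m := 0)).continuous.comp
            (continuous_const.mul continuous_norm)).aestronglyMeasurable
      · rw [norm_smul, Complex.norm_exp_ofReal_mul_I, one_mul, norm_mul, Complex.norm_real,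
          Real.norm_of_nonneg (cutoff_nonneg _)]
        exact mul_le_of_le_one_left (norm_nonneg _) (cutoff_le_one _)
      · refine Tendsto.congr' ?_ tendsto_const_nhds
        obtain ⟨N₀, hN₀⟩ := exists_nat_gt ‖x‖
        filter_upwards [eventually_ge_atTop N₀] with N hN
        have : (N₀ : ℝ) ≤ N := by exact_mod_cast hN
        have h1 : (N + 1 : ℝ)⁻¹ * ‖x‖ ≤ 1 := by
          rw [inv_mul_eq_div, div_le_one (by positivity)]
          linarith
        simp [σ', cutoff_of_le_one h1]
    exact le_of_tendsto ht.norm (Eventually.of_forall hb)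
  refine ⟨2 ^ K * (M * Cκ) * (B₁ + D * B₂), by positivity, fun σ A hA hint hσ y hy => ?_⟩
  set ρ := ‖y‖ with hρ
  have hρ0 : 0 < ρ := norm_pos_iff.2 hy
  -- The dilate z ↦ σ(ρ⁻¹ z) satisfies the hypotheses with A ρ^α in place of A, and its transform at
  -- y/ρ is ρ^n 𝓕 σ(y).
  have h1 := hunit (fun z => σ (ρ⁻¹ • z)) (A * ρ ^ α) (by positivity)
    (hint.comp_smul (inv_ne_zero hρ0.ne')) (fun z hz => ?_) (ρ⁻¹ • y)
    (by rw [norm_smul, norm_inv, Real.norm_of_nonneg hρ0.le]; field_simp; exact hρ.symm)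
  · rw [fourier_comp_smul _ (inv_pos.2 hρ0), inv_inv, smul_smul, mul_inv_cancel₀ hρ0.ne', one_smul,
      hfr, norm_mul, Complex.norm_real, Real.norm_of_nonneg (by positivity)] at h1
    have h2 : ρ ^ (α - n) = ρ ^ α / ρ ^ n := by
      rw [Real.rpow_sub hρ0, Real.rpow_natCast]
    rw [h2, ← mul_div_assoc, le_div_iff₀ (by positivity)]
    linarith
  · have hz' : ρ⁻¹ • z ≠ 0 := smul_ne_zero (inv_ne_zero hρ0.ne') hz
    refine (symbolBound_comp_smul (inv_ne_zero hρ0.ne') (hσ _ hz')).mono (le_of_eq ?_)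
    rw [norm_smul, norm_inv, Real.norm_of_nonneg hρ0.le, Real.mul_rpow (by positivity)
      (norm_nonneg _), Real.inv_rpow hρ0.le, Real.rpow_neg hρ0.le, inv_inv]
    ring

/-! ### One-dimensional oscillatory integrals with endpoint singularities. -/

open scoped ContDiff

section Oscillatory

open Complex in
theorem norm_exp_ofReal_mul_I' (r t : ℝ) : ‖exp ((r * t : ℝ) * I)‖ = 1 :=
  Complex.norm_exp_ofReal_mul_I _

theorem hasDerivAt_exp_div {r : ℝ} (hr : r ≠ 0) (t : ℝ) :
    HasDerivAt (fun t : ℝ => Complex.exp ((r * t : ℝ) * Complex.I) / (r * Complex.I))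
      (Complex.exp ((r * t : ℝ) * Complex.I)) t := by
  have h1 : HasDerivAt (fun t : ℝ => ((r * t : ℝ) : ℂ) * Complex.I) (r * Complex.I) t := by
    have := (((hasDerivAt_id t).const_mul r).ofReal_comp).mul_const Complex.I
    simpa using this
  have h2 := h1.cexp.div_const (r * Complex.I)
  have hne : (r : ℂ) * Complex.I ≠ 0 := mul_ne_zero (by exact_mod_cast hr) Complex.I_ne_zero
  rwa [mul_div_assoc, div_self hne, mul_one] at h2

theorem intervalIntegrable_complex_ofReal {f : ℝ → ℝ} {a b : ℝ}
    (h : IntervalIntegrable f volume a b) :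
    IntervalIntegrable (fun x => (f x : ℂ)) volume a b :=
  ⟨h.1.ofReal, h.2.ofReal⟩

/-- The interval is cut at ρ = 1/|r|. On [0, ρ] the absolute value integrates to a multiple of
ρ^(1+a). On [ρ, 1] one integration by parts gains ρ, and v^a is monotone with values at most ρ^a, so
its total variation costs only ρ^a. -/
theorem norm_integral_rpow_mul_exp_le {a Q r : ℝ} (ha : -1 < a) (ha0 : a ≤ 0) (hr : 1 ≤ |r|)
    {q q' : ℝ → ℂ} (hq : ∀ v ∈ Set.Icc (0 : ℝ) 1, HasDerivAt q (q' v) v)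
    (hq' : ContinuousOn q' (Set.Icc 0 1)) (hQ : ∀ v ∈ Set.Icc (0 : ℝ) 1, ‖q v‖ ≤ Q)
    (hQ' : ∀ v ∈ Set.Icc (0 : ℝ) 1, ‖q' v‖ ≤ Q) :
    ‖∫ v in (0 : ℝ)..1, ((v ^ a : ℝ) : ℂ) * q v * Complex.exp ((r * v : ℝ) * Complex.I)‖ ≤
      (1 / (1 + a) + 4) * Q * |r| ^ (-1 - a) := by
  have hr0 : r ≠ 0 := by rintro rfl; simp at hr; linarith
  have hrpos : 0 < |r| := by linarith
  set ρ := |r|⁻¹ with hρ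
  have hρ0 : 0 < ρ := by positivity
  have hρ1 : ρ ≤ 1 := inv_le_one_of_one_le₀ hr
  have hQ0 : 0 ≤ Q := (norm_nonneg _).trans (hQ 0 (by simp))
  have hρa : |r| ^ (-1 - a) = ρ * ρ ^ a := by
    rw [hρ, Real.inv_rpow hrpos.le, ← Real.rpow_neg hrpos.le, ← Real.rpow_neg_one,
      ← Real.rpow_add hrpos]; congr 1
  have hqc : ContinuousOn q (Set.Icc 0 1) := fun v hv => (hq v hv).continuousAt.continuousWithinAt
  have hec : Continuous fun v : ℝ => Complex.exp ((r * v : ℝ) * Complex.I) := by fun_prop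
  have hint : ∀ c d : ℝ, 0 ≤ c → c ≤ d → d ≤ 1 → IntervalIntegrable
      (fun v : ℝ => ((v ^ a : ℝ) : ℂ) * q v * Complex.exp ((r * v : ℝ) * Complex.I))
      volume c d := by
    intro c d hc hcd hd
    have h1 : IntervalIntegrable (fun v : ℝ => ((v ^ a : ℝ) : ℂ)) volume c d :=
      intervalIntegrable_complex_ofReal (intervalIntegral.intervalIntegrable_rpow' ha)
    have hs : Set.uIcc c d ⊆ Set.Icc 0 1 := by
      rw [Set.uIcc_of_le hcd]; exact Set.Icc_subset_Icc hc hd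
    exact (h1.mul_continuousOn (hqc.mono hs)).mul_continuousOn hec.continuousOn
  rw [← intervalIntegral.integral_add_adjacent_intervals (hint 0 ρ le_rfl hρ0.le hρ1)
    (hint ρ 1 hρ0.le hρ1 le_rfl)]
  have hA : ‖∫ v in (0 : ℝ)..ρ, ((v ^ a : ℝ) : ℂ) * q v * Complex.exp ((r * v : ℝ) * Complex.I)‖ ≤
      1 / (1 + a) * Q * (ρ * ρ ^ a) := by
    have h1 : ∀ v ∈ Set.Ioc 0 ρ,
        ‖((v ^ a : ℝ) : ℂ) * q v * Complex.exp ((r * v : ℝ) * Complex.I)‖ ≤ Q * v ^ a := by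
      intro v hv
      rw [norm_mul, norm_mul, norm_exp_ofReal_mul_I', mul_one, Complex.norm_real,
        Real.norm_of_nonneg (Real.rpow_nonneg hv.1.le _), mul_comm]
      gcongr
      · exact Real.rpow_nonneg hv.1.le _
      · exact hQ v ⟨hv.1.le, hv.2.trans hρ1⟩
    have h2 := intervalIntegral.norm_integral_le_of_norm_le hρ0.le
      (Eventually.of_forall h1)
      ((intervalIntegral.intervalIntegrable_rpow' (a := 0) (b := ρ) ha).const_mul Q)
    refine h2.trans (le_of_eq ?_)
    rw [intervalIntegral.integral_const_mul, integral_rpow (Or.inl ha),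
      Real.zero_rpow (by linarith), Real.rpow_add hρ0, Real.rpow_one]
    have : a + 1 ≠ 0 := by linarith
    rw [add_comm 1 a]
    field_simp
    ring
  have hB : ‖∫ v in ρ..1, ((v ^ a : ℝ) : ℂ) * q v * Complex.exp ((r * v : ℝ) * Complex.I)‖ ≤
      4 * Q * (ρ * ρ ^ a) := by
    have hpos : ∀ v ∈ Set.Icc ρ 1, 0 < v := fun v hv => hρ0.trans_le hv.1
    have hmem : ∀ v ∈ Set.Icc ρ 1, v ∈ Set.Icc (0 : ℝ) 1 := fun v hv => ⟨(hpos v hv).le, hv.2⟩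
    have hu : ∀ v ∈ Set.uIcc ρ 1, HasDerivAt (fun v : ℝ => ((v ^ a : ℝ) : ℂ) * q v)
        (((a * v ^ (a - 1) : ℝ) : ℂ) * q v + ((v ^ a : ℝ) : ℂ) * q' v) v := by
      intro v hv
      rw [Set.uIcc_of_le hρ1] at hv
      exact (Real.hasDerivAt_rpow_const (Or.inl (hpos v hv).ne')).ofReal_comp.mul
        (hq v (hmem v hv))
    have hcr : ∀ b : ℝ, ContinuousOn (fun v : ℝ => v ^ b) (Set.Icc ρ 1) := fun b v hv =>
      (Real.continuousAt_rpow_const _ _ (Or.inl (hpos v hv).ne')).continuousWithinAt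
    have hu'c : ContinuousOn (fun v : ℝ => ((a * v ^ (a - 1) : ℝ) : ℂ) * q v +
        ((v ^ a : ℝ) : ℂ) * q' v) (Set.Icc ρ 1) := by
      have hc1 : ContinuousOn (fun v : ℝ => ((a * v ^ (a - 1) : ℝ) : ℂ)) (Set.Icc ρ 1) :=
        Complex.continuous_ofReal.comp_continuousOn ((hcr (a - 1)).const_mul a)
      have hc2 : ContinuousOn (fun v : ℝ => ((v ^ a : ℝ) : ℂ)) (Set.Icc ρ 1) :=
        Complex.continuous_ofReal.comp_continuousOn (hcr a)
      exact (hc1.mul (hqc.mono hmem)).add (hc2.mul (hq'.mono hmem))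
    have hparts := intervalIntegral.integral_mul_deriv_eq_deriv_mul hu
      (fun v _ => hasDerivAt_exp_div hr0 v)
      ((Set.uIcc_of_le hρ1 ▸ hu'c : ContinuousOn _ (Set.uIcc ρ 1)).intervalIntegrable)
      (hec.intervalIntegrable _ _)
    rw [hparts]
    have hE : ∀ t : ℝ, ‖Complex.exp ((r * t : ℝ) * Complex.I) / (r * Complex.I)‖ = ρ := by
      intro t
      rw [norm_div, norm_exp_ofReal_mul_I', norm_mul, Complex.norm_I, mul_one, Complex.norm_real,
        Real.norm_eq_abs, one_div]
    have hρa1 : 1 ≤ ρ ^ a := Real.one_le_rpow_of_pos_of_le_one_of_nonpos hρ0 hρ1 ha0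
    have hle : ∀ v ∈ Set.Icc ρ 1, v ^ a ≤ ρ ^ a := fun v hv =>
      Real.rpow_le_rpow_of_nonpos hρ0 hv.1 ha0
    have hb1 : ‖(((1 : ℝ) ^ a : ℝ) : ℂ) * q 1 *
        (Complex.exp ((r * 1 : ℝ) * Complex.I) / (r * Complex.I))‖ ≤ Q * (ρ * ρ ^ a) := by
      rw [norm_mul, hE, norm_mul, Real.one_rpow, Complex.ofReal_one, norm_one, one_mul]
      have := hQ 1 (by simp)
      calc _ ≤ Q * (ρ * 1) := by rw [mul_one]; gcongr
        _ ≤ _ := by gcongr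
    have hb2 : ‖((ρ ^ a : ℝ) : ℂ) * q ρ *
        (Complex.exp ((r * ρ : ℝ) * Complex.I) / (r * Complex.I))‖ ≤ Q * (ρ * ρ ^ a) := by
      rw [norm_mul, hE, norm_mul, Complex.norm_real, Real.norm_of_nonneg (by positivity)]
      have := hQ ρ ⟨hρ0.le, hρ1⟩
      calc _ ≤ ρ ^ a * Q * ρ := by gcongr
        _ = _ := by ring
    have hb3 : ‖∫ v in ρ..1, (((a * v ^ (a - 1) : ℝ) : ℂ) * q v + ((v ^ a : ℝ) : ℂ) * q' v) *
        (Complex.exp ((r * v : ℝ) * Complex.I) / (r * Complex.I))‖ ≤ 2 * Q * (ρ * ρ ^ a) := by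
      have hbd : ∀ v ∈ Set.Ioc ρ 1,
          ‖(((a * v ^ (a - 1) : ℝ) : ℂ) * q v + ((v ^ a : ℝ) : ℂ) * q' v) *
          (Complex.exp ((r * v : ℝ) * Complex.I) / (r * Complex.I))‖ ≤
          Q * ρ * (-(a * v ^ (a - 1)) + ρ ^ a) := by
        intro v hv
        have hv' : v ∈ Set.Icc ρ 1 := ⟨hv.1.le, hv.2⟩
        have hv0 := hpos v hv'
        rw [norm_mul, hE]
        have h1 : ‖((a * v ^ (a - 1) : ℝ) : ℂ) * q v‖ ≤ -(a * v ^ (a - 1)) * Q := by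
          rw [norm_mul, Complex.norm_real, Real.norm_of_nonpos
            (mul_nonpos_of_nonpos_of_nonneg ha0 (by positivity))]
          have : 0 ≤ -(a * v ^ (a - 1)) :=
            neg_nonneg.2 (mul_nonpos_of_nonpos_of_nonneg ha0 (by positivity))
          gcongr
          exact hQ v (hmem v hv')
        have h2 : ‖((v ^ a : ℝ) : ℂ) * q' v‖ ≤ ρ ^ a * Q := by
          rw [norm_mul, Complex.norm_real, Real.norm_of_nonneg (by positivity)]
          exact mul_le_mul (hle v hv') (hQ' v (hmem v hv')) (norm_nonneg _) (by positivity)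
        calc _ ≤ (-(a * v ^ (a - 1)) * Q + ρ ^ a * Q) * ρ := by
              gcongr; exact (norm_add_le _ _).trans (add_le_add h1 h2)
          _ = _ := by ring
      -- Because a ≤ 0, the quantity -a v^(a-1) is nonnegative and has primitive -v^a; the majorant
      -- is therefore integrated exactly.
      have hder : ∀ v ∈ Set.uIcc ρ 1, HasDerivAt (fun v : ℝ => Q * ρ * (-(v ^ a) + ρ ^ a * v))
          (Q * ρ * (-(a * v ^ (a - 1)) + ρ ^ a)) v := by
        intro v hv
        rw [Set.uIcc_of_le hρ1] at hv
        have h1 := (Real.hasDerivAt_rpow_const (p := a) (Or.inl (hpos v hv).ne')).neg.add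
          ((hasDerivAt_id v).const_mul (ρ ^ a))
        simpa using h1.const_mul (Q * ρ)
      have hci : IntervalIntegrable (fun v : ℝ => Q * ρ * (-(a * v ^ (a - 1)) + ρ ^ a))
          volume ρ 1 := by
        refine ContinuousOn.intervalIntegrable ?_
        rw [Set.uIcc_of_le hρ1]
        exact ((((hcr (a - 1)).const_mul a).neg).add continuousOn_const).const_mul _
      refine (intervalIntegral.norm_integral_le_of_norm_le hρ1 (Eventually.of_forall hbd)
        hci).trans ?_
      rw [intervalIntegral.integral_eq_sub_of_hasDerivAt hder hci, Real.one_rpow]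
      have h5 : 0 ≤ Q * ρ := by positivity
      have h6 : 0 ≤ ρ ^ a * ρ := by positivity
      nlinarith [mul_nonneg h5 h6]
    calc _ ≤ Q * (ρ * ρ ^ a) + Q * (ρ * ρ ^ a) + 2 * Q * (ρ * ρ ^ a) :=
          (norm_sub_le _ _).trans (add_le_add ((norm_sub_le _ _).trans (add_le_add hb1 hb2)) hb3)
      _ = _ := by ring
  rw [hρa]
  calc _ ≤ 1 / (1 + a) * Q * (ρ * ρ ^ a) + 4 * Q * (ρ * ρ ^ a) :=
        (norm_add_le _ _).trans (add_le_add hA hB)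
    _ = _ := by ring

theorem one_sub_sq_rpow {u b : ℝ} (h : u ∈ Set.Icc (-1 : ℝ) 1) :
    (1 - u ^ 2) ^ b = (1 - u) ^ b * (1 + u) ^ b := by
  rw [← Real.mul_rpow (by linarith [h.2]) (by linarith [h.1])]
  congr 1; ring

theorem intervalIntegrable_one_sub_sq_rpow {b : ℝ} (hb : -1 < b) :
    IntervalIntegrable (fun u : ℝ => (1 - u ^ 2) ^ b) volume (-1) 1 := by
  have h1 : IntervalIntegrable (fun u : ℝ => (1 - u ^ 2) ^ b) volume 0 1 := by
    have h2 : IntervalIntegrable (fun u : ℝ => (1 - u) ^ b) volume 0 1 := by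
      have := (intervalIntegral.intervalIntegrable_rpow' (a := 1) (b := 0) hb).comp_sub_left 1
      simpa using this
    have h3 : ContinuousOn (fun u : ℝ => (1 + u) ^ b) (Set.uIcc 0 1) := by
      rw [Set.uIcc_of_le zero_le_one]
      intro u hu
      exact ((continuousAt_const.add continuousAt_id).rpow_const
        (Or.inl (show (1 : ℝ) + u ≠ 0 by linarith [hu.1]))).continuousWithinAt
    refine (h2.mul_continuousOn h3).congr ?_
    rw [Set.uIoc_of_le zero_le_one]
    intro u hu
    exact (one_sub_sq_rpow ⟨by linarith [hu.1], hu.2⟩).symm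
  have h2 : IntervalIntegrable (fun u : ℝ => (1 - u ^ 2) ^ b) volume (-1) 0 := by
    have := ((IntervalIntegrable.iff_comp_neg).1 h1).symm
    simpa using this
  exact h2.trans h1

/-- The substitution u = 1 - v moves the singular endpoint to 0. There (1-u²)^a = v^a (2-v)^a, and
the second factor is smooth on [0, 1] and joins the amplitude. -/
theorem exists_norm_integral_half_le {a : ℝ} (ha : -1 < a) (ha0 : a ≤ 0) {p : ℝ → ℂ}
    (hp : ContDiff ℝ 1 p) : ∃ C : ℝ, 0 ≤ C ∧ ∀ r : ℝ, 1 ≤ |r| →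
      ‖∫ u in (0 : ℝ)..1, p u * ((1 - u ^ 2) ^ a : ℝ) * Complex.exp ((r * u : ℝ) * Complex.I)‖ ≤
        C * |r| ^ (-1 - a) := by
  set q : ℝ → ℂ := fun v => p (1 - v) * (((2 - v) ^ a : ℝ) : ℂ) with hq
  set q' : ℝ → ℂ := fun v => -(deriv p (1 - v)) * (((2 - v) ^ a : ℝ) : ℂ) +
    p (1 - v) * ((-(a * (2 - v) ^ (a - 1)) : ℝ) : ℂ) with hq'
  have hne : ∀ v ∈ Set.Icc (0 : ℝ) 1, (2 - v) ≠ 0 := fun v hv => by linarith [hv.2]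
  have hder : ∀ v ∈ Set.Icc (0 : ℝ) 1, HasDerivAt q (q' v) v := by
    intro v hv
    have h1 : HasDerivAt (fun v => p (1 - v)) (-(deriv p (1 - v))) v := by
      have := (hp.differentiable one_ne_zero (1 - v)).hasDerivAt.scomp v
        ((hasDerivAt_id v).const_sub 1)
      simpa [Function.comp_def] using this
    have h2 : HasDerivAt (fun v : ℝ => (2 - v) ^ a) (-(a * (2 - v) ^ (a - 1))) v := by
      have := ((hasDerivAt_id v).const_sub 2).rpow_const (p := a) (Or.inl (hne v hv))
      simpa using this
    exact h1.mul h2.ofReal_comp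
  have hcr : ∀ b : ℝ, ContinuousOn (fun v : ℝ => (2 - v) ^ b) (Set.Icc 0 1) := fun b v hv =>
    ((continuousAt_const.sub continuousAt_id).rpow_const (Or.inl (hne v hv))).continuousWithinAt
  have hc' : ContinuousOn q' (Set.Icc 0 1) := by
    have hpd : Continuous fun v => deriv p (1 - v) :=
      (hp.continuous_deriv le_rfl).comp (continuous_const.sub continuous_id)
    have hpc : Continuous fun v => p (1 - v) := hp.continuous.comp (continuous_const.sub continuous_id)
    refine (hpd.neg.continuousOn.mul (Complex.continuous_ofReal.comp_continuousOn (hcr a))).add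
      (hpc.continuousOn.mul (Complex.continuous_ofReal.comp_continuousOn
        (((hcr (a - 1)).const_mul a).neg)))
  have hc : ContinuousOn q (Set.Icc 0 1) := fun v hv => (hder v hv).continuousAt.continuousWithinAt
  obtain ⟨Q₁, hQ₁⟩ := isCompact_Icc.exists_bound_of_continuousOn hc
  obtain ⟨Q₂, hQ₂⟩ := isCompact_Icc.exists_bound_of_continuousOn hc'
  have hQ0 : 0 ≤ Q₁ := (norm_nonneg _).trans (hQ₁ 0 (by simp))
  have ha1 : 0 < 1 + a := by linarith
  refine ⟨(1 / (1 + a) + 4) * max Q₁ Q₂, by positivity, fun r hr => ?_⟩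
  have h1 := norm_integral_rpow_mul_exp_le (r := -r) ha ha0 (by rwa [abs_neg]) hder hc'
    (fun v hv => (hQ₁ v hv).trans (le_max_left _ _))
    (fun v hv => (hQ₂ v hv).trans (le_max_right _ _))
  rw [abs_neg] at h1
  refine le_trans (le_of_eq ?_) h1
  have h2 := intervalIntegral.integral_comp_sub_left (a := (0 : ℝ)) (b := 1)
    (fun u : ℝ => p u * ((1 - u ^ 2) ^ a : ℝ) * Complex.exp ((r * u : ℝ) * Complex.I)) 1
  rw [sub_self, sub_zero] at h2
  rw [← h2]
  have h3 : ∀ v ∈ Set.uIcc (0 : ℝ) 1, p (1 - v) * ((1 - (1 - v) ^ 2) ^ a : ℝ) *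
      Complex.exp ((r * (1 - v) : ℝ) * Complex.I) = Complex.exp ((r * 1 : ℝ) * Complex.I) *
      (((v ^ a : ℝ) : ℂ) * q v * Complex.exp ((-r * v : ℝ) * Complex.I)) := by
    intro v hv
    rw [Set.uIcc_of_le zero_le_one] at hv
    have e1 : (1 - (1 - v) ^ 2) ^ a = v ^ a * (2 - v) ^ a := by
      rw [← Real.mul_rpow hv.1 (by linarith [hv.2])]; congr 1; ring
    have e2 : Complex.exp ((r * (1 - v) : ℝ) * Complex.I) =
        Complex.exp ((r * 1 : ℝ) * Complex.I) * Complex.exp ((-r * v : ℝ) * Complex.I) := by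
      rw [← Complex.exp_add]; congr 1; push_cast; ring
    rw [e1, e2, hq]; push_cast; ring
  rw [intervalIntegral.integral_congr h3, intervalIntegral.integral_const_mul, norm_mul,
    norm_exp_ofReal_mul_I', one_mul]

/-- Integration by parts lowers a by one and gains a factor 1/|r|; boundary terms vanish as long as
a > 0. The induction ends with -1 < a ≤ 0, where each endpoint is treated separately. A general
amplitude p is carried because each step changes it. -/
theorem exists_norm_integral_one_sub_sq_rpow_le (m : ℕ) : ∀ (a : ℝ), -1 < a → a ≤ m →
    ∀ p : ℝ → ℂ, ContDiff ℝ ∞ p → ∃ C : ℝ, 0 ≤ C ∧ ∀ r : ℝ, 1 ≤ |r| →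
      ‖∫ u in (-1 : ℝ)..1, p u * ((1 - u ^ 2) ^ a : ℝ) * Complex.exp ((r * u : ℝ) * Complex.I)‖ ≤
        C * |r| ^ (-1 - a) := by
  have hint : ∀ (b : ℝ), -1 < b → ∀ (p : ℝ → ℂ), Continuous p → ∀ r : ℝ, IntervalIntegrable
      (fun u : ℝ => p u * ((1 - u ^ 2) ^ b : ℝ) * Complex.exp ((r * u : ℝ) * Complex.I))
      volume (-1) 1 := by
    intro b hb p hp r
    have hec : Continuous fun v : ℝ => Complex.exp ((r * v : ℝ) * Complex.I) := by fun_prop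
    exact ((intervalIntegrable_complex_ofReal (intervalIntegrable_one_sub_sq_rpow hb)).continuousOn_mul
      hp.continuousOn).mul_continuousOn hec.continuousOn
  induction m with
  | zero =>
    intro a ha ha0 p hp
    simp only [Nat.cast_zero] at ha0
    have hp1 : ContDiff ℝ 1 p := hp.of_le (by exact_mod_cast le_top)
    obtain ⟨C₁, hC₁, h₁⟩ := exists_norm_integral_half_le ha ha0 hp1
    obtain ⟨C₂, hC₂, h₂⟩ := exists_norm_integral_half_le ha ha0 (p := fun u => p (-u))
      (hp1.comp contDiff_neg)
    refine ⟨C₂ + C₁, by positivity, fun r hr => ?_⟩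
    have hi := hint a ha p hp.continuous r
    rw [← intervalIntegral.integral_add_adjacent_intervals (b := 0)
      (hi.mono_set (Set.uIcc_subset_uIcc (by simp) (by simp)))
      (hi.mono_set (Set.uIcc_subset_uIcc (by simp) (by simp))), add_mul]
    refine (norm_add_le _ _).trans (add_le_add ?_ (h₁ r hr))
    have h3 := h₂ (-r) (by rwa [abs_neg])
    rw [abs_neg] at h3
    refine le_trans (le_of_eq ?_) h3
    have h4 := intervalIntegral.integral_comp_neg (a := (0 : ℝ)) (b := 1)
      (fun u : ℝ => p u * ((1 - u ^ 2) ^ a : ℝ) * Complex.exp ((r * u : ℝ) * Complex.I))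
    rw [neg_zero] at h4
    rw [← h4]
    simp
  | succ m ih =>
    intro a ha ham p hp
    rcases le_or_gt a m with h | h
    · exact ih a ha h p hp
    have ha0 : 0 < a := lt_of_le_of_lt (Nat.cast_nonneg m) h
    push_cast at ham
    -- The derivative of p (1-u²)^a is p₁ (1-u²)^(a-1), an integrand of the same form.
    set p₁ : ℝ → ℂ := fun u => deriv p u * ((1 - u ^ 2 : ℝ) : ℂ) + ((-2 * a * u : ℝ) : ℂ) * p u
      with hp₁
    have hp₁c : ContDiff ℝ ∞ p₁ := by
      have h1 : ContDiff ℝ ∞ (deriv p) := (contDiff_infty_iff_deriv.1 hp).2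
      have h2 : ContDiff ℝ ∞ (fun u : ℝ => ((1 - u ^ 2 : ℝ) : ℂ)) :=
        Complex.ofRealCLM.contDiff.comp (contDiff_const.sub (contDiff_id.pow 2))
      have h3 : ContDiff ℝ ∞ (fun u : ℝ => ((-2 * a * u : ℝ) : ℂ)) :=
        Complex.ofRealCLM.contDiff.comp (contDiff_const.mul contDiff_id)
      exact (h1.mul h2).add (h3.mul hp)
    obtain ⟨C, hC, hCr⟩ := ih (a - 1) (by linarith) (by linarith) p₁ hp₁c
    refine ⟨C, hC, fun r hr => ?_⟩
    have hr0 : r ≠ 0 := by rintro rfl; simp at hr; linarith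
    have hrpos : 0 < |r| := by linarith
    have hu : ∀ u ∈ Set.Ioo (min (-1 : ℝ) 1) (max (-1) 1),
        HasDerivAt (fun u => p u * ((1 - u ^ 2) ^ a : ℝ))
          (p₁ u * ((1 - u ^ 2) ^ (a - 1) : ℝ)) u := by
      intro u hu
      have hu1 : u ∈ Set.Ioo (-1 : ℝ) 1 := by simpa using hu
      have hpos : 0 < 1 - u ^ 2 := by nlinarith [hu1.1, hu1.2]
      have h1 : HasDerivAt (fun u : ℝ => (1 - u ^ 2) ^ a) (-(2 * u) * a * (1 - u ^ 2) ^ (a - 1)) u := by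
        have := (((hasDerivAt_id u).pow 2).const_sub 1).rpow_const (p := a) (Or.inl hpos.ne')
        simpa using this
      have h2 := (hp.differentiable (by simp) u).hasDerivAt.mul h1.ofReal_comp
      refine h2.congr_deriv ?_
      have h3 : (1 - u ^ 2) ^ a = (1 - u ^ 2) * (1 - u ^ 2) ^ (a - 1) := by
        rw [Real.rpow_sub_one hpos.ne']; field_simp
      rw [h3, hp₁]; push_cast; ring
    have hcont : ContinuousOn (fun u => p u * ((1 - u ^ 2) ^ a : ℝ)) (Set.uIcc (-1) 1) := by
      have : Continuous fun u : ℝ => (1 - u ^ 2) ^ a :=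
        (by fun_prop : Continuous fun u : ℝ => 1 - u ^ 2).rpow_const fun _ => Or.inr ha0.le
      exact (hp.continuous.mul (Complex.continuous_ofReal.comp this)).continuousOn
    have hec : Continuous fun v : ℝ => Complex.exp ((r * v : ℝ) * Complex.I) := by fun_prop
    have hparts := intervalIntegral.integral_mul_deriv_eq_deriv_mul_of_hasDerivAt hcont
      (v := fun t : ℝ => Complex.exp ((r * t : ℝ) * Complex.I) / (r * Complex.I))
      (by fun_prop) hu (fun v _ => hasDerivAt_exp_div hr0 v)
      ((intervalIntegrable_complex_ofReal (intervalIntegrable_one_sub_sq_rpow (by linarith))).continuousOn_mul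
        hp₁c.continuous.continuousOn) (hec.intervalIntegrable _ _)
    rw [hparts]
    have hz : (0 : ℝ) ^ a = 0 := Real.zero_rpow ha0.ne'
    simp only [one_pow, even_two, Even.neg_pow, sub_self, hz, Complex.ofReal_zero, mul_zero,
      zero_mul, zero_sub, norm_neg]
    simp only [← mul_div_assoc]
    rw [intervalIntegral.integral_div, norm_div, norm_mul, Complex.norm_I, mul_one,
      Complex.norm_real, Real.norm_eq_abs, div_le_iff₀ hrpos]
    refine (hCr r hr).trans (le_of_eq ?_)
    have : |r| ^ (-1 - (a - 1)) = |r| ^ (-1 - a) * |r| := by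
      rw [← Real.rpow_add_one hrpos.ne']; congr 1; ring
    rw [this]; ring

end Oscillatory

/-! ### The Fourier transform of the classical weight (1-|ξ|²)₊^β. -/

theorem posPow_of_nonpos {β t : ℝ} (h : t ≤ 0) : posPow β t = 0 := if_neg (not_lt.2 h)

theorem posPow_of_pos {β t : ℝ} (h : 0 < t) : posPow β t = t ^ β := if_pos h

theorem posPow_mul {β s t : ℝ} (hs : 0 < s) : posPow β (s * t) = s ^ β * posPow β t := by
  rcases le_or_gt t 0 with h | h
  · rw [posPow_of_nonpos h, posPow_of_nonpos (mul_nonpos_of_nonneg_of_nonpos hs.le h), mul_zero]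
  · rw [posPow_of_pos h, posPow_of_pos (by positivity), Real.mul_rpow hs.le h.le]

theorem posPow_succ (β t : ℝ) : posPow (β + 1) t = t * posPow β t := by
  rcases le_or_gt t 0 with h | h
  · rw [posPow_of_nonpos h, posPow_of_nonpos h, mul_zero]
  · rw [posPow_of_pos h, posPow_of_pos h, Real.rpow_add_one h.ne', mul_comm]

@[fun_prop]
theorem measurable_posPow (β : ℝ) : Measurable (posPow β) :=
  Measurable.ite measurableSet_Ioi (by fun_prop) measurable_const

/-- The classical Bochner-Riesz multiplier `(1 - |ξ|²)₊ ^ β`. -/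
def ballWeight {n : ℕ} (β : ℝ) (ξ : Space n) : ℂ := (posPow β (1 - ‖ξ‖ ^ 2) : ℝ)

theorem integrable_posPow_norm {n : ℕ} (hn : 1 ≤ n) {β : ℝ} (hβ : -1 < β) :
    Integrable (fun ξ : Space n => posPow β (1 - ‖ξ‖ ^ 2)) := by
  have : Nonempty (Fin n) := ⟨⟨0, hn⟩⟩
  rw [integrable_fun_norm_addHaar volume (f := fun r : ℝ => posPow β (1 - r ^ 2))]
  have h1 : IntegrableOn (fun u : ℝ => (1 - u ^ 2) ^ β) (Set.Ioc (-1) 1) :=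
    (intervalIntegrable_one_sub_sq_rpow hβ).1
  have h2 : Integrable ((Set.Ioc (-1 : ℝ) 1).indicator fun u : ℝ => (1 - u ^ 2) ^ β) :=
    IntegrableOn.integrable_indicator h1 measurableSet_Ioc
  refine Integrable.mono' h2.integrableOn ?_ ?_
  · exact (by fun_prop : Measurable fun y : ℝ =>
      y ^ (Module.finrank ℝ (Space n) - 1) • posPow β (1 - y ^ 2)).aestronglyMeasurable
  · filter_upwards [ae_restrict_mem measurableSet_Ioi] with y hy
    have hy0 : 0 < y := hy
    rcases lt_or_ge y 1 with h | h
    · rw [Set.indicator_of_mem (show y ∈ Set.Ioc (-1 : ℝ) 1 from ⟨by linarith, h.le⟩),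
        posPow_of_pos (by nlinarith), norm_smul,
        Real.norm_of_nonneg (by positivity), Real.norm_of_nonneg (Real.rpow_nonneg (by nlinarith) _)]
      exact mul_le_of_le_one_left (Real.rpow_nonneg (by nlinarith) _)
        (pow_le_one₀ hy0.le h.le)
    · rw [posPow_of_nonpos (by nlinarith), smul_zero, norm_zero]
      refine Set.indicator_nonneg (fun u hu => Real.rpow_nonneg ?_ _) _
      nlinarith [hu.1, hu.2]

theorem integrable_ballWeight {n : ℕ} (hn : 1 ≤ n) {β : ℝ} (hβ : -1 < β) :
    Integrable (ballWeight β : Space n → ℂ) :=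
  (integrable_posPow_norm hn hβ).ofReal

/-- The substitution w ↦ √t w. The gain k/2 in the exponent is what raises β to β + (n-1)/2 when the
ball is sliced by parallel hyperplanes. -/
theorem integral_posPow_sub_sum_sq {k : ℕ} (β : ℝ) {t : ℝ} (ht : 0 < t) :
    ∫ w : Fin k → ℝ, posPow β (t - ∑ i, w i ^ 2) =
      t ^ (β + k / 2) * ∫ w : Fin k → ℝ, posPow β (1 - ∑ i, w i ^ 2) := by
  have h1 := Measure.integral_comp_smul (volume : Measure (Fin k → ℝ))
    (fun w => posPow β (t - ∑ i, w i ^ 2)) (Real.sqrt t)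
  have hs : 0 < Real.sqrt t := Real.sqrt_pos.2 ht
  have h2 : ∀ w : Fin k → ℝ, posPow β (t - ∑ i, (Real.sqrt t • w) i ^ 2) =
      t ^ β * posPow β (1 - ∑ i, w i ^ 2) := by
    intro w
    rw [← posPow_mul ht]
    congr 1
    simp only [Pi.smul_apply, smul_eq_mul, mul_pow, Real.sq_sqrt ht.le, ← Finset.mul_sum]
    ring
  simp only [h2] at h1
  rw [integral_const_mul, Module.finrank_fin_fun, abs_of_pos (by positivity), smul_eq_mul,
    inv_mul_eq_div, eq_div_iff (by positivity)] at h1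
  rw [← h1, Real.rpow_add ht]
  have : t ^ ((k : ℝ) / 2) = Real.sqrt t ^ k := by
    rw [Real.sqrt_eq_rpow, ← Real.rpow_mul_natCast ht.le]; congr 1; ring
  rw [this]; ring

/-- The reflection in the hyperplane orthogonal to y - z exchanges y and z, leaves f invariant, and
commutes with the Fourier transform. -/
theorem fourier_comp_norm_eq {n : ℕ} (f : Space n → ℂ) (hf : ∀ ξ η, ‖ξ‖ = ‖η‖ → f ξ = f η)
    {y z : Space n} (h : ‖y‖ = ‖z‖) : 𝓕 f y = 𝓕 f z := by
  set A := (ℝ ∙ (y - z))ᗮ.reflection with hA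
  have h1 := Real.fourier_comp_linearIsometry A f y
  rw [Submodule.reflection_sub h] at h1
  rw [← h1]
  have h2 : f = f ∘ A := funext fun ξ => hf _ _ (A.norm_map ξ).symm
  rw [← h2]

/-- For a frequency on the first axis the phase depends on the first coordinate only, so Fubini
integrates out the other k coordinates. -/
theorem fourier_ballWeight_single {k : ℕ} {β : ℝ} (hβ : -1 < β) (ρ : ℝ) :
    𝓕 (ballWeight β : Space (k + 1) → ℂ) (EuclideanSpace.single 0 ρ) =
      ((∫ w : Fin k → ℝ, posPow β (1 - ∑ i, w i ^ 2) : ℝ) : ℂ) *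
      ∫ u in (-1 : ℝ)..1, 1 * ((1 - u ^ 2) ^ (β + k / 2) : ℝ) *
        Complex.exp ((-2 * Real.pi * ρ * u : ℝ) * Complex.I) := by
  set c := ∫ w : Fin k → ℝ, posPow β (1 - ∑ i, w i ^ 2) with hc
  set F : ℝ × (Fin k → ℝ) → ℂ := fun q =>
    Complex.exp ((-2 * Real.pi * ρ * q.1 : ℝ) * Complex.I) *
      (posPow β (1 - q.1 ^ 2 - ∑ i, q.2 i ^ 2) : ℝ) with hF
  let e : Space (k + 1) ≃ᵐ ℝ × (Fin k → ℝ) :=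
    (MeasurableEquiv.toLp 2 (Fin (k + 1) → ℝ)).symm.trans
      (MeasurableEquiv.piFinSuccAbove (fun _ : Fin (k + 1) => ℝ) 0)
  have he : MeasurePreserving e volume volume :=
    (EuclideanSpace.volume_preserving_symm_measurableEquiv_toLp _).trans
      (volume_preserving_piFinSuccAbove (fun _ : Fin (k + 1) => ℝ) 0)
  have he1 : ∀ ξ, (e ξ).1 = ξ 0 := fun ξ => rfl
  have he2 : ∀ ξ i, (e ξ).2 i = ξ i.succ := fun ξ i => rfl
  have hns : ∀ ξ : Space (k + 1), 1 - (e ξ).1 ^ 2 - ∑ i, (e ξ).2 i ^ 2 = 1 - ‖ξ‖ ^ 2 := by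
    intro ξ
    rw [EuclideanSpace.real_norm_sq_eq, Fin.sum_univ_succ]
    simp only [he1, he2]
    ring
  have hFe : ∀ ξ : Space (k + 1), F (e ξ) =
      Complex.exp ((-2 * Real.pi * inner ℝ ξ (EuclideanSpace.single 0 ρ) : ℝ) * Complex.I) •
        ballWeight β ξ := by
    intro ξ
    simp only [hF, hns, ballWeight, smul_eq_mul]
    congr 4
    rw [EuclideanSpace.inner_single_right, he1]
    simp
    ring
  have hint : Integrable F := by
    rw [← he.integrable_comp_emb e.measurableEmbedding]
    have : (F ∘ e) = fun ξ => Complex.exp ((-2 * Real.pi *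
        inner ℝ ξ (EuclideanSpace.single 0 ρ) : ℝ) * Complex.I) • ballWeight β ξ := funext hFe
    rw [this]
    simpa [Circle.smul_def, Real.fourierChar_apply] using
      (Real.fourierIntegral_convergent_iff (EuclideanSpace.single 0 ρ : Space (k + 1))).2
        (integrable_ballWeight (Nat.le_add_left 1 k) hβ)
  rw [Real.fourier_eq']
  simp only [← hFe]
  rw [he.integral_comp' (g := F)]
  rw [show (volume : Measure (ℝ × (Fin k → ℝ))) = (volume : Measure ℝ).prod volume from rfl,
    integral_prod F hint]
  have hin : ∀ u : ℝ, ∫ w : Fin k → ℝ, F (u, w) = (Set.Ioo (-1 : ℝ) 1).indicator (fun u =>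
      (c : ℂ) * (1 * ((1 - u ^ 2) ^ (β + k / 2) : ℝ) *
        Complex.exp ((-2 * Real.pi * ρ * u : ℝ) * Complex.I))) u := by
    intro u
    simp only [hF]
    rw [integral_const_mul, integral_complex_ofReal]
    by_cases hu : u ∈ Set.Ioo (-1 : ℝ) 1
    · rw [Set.indicator_of_mem hu, integral_posPow_sub_sum_sq β (by nlinarith [hu.1, hu.2])]
      push_cast
      ring
    · rw [Set.indicator_of_notMem hu]
      have h1 : 1 - u ^ 2 ≤ 0 := by
        rw [Set.mem_Ioo, not_and_or, not_lt, not_lt] at hu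
        rcases hu with h | h <;> nlinarith
      have : ∀ w : Fin k → ℝ, posPow β (1 - u ^ 2 - ∑ i, w i ^ 2) = 0 := fun w =>
        posPow_of_nonpos (by
          have : 0 ≤ ∑ i, w i ^ 2 := Finset.sum_nonneg fun i _ => sq_nonneg _
          linarith)
      simp [this]
  simp only [hin]
  rw [integral_indicator measurableSet_Ioo, integral_const_mul,
    intervalIntegral.integral_of_le (by norm_num), integral_Ioc_eq_integral_Ioo]

/-- Rotation puts y on the first axis, and the one-dimensional bound with a = β + (n-1)/2 applies:
-1 - a = -((n+1)/2 + β). -/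
theorem exists_norm_fourier_ballWeight_le {n : ℕ} (hn : 1 ≤ n) {β : ℝ} (hβ : -1 < β) :
    ∃ C : ℝ, 0 ≤ C ∧ ∀ y : Space n, 1 ≤ ‖y‖ →
      ‖𝓕 (ballWeight β : Space n → ℂ) y‖ ≤ C * ‖y‖ ^ (-((n + 1) / 2 + β)) := by
  obtain ⟨k, rfl⟩ : ∃ k, n = k + 1 := ⟨n - 1, by omega⟩
  have ha : -1 < β + k / 2 := by have : (0 : ℝ) ≤ k / 2 := by positivity
                                 linarith
  obtain ⟨m, hm⟩ := exists_nat_ge (β + k / 2)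
  obtain ⟨C, hC, hCr⟩ := exists_norm_integral_one_sub_sq_rpow_le m _ ha hm (fun _ => 1)
    contDiff_const
  refine ⟨|∫ w : Fin k → ℝ, posPow β (1 - ∑ i, w i ^ 2)| * C, by positivity, fun y hy => ?_⟩
  have h1 : ‖y‖ = ‖(EuclideanSpace.single 0 ‖y‖ : Space (k + 1))‖ := by simp
  rw [fourier_comp_norm_eq _ (fun ξ η h => by simp [ballWeight, h]) h1,
    fourier_ballWeight_single hβ, norm_mul, Complex.norm_real, Real.norm_eq_abs, mul_assoc (abs _) C]
  refine mul_le_mul_of_nonneg_left ?_ (abs_nonneg _)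
  have hpi := Real.pi_gt_three
  have h2 : ‖y‖ ≤ |-2 * Real.pi * ‖y‖| := by
    rw [abs_mul, abs_mul, abs_norm, abs_of_pos Real.pi_pos]
    norm_num
    nlinarith
  refine (hCr _ (hy.trans h2)).trans ?_
  gcongr
  refine (Real.rpow_le_rpow_of_nonpos (by linarith) h2 (by linarith)).trans (le_of_eq ?_)
  congr 1
  push_cast
  ring

theorem fourier_const_mul {H : Type*} [NormedAddCommGroup H] [InnerProductSpace ℝ H]
    [FiniteDimensional ℝ H] [MeasurableSpace H] [BorelSpace H] (c : ℂ) (f : H → ℂ) (y : H) :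
    𝓕 (fun x => c * f x) y = c * 𝓕 f y := by
  rw [Real.fourier_eq', Real.fourier_eq', ← integral_const_mul]
  simp only [smul_eq_mul]
  congr 1; ext; ring

/-! ### Divided slopes and singularities at the origin and on the sphere. -/

section Dslope

variable {F : Type*} [NormedAddCommGroup F] [NormedSpace ℝ F]

theorem contDiffAt_dslope_of_ne {m : WithTop ℕ∞} {f : ℝ → F} {a x : ℝ} (hx : x ≠ a)
    (hf : ContDiffAt ℝ m f x) : ContDiffAt ℝ m (dslope f a) x := by
  refine ContDiffAt.congr_of_eventuallyEq ?_ (dslope_eventuallyEq_slope_of_ne f hx)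
  have h1 : ContDiffAt ℝ m (fun y => (y - a)⁻¹ • (f y - f a)) x :=
    ((contDiffAt_id.sub contDiffAt_const).inv (sub_ne_zero.2 hx)).smul (hf.sub contDiffAt_const)
  refine h1.congr_of_eventuallyEq (Eventually.of_forall fun y => ?_)
  rw [slope_def_module]

/-- For an analytic function, dividing out the zero is a shift of the power series. This is why
analyticity is asked at the base point, whereas elsewhere the quotient simply inherits the
regularity of f. -/
theorem contDiffAt_dslope_self {f : ℝ → F} [CompleteSpace F] {a : ℝ} (hf : ContDiffAt ℝ ω f a) :
    ContDiffAt ℝ ω (dslope f a) a := by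
  obtain ⟨p, hp⟩ := hf.analyticAt
  exact AnalyticAt.contDiffAt ⟨_, hp.has_fpower_series_dslope_fslope⟩

theorem exists_iteratedFDeriv_le_of_isCompact {V : Type*} [NormedAddCommGroup V] [NormedSpace ℝ V]
    (K : ℕ) {f : V → F} {S : Set V} (hS : IsCompact S) (h : ∀ x ∈ S, ContDiffAt ℝ K f x) :
    ∃ A, 0 ≤ A ∧ ∀ x ∈ S, ∀ k ≤ K, ‖iteratedFDeriv ℝ k f x‖ ≤ A := by
  have hc : ∀ k ≤ K, ContinuousOn (fun x => ‖iteratedFDeriv ℝ k f x‖) S := by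
    intro k hk x hx
    have : ContinuousAt (iteratedFDeriv ℝ k f) x := by
      obtain ⟨u, hu, hfu⟩ := (h x hx).contDiffOn (m := K) le_rfl (by simp)
      obtain ⟨v, hvu, hvo, hxv⟩ := mem_nhds_iff.1 hu
      have h1 := (hfu.mono (hvu.trans (by simp))).continuousOn_iteratedFDerivWithin
        (m := k) (by exact_mod_cast hk) hvo.uniqueDiffOn
      exact ((h1.congr fun y hy => (iteratedFDerivWithin_of_isOpen k hvo hy).symm)
        ).continuousAt (hvo.mem_nhds hxv)
    exact this.norm.continuousWithinAt
  choose! M hM using fun k hk => (hS.bddAbove_image (hc k hk))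
  refine ⟨∑ k ∈ Finset.range (K + 1), |M k|, by positivity, fun x hx k hk => ?_⟩
  calc _ ≤ M k := hM k hk (Set.mem_image_of_mem _ hx)
    _ ≤ |M k| := le_abs_self _
    _ ≤ _ := Finset.single_le_sum (f := fun k => |M k|) (fun _ _ => abs_nonneg _)
      (Finset.mem_range.2 (Nat.lt_succ_of_le hk))

end Dslope

theorem contDiffAt_ofReal_rpow {m : WithTop ℕ∞} {a x : ℝ} (hx : x ≠ 0) :
    ContDiffAt ℝ m (fun t : ℝ => t ^ a) x :=
  Real.contDiffAt_rpow_const_of_ne hx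

/-- The function `(1 - r^γ)^δ - 1` is a symbol of order `γ` near the origin. -/
theorem exists_symbolBound_one_sub_rpow_sub_one (K : ℕ) (δ : ℝ) {γ : ℝ} (hγ : 0 < γ) :
    ∃ C : ℝ, 0 ≤ C ∧ ∀ r : ℝ, 0 < r → r ≤ 1 / 2 →
      SymbolBound K (C * r ^ γ) (fun t : ℝ => (((1 - t ^ γ) ^ δ : ℝ) : ℂ) - 1) r := by
  set E : ℝ → ℂ := fun s => (((1 - s) ^ δ : ℝ) : ℂ) with hE
  have hEs : ∀ s : ℝ, s < 1 → ContDiffAt ℝ ω E s := fun s hs =>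
    Complex.ofRealCLM.contDiff.contDiffAt.comp _
      ((contDiffAt_const.sub contDiffAt_id).rpow_const_of_ne (by simp; linarith))
  -- With s = t^γ, the identity (1-s)^δ - 1 = s e(s) displays the factor t^γ, and e is smooth up to
  -- s = 0.
  set e := dslope E 0 with he
  have hes : ∀ s : ℝ, s < 1 → ContDiffAt ℝ K e s := by
    intro s hs
    rcases eq_or_ne s 0 with rfl | h0
    · exact (contDiffAt_dslope_self (hEs 0 one_pos)).of_le le_top
    · exact contDiffAt_dslope_of_ne h0 ((hEs s hs).of_le le_top)
  have hEe : ∀ s : ℝ, E s - 1 = s * e s := by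
    intro s
    have := sub_smul_dslope E 0 s
    simp only [sub_zero, Complex.real_smul] at this
    rw [this]
    simp [hE]
  set S : Set ℝ := Set.Icc 0 ((1 / 2 : ℝ) ^ γ) with hS
  have hlt : (1 / 2 : ℝ) ^ γ < 1 := Real.rpow_lt_one (by norm_num) (by norm_num) hγ
  obtain ⟨A, hA0, hA⟩ := exists_iteratedFDeriv_le_of_isCompact K (isCompact_Icc (a := (0 : ℝ))
    (b := (1 / 2 : ℝ) ^ γ)) (fun s hs => hes s (hs.2.trans_lt hlt))
  obtain ⟨B, hB0, hB⟩ := exists_symbolBound_rpow K γ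
  refine ⟨2 ^ K * B * (K.factorial * A * (B + 1) ^ K), by positivity, fun r hr hr2 => ?_⟩
  have hrS : r ^ γ ∈ S := ⟨by positivity, by gcongr⟩
  have hrγ1 : r ^ γ ≤ 1 := hrS.2.trans hlt.le
  have hrd : ContDiffAt ℝ K (fun t : ℝ => t ^ γ) r := contDiffAt_ofReal_rpow hr.ne'
  have h1 : SymbolBound K (K.factorial * A * (B + 1) ^ K) (fun t : ℝ => e (t ^ γ)) r := by
    refine symbolBound_comp hr.ne' (by linarith) (hes _ (hrS.2.trans_lt hlt)) hrd
      (fun k hk => hA _ hrS k hk) (fun k hk _ => ?_)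
    have h2 := (hB r hr).2 k hk
    have h3 := Complex.ofRealLI.norm_iteratedFDeriv_comp_left hrd (i := k) (by exact_mod_cast hk)
    have h4 : (⇑Complex.ofRealLI ∘ fun t : ℝ => t ^ γ) = fun t : ℝ => ((t ^ γ : ℝ) : ℂ) := rfl
    rw [h4] at h3
    rw [h3] at h2
    refine h2.trans ?_
    nlinarith
  refine (((hB r hr).mul h1).congr (Eventually.of_forall fun t => ?_)).mono (le_of_eq (by ring))
  simp only
  rw [← hEe]

/-- The derivative is β t₊^(β-1). At t = 0 this follows from writing the function as t times
t₊^(β-1), which is continuous and vanishes there. -/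
theorem contDiff_posPow {K : ℕ} : ∀ {β : ℝ}, (K : ℝ) < β → ContDiff ℝ K (posPow β) := by
  induction K with
  | zero =>
    intro β hβ
    have hβ0 : 0 < β := by simpa using hβ
    have : posPow β = fun t => (max t 0) ^ β := by
      ext t
      rcases le_or_gt t 0 with h | h
      · rw [posPow_of_nonpos h, max_eq_right h, Real.zero_rpow hβ0.ne']
      · rw [posPow_of_pos h, max_eq_left h.le]
    rw [this, Nat.cast_zero, contDiff_zero]
    exact (continuous_id.max continuous_const).rpow_const fun _ => Or.inr hβ0.le
  | succ k ih =>
    intro β hβ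
    push_cast at hβ
    have hk : (0 : ℝ) ≤ k := k.cast_nonneg
    have hd : ∀ t, HasDerivAt (posPow β) (β * posPow (β - 1) t) t := by
      intro t
      rcases lt_trichotomy t 0 with h | rfl | h
      · rw [posPow_of_nonpos h.le, mul_zero]
        refine (hasDerivAt_const t (0 : ℝ)).congr_of_eventuallyEq ?_
        filter_upwards [gt_mem_nhds h] with s hs
        exact posPow_of_nonpos hs.le
      · rw [posPow_of_nonpos le_rfl, mul_zero, hasDerivAt_iff_isLittleO]
        have h1 : ∀ s, posPow β s - posPow β 0 - (s - 0) • (0 : ℝ) = s * posPow (β - 1) s := by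
          intro s
          rw [posPow_of_nonpos le_rfl, ← posPow_succ]
          simp
        have hc : Continuous (posPow (β - 1)) := (ih (by linarith)).continuous
        simp only [h1]
        have h2 : Tendsto (posPow (β - 1)) (𝓝 0) (𝓝 0) := by
          have := hc.tendsto 0
          rwa [posPow_of_nonpos le_rfl] at this
        simpa using (Asymptotics.isBigO_refl (fun s : ℝ => s) (𝓝 0)).mul_isLittleO
          ((Asymptotics.isLittleO_one_iff ℝ).2 h2)
      · rw [posPow_of_pos h]
        refine (Real.hasDerivAt_rpow_const (Or.inl h.ne')).congr_of_eventuallyEq ?_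
        filter_upwards [lt_mem_nhds h] with s hs
        exact posPow_of_pos hs
    have hdf : deriv (posPow β) = fun t => β * posPow (β - 1) t := funext fun t => (hd t).deriv
    rw [Nat.cast_succ, contDiff_succ_iff_deriv, hdf]
    exact ⟨fun t => (hd t).differentiableAt, by simp, contDiff_const.mul (ih (by linarith))⟩

theorem integrable_posPow_mul {n : ℕ} (hn : 1 ≤ n) {β : ℝ} (hβ : -1 < β) {a : ℝ → ℂ}
    (ha : Continuous a) :
    Integrable (fun ξ : Space n => ballWeight β ξ * a (‖ξ‖ ^ 2)) := by
  obtain ⟨M, hM⟩ := (isCompact_Icc (a := (0 : ℝ)) (b := 1)).exists_bound_of_continuousOn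
    ha.continuousOn
  have hac : Continuous fun ξ : Space n => a (‖ξ‖ ^ 2) := ha.comp (by fun_prop)
  refine Integrable.mono' ((integrable_ballWeight hn hβ).norm.const_mul M)
    ((integrable_ballWeight hn hβ).1.mul hac.aestronglyMeasurable) (Eventually.of_forall fun ξ => ?_)
  rw [norm_mul, mul_comm]
  rcases le_or_gt (1 - ‖ξ‖ ^ 2) 0 with h | h
  · simp [ballWeight, posPow_of_nonpos h]
  · exact mul_le_mul_of_nonneg_right (hM _ ⟨by positivity, by linarith⟩) (norm_nonneg _)

/-- Expanding a(s) = a(1) + (s-1) a₁(s) at the sphere splits off a multiple of the classical weight,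
whose decay is known; the factor s-1 raises the exponent of the other term to β+1. After N steps the
exponent exceeds n, the integrand is C^n with compact support, and the decay ‖y‖^(-n) suffices
because s ≤ n. -/
theorem exists_norm_fourier_posPow_mul_le {n : ℕ} (hn : 1 ≤ n) {s : ℝ} (hs : s ≤ n) (N : ℕ) :
    ∀ β : ℝ, -1 < β → (n : ℝ) < β + N → s ≤ (n + 1) / 2 + β → ∀ a : ℝ → ℂ, ContDiff ℝ ∞ a →
      ContDiffAt ℝ ω a 1 → ∃ C : ℝ, 0 ≤ C ∧ ∀ y : Space n, 1 ≤ ‖y‖ →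
        ‖𝓕 (fun ξ : Space n => ballWeight β ξ * a (‖ξ‖ ^ 2)) y‖ ≤ C * ‖y‖ ^ (-s) := by
  induction N with
  | zero =>
    intro β hβ hnβ hsβ a ha _
    have hcd : ContDiff ℝ n (fun ξ : Space n => ballWeight β ξ * a (‖ξ‖ ^ 2)) := by
      refine ContDiff.mul ?_ ((ha.of_le (by exact_mod_cast le_top)).comp (contDiff_norm_sq ℝ))
      exact Complex.ofRealCLM.contDiff.comp
        ((contDiff_posPow (by simpa using hnβ)).comp (contDiff_const.sub (contDiff_norm_sq ℝ)))
    have hcs : HasCompactSupport (fun ξ : Space n => ballWeight β ξ * a (‖ξ‖ ^ 2)) := by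
      refine HasCompactSupport.intro (isCompact_closedBall (0 : Space n) 1) fun ξ hξ => ?_
      rw [mem_closedBall_zero_iff, not_le] at hξ
      rw [ballWeight, posPow_of_nonpos (by nlinarith)]
      simp
    refine ⟨∫ x, ‖iteratedFDeriv ℝ n (fun ξ : Space n => ballWeight β ξ * a (‖ξ‖ ^ 2)) x‖,
      by positivity, fun y hy => ?_⟩
    have h1 := pow_mul_norm_fourier_le hcd hcs y
    have hy0 : 0 < ‖y‖ := by linarith
    rw [mul_comm, ← le_div_iff₀ (by positivity)] at h1
    refine h1.trans ?_
    rw [div_eq_mul_inv]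
    gcongr
    rw [← Real.rpow_natCast, ← Real.rpow_neg hy0.le]
    exact Real.rpow_le_rpow_of_exponent_le hy (by linarith)
  | succ N ih =>
    intro β hβ hnβ hsβ a ha ha1
    push_cast at hnβ
    have hd : ContDiff ℝ ∞ (dslope a 1) := by
      rw [contDiff_iff_contDiffAt]
      intro x
      rcases eq_or_ne x 1 with rfl | hx
      · exact (contDiffAt_dslope_self ha1).of_le le_top
      · exact contDiffAt_dslope_of_ne hx ha.contDiffAt
    obtain ⟨C₁, hC₁, h₁⟩ := ih (β + 1) (by linarith) (by linarith) (by linarith) _ hd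
      (contDiffAt_dslope_self ha1)
    obtain ⟨C₂, hC₂, h₂⟩ := exists_norm_fourier_ballWeight_le hn hβ
    refine ⟨‖a 1‖ * C₂ + C₁, by positivity, fun y hy => ?_⟩
    have hsplit : (fun ξ : Space n => ballWeight β ξ * a (‖ξ‖ ^ 2)) = fun ξ =>
        a 1 * ballWeight β ξ + (-1) * (ballWeight (β + 1) ξ * dslope a 1 (‖ξ‖ ^ 2)) := by
      ext ξ
      have h := sub_smul_dslope a 1 (‖ξ‖ ^ 2)
      rw [Complex.real_smul] at h
      have h3 : a (‖ξ‖ ^ 2) = a 1 + ((‖ξ‖ ^ 2 - 1 : ℝ) : ℂ) * dslope a 1 (‖ξ‖ ^ 2) := by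
        rw [h]; ring
      rw [h3]
      simp only [ballWeight, posPow_succ]
      push_cast
      ring
    rw [hsplit, fourier_add_of_integrable ((integrable_ballWeight hn hβ).const_mul _)
      ((integrable_posPow_mul hn (by linarith) hd.continuous).const_mul _), fourier_const_mul,
      fourier_const_mul]
    refine (norm_add_le _ _).trans ?_
    rw [norm_mul, norm_mul, norm_neg, norm_one, one_mul, add_mul]
    refine add_le_add ?_ (h₁ y hy)
    rw [mul_assoc]
    refine mul_le_mul_of_nonneg_left ((h₂ y hy).trans ?_) (norm_nonneg _)
    gcongr

/-! ### Decomposition of the generalized multiplier and decay of its kernel. -/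

theorem multiplier_one {n : ℕ} (δ γ : ℝ) (ξ : Space n) :
    multiplier δ γ 1 ξ = (posPow δ (1 - ‖ξ‖ ^ γ) : ℝ) := by
  simp [multiplier]

/-- The singular part `(m - 1) κ` of the multiplier `m = (1 - |ξ|^γ)₊ ^ δ` at the origin. -/
def originPart {n : ℕ} (δ γ : ℝ) (ξ : Space n) : ℂ :=
  (multiplier δ γ 1 ξ - 1) * (cutoff (8 * ‖ξ‖) : ℝ)

theorem originPart_of_le {n : ℕ} {δ γ : ℝ} {ξ : Space n} (h : 1 / 4 ≤ ‖ξ‖) :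
    originPart δ γ ξ = 0 := by
  rw [originPart, cutoff_of_two_le (by linarith)]; simp

theorem hasCompactSupport_originPart {n : ℕ} (δ γ : ℝ) :
    HasCompactSupport (originPart δ γ : Space n → ℂ) :=
  HasCompactSupport.intro (isCompact_closedBall (0 : Space n) 1) fun ξ hξ => by
    rw [mem_closedBall_zero_iff, not_le] at hξ
    exact originPart_of_le (by linarith)

theorem exists_symbolBound_originPart {n : ℕ} (K : ℕ) (δ : ℝ) {γ : ℝ} (hγ : 0 < γ) :
    ∃ C : ℝ, 0 ≤ C ∧ ∀ ξ : Space n, ξ ≠ 0 → SymbolBound K (C * ‖ξ‖ ^ γ) (originPart δ γ) ξ := by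
  obtain ⟨M, hM0, hM⟩ := exists_symbolBound_comp_norm (F := ℂ) (H := Space n) K
  obtain ⟨Cκ, hCκ1, hCκ⟩ := exists_symbolBound_cutoff K
  obtain ⟨B, hB0, hB⟩ := exists_symbolBound_one_sub_rpow_sub_one K δ hγ
  refine ⟨M * (2 ^ K * B * Cκ), by positivity, fun ξ hξ => ?_⟩
  have hr : 0 < ‖ξ‖ := norm_pos_iff.2 hξ
  rcases lt_or_ge ‖ξ‖ (1 / 2) with h | h
  · have h1 := hM _ _ ξ hξ ((hB _ hr h.le).mul (hCκ 8 _ (by norm_num) hr))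
    refine (h1.congr ?_).mono (le_of_eq (by ring))
    filter_upwards [(isOpen_lt continuous_norm continuous_const).mem_nhds h] with z hz
    have hz' : ‖z‖ < 1 / 2 := hz
    have : ‖z‖ ^ γ < 1 := Real.rpow_lt_one (norm_nonneg _) (by linarith) hγ
    rw [originPart, multiplier_one, posPow_of_pos (by linarith)]
  · have h0 : originPart δ γ =ᶠ[𝓝 ξ] fun _ => (0 : ℂ) := by
      filter_upwards [(isOpen_lt continuous_const continuous_norm).mem_nhds
        (show (1 / 4 : ℝ) < ‖ξ‖ by linarith)] with z hz
      exact originPart_of_le (le_of_lt hz)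
    refine ((symbolBound_const K 0 ξ).congr h0).mono ?_
    simp only [norm_zero]
    positivity

theorem continuous_originPart {n : ℕ} (δ : ℝ) {γ : ℝ} (hγ : 0 < γ) :
    Continuous (originPart δ γ : Space n → ℂ) := by
  rw [continuous_iff_continuousAt]
  intro ξ
  obtain ⟨C, hC0, hC⟩ := exists_symbolBound_originPart (n := n) 0 δ hγ
  rcases eq_or_ne ξ 0 with rfl | hξ
  · have h0 : originPart δ γ (0 : Space n) = 0 := by
      rw [originPart, multiplier_one, norm_zero, Real.zero_rpow hγ.ne', posPow_of_pos (by norm_num)]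
      simp
    rw [ContinuousAt, h0]
    refine squeeze_zero_norm (a := fun z => C * ‖z‖ ^ γ) (fun z => ?_) ?_
    · rcases eq_or_ne z 0 with rfl | hz
      · rw [h0, norm_zero]; positivity
      · exact (hC z hz).norm_le
    · have : Continuous fun z : Space n => C * ‖z‖ ^ γ :=
        continuous_const.mul (continuous_norm.rpow_const fun _ => Or.inr hγ.le)
      have h2 := this.tendsto 0
      simpa [Real.zero_rpow hγ.ne'] using h2
  · exact (hC ξ hξ).1.continuousAt

theorem integrable_originPart {n : ℕ} (δ : ℝ) {γ : ℝ} (hγ : 0 < γ) :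
    Integrable (originPart δ γ : Space n → ℂ) :=
  (continuous_originPart δ hγ).integrable_of_hasCompactSupport (hasCompactSupport_originPart δ γ)

/-- A bounded function with decay `‖y‖ ^ (-s)` at infinity is `O((1 + ‖y‖) ^ (-s))`. -/
theorem exists_norm_le_one_add_norm_rpow {H : Type*} [NormedAddCommGroup H] {f : H → ℂ} {s A B : ℝ}
    (hs : 0 ≤ s) (hA : 0 ≤ A) (hB : 0 ≤ B) (h1 : ∀ y, ‖f y‖ ≤ A)
    (h2 : ∀ y, 1 ≤ ‖y‖ → ‖f y‖ ≤ B * ‖y‖ ^ (-s)) (y : H) :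
    ‖f y‖ ≤ (A + B) * 2 ^ s * (1 + ‖y‖) ^ (-s) := by
  have key : ∀ r : ℝ, 0 < r → (1 + ‖y‖) / 2 ≤ r → r ^ (-s) ≤ 2 ^ s * (1 + ‖y‖) ^ (-s) := by
    intro r hr h
    calc _ ≤ ((1 + ‖y‖) / 2) ^ (-s) :=
          Real.rpow_le_rpow_of_nonpos (by positivity) h (by linarith)
      _ = _ := by
          rw [Real.div_rpow (by positivity) (by norm_num), Real.rpow_neg (by norm_num : (0 : ℝ) ≤ 2)]
          field_simp
  rcases le_or_gt 1 ‖y‖ with h | h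
  · calc _ ≤ B * ‖y‖ ^ (-s) := h2 y h
      _ ≤ B * (2 ^ s * (1 + ‖y‖) ^ (-s)) := by
          gcongr
          exact key _ (by linarith) (by linarith)
      _ ≤ (A + B) * (2 ^ s * (1 + ‖y‖) ^ (-s)) := by gcongr; linarith
      _ = _ := by ring
  · have h3 := key 1 one_pos (by linarith)
    rw [Real.one_rpow] at h3
    have : ‖f y‖ ≤ A := h1 y
    have : 0 ≤ 2 ^ s * (1 + ‖y‖) ^ (-s) := by positivity
    nlinarith

/-- A symbol of order γ, hence the general estimate with α = -γ for ‖y‖ ≥ 1 and integrability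
otherwise. The decay n + γ is what makes moments of every order below γ meaningful. -/
theorem exists_norm_fourier_originPart_le {n : ℕ} (hn : 1 ≤ n) (δ : ℝ) {γ : ℝ} (hγ : 0 < γ) :
    ∃ C : ℝ, 0 ≤ C ∧ ∀ y : Space n,
      ‖𝓕 (originPart δ γ : Space n → ℂ) y‖ ≤ C * (1 + ‖y‖) ^ (-(n + γ)) := by
  obtain ⟨K, hK⟩ := exists_nat_gt (n + γ)
  have hn0 : (0 : ℝ) ≤ n := n.cast_nonneg
  obtain ⟨C, hC0, hC⟩ := exists_norm_fourier_le_of_symbolBound (K := K) (α := -γ) hn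
    (by linarith) (by linarith)
  obtain ⟨A, hA0, hA⟩ := exists_symbolBound_originPart (n := n) K δ hγ
  refine ⟨_, ?_, exists_norm_le_one_add_norm_rpow (s := n + γ) (A := ∫ x : Space n,
    ‖originPart δ γ x‖) (B := C * A) (by linarith) (by positivity) (by positivity)
    (fun y => norm_fourier_le_integral_norm _ y) (fun y hy => ?_)⟩
  · positivity
  · have := hC (originPart δ γ) A hA0 (integrable_originPart δ hγ)
      (fun ξ hξ => by simpa using hA ξ hξ) y (by rintro rfl; simp at hy; linarith)
    convert this using 3
    ring

/-- Since r^γ = (r²)^(γ/2), the quotient (1-r^γ)/(1-r²) is the slope of s^(γ/2) between 1 and r².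
This positive factor is analytic at the sphere and reduces the multiplier to the classical weight.
-/
theorem posPow_eq_mul_dslope {δ γ r : ℝ} (hγ : 0 < γ) (hr : 0 < r) :
    posPow δ (1 - r ^ γ) =
      posPow δ (1 - r ^ 2) * (dslope (fun s : ℝ => s ^ (γ / 2)) 1 (r ^ 2)) ^ δ := by
  rcases lt_or_ge r 1 with h | h
  · have h1 : r ^ γ < 1 := Real.rpow_lt_one hr.le h hγ
    have h2 : (r ^ 2) ^ (γ / 2) = r ^ γ := by
      rw [← Real.rpow_natCast, ← Real.rpow_mul hr.le]; congr 1; push_cast; ring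
    have h3 := sub_smul_dslope (fun s : ℝ => s ^ (γ / 2)) 1 (r ^ 2)
    simp only [smul_eq_mul, Real.one_rpow, h2] at h3
    have h4 : 0 < 1 - r ^ 2 := by nlinarith
    have h5 : 1 - r ^ γ = (1 - r ^ 2) * dslope (fun s : ℝ => s ^ (γ / 2)) 1 (r ^ 2) := by linarith
    have h6 : 0 < dslope (fun s : ℝ => s ^ (γ / 2)) 1 (r ^ 2) := by
      by_contra hc
      have := mul_nonpos_of_nonneg_of_nonpos h4.le (not_lt.1 hc)
      linarith
    rw [posPow_of_pos (by linarith), posPow_of_pos h4, ← Real.mul_rpow h4.le h6.le, h5]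
  · rw [posPow_of_nonpos (show 1 - r ^ γ ≤ 0 by linarith [Real.one_le_rpow h hγ.le]),
      posPow_of_nonpos (show 1 - r ^ 2 ≤ 0 by nlinarith), zero_mul]

theorem dslope_rpow_pos {b s : ℝ} (hb : 0 < b) (hs : 0 < s) :
    0 < dslope (fun s : ℝ => s ^ b) 1 s := by
  rcases eq_or_ne s 1 with rfl | h1
  · rw [dslope_same, (Real.hasDerivAt_rpow_const (Or.inl one_ne_zero)).deriv]
    simpa using hb
  · have h3 := sub_smul_dslope (fun s : ℝ => s ^ b) 1 s
    simp only [smul_eq_mul, Real.one_rpow] at h3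
    by_contra hc
    rw [not_lt] at hc
    rcases lt_or_gt_of_ne h1 with h | h
    · have := Real.rpow_lt_one hs.le h hb
      nlinarith
    · have := Real.one_lt_rpow h hb
      nlinarith

/-- The factor `a` in `m (1 - κ) = (1 - |ξ|²)₊ ^ δ a(|ξ|²)`. -/
def sphereFactor (δ γ s : ℝ) : ℂ :=
  ((1 - cutoff (8 * Real.sqrt s)) * (dslope (fun s : ℝ => s ^ (γ / 2)) 1 s) ^ δ : ℝ)

theorem contDiffAt_sphereFactor_one {δ γ : ℝ} (hγ : 0 < γ) :
    ContDiffAt ℝ ω (sphereFactor δ γ) 1 := by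
  have h1 : ContDiffAt ℝ ω (fun s : ℝ =>
      (((dslope (fun s : ℝ => s ^ (γ / 2)) 1 s) ^ δ : ℝ) : ℂ)) 1 :=
    Complex.ofRealCLM.contDiff.contDiffAt.comp _
      ((contDiffAt_dslope_self (contDiffAt_ofReal_rpow one_ne_zero)).rpow_const_of_ne
        (dslope_rpow_pos (by positivity) one_pos).ne')
  refine h1.congr_of_eventuallyEq ?_
  filter_upwards [lt_mem_nhds (show (1 / 4 : ℝ) < 1 by norm_num)] with s hs
  have : 1 / 2 ≤ Real.sqrt s := Real.le_sqrt_of_sq_le (by linarith)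
  rw [sphereFactor, cutoff_of_two_le (by linarith)]
  simp

theorem contDiff_sphereFactor {δ γ : ℝ} (hγ : 0 < γ) : ContDiff ℝ ∞ (sphereFactor δ γ) := by
  rw [contDiff_iff_contDiffAt]
  intro s
  rcases le_or_gt s 0 with h | h
  · refine (contDiffAt_const (c := (0 : ℂ))).congr_of_eventuallyEq ?_
    filter_upwards [gt_mem_nhds (show s < 1 / 64 by linarith)] with t ht
    have : Real.sqrt t ≤ 1 / 8 := by
      rw [Real.sqrt_le_left (by norm_num)]
      linarith
    rw [sphereFactor, cutoff_of_le_one (by linarith)]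
    simp
  · have hd : ContDiffAt ℝ ∞ (dslope (fun s : ℝ => s ^ (γ / 2)) 1) s := by
      rcases eq_or_ne s 1 with rfl | hs
      · exact (contDiffAt_dslope_self (contDiffAt_ofReal_rpow one_ne_zero)).of_le le_top
      · exact contDiffAt_dslope_of_ne hs (contDiffAt_ofReal_rpow h.ne')
    refine Complex.ofRealCLM.contDiff.contDiffAt.comp _ (ContDiffAt.mul ?_
      (hd.rpow_const_of_ne (dslope_rpow_pos (by positivity) h).ne'))
    exact contDiffAt_const.sub ((contDiff_cutoff (m := ⊤)).contDiffAt.comp _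
      (contDiffAt_const.mul (Real.contDiffAt_sqrt h.ne')))

/-- With κ the cutoff at scale 1/8, m - (m-1)κ = m(1-κ) + κ: the first term is singular only on the
sphere, the second is a smooth bump. -/
theorem multiplier_sub_originPart {n : ℕ} {δ γ : ℝ} (hγ : 0 < γ) (ξ : Space n) :
    multiplier δ γ 1 ξ - originPart δ γ ξ =
      ballWeight δ ξ * sphereFactor δ γ (‖ξ‖ ^ 2) + (cutoff (8 * ‖ξ‖) : ℝ) := by
  have h : multiplier δ γ 1 ξ * (1 - (cutoff (8 * ‖ξ‖) : ℝ)) =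
      ballWeight δ ξ * sphereFactor δ γ (‖ξ‖ ^ 2) := by
    rcases eq_or_ne ξ 0 with rfl | hξ
    · simp [sphereFactor, cutoff_of_le_one]
    · rw [multiplier_one, posPow_eq_mul_dslope hγ (norm_pos_iff.2 hξ), sphereFactor, ballWeight,
        Real.sqrt_sq (norm_nonneg _)]
      push_cast
      ring
  rw [← h, originPart]
  ring

theorem contDiff_cutoff_norm {n : ℕ} (c : ℝ) :
    ContDiff ℝ ∞ (fun ξ : Space n => ((cutoff (c * ‖ξ‖) : ℝ) : ℂ)) := by
  rw [contDiff_iff_contDiffAt]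
  intro ξ
  rcases eq_or_ne ξ 0 with rfl | hξ
  · refine (contDiffAt_const (c := (1 : ℂ))).congr_of_eventuallyEq ?_
    have : Tendsto (fun z : Space n => c * ‖z‖) (𝓝 0) (𝓝 0) := by
      have h : Continuous fun z : Space n => c * ‖z‖ := by fun_prop
      simpa using h.tendsto 0
    filter_upwards [this.eventually (gt_mem_nhds one_pos)] with z hz
    rw [cutoff_of_le_one hz.le]; simp
  · exact (contDiff_ofReal_cutoff (m := ⊤)).contDiffAt.comp _
      (contDiffAt_const.mul (contDiffAt_norm ℝ hξ))

theorem hasCompactSupport_cutoff_norm {n : ℕ} {c : ℝ} (hc : 0 < c) :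
    HasCompactSupport (fun ξ : Space n => ((cutoff (c * ‖ξ‖) : ℝ) : ℂ)) :=
  HasCompactSupport.intro (isCompact_closedBall (0 : Space n) (2 / c)) fun ξ hξ => by
    rw [mem_closedBall_zero_iff, not_le, div_lt_iff₀ hc] at hξ
    rw [cutoff_of_two_le (by linarith)]; simp

theorem integrable_cutoff_norm {n : ℕ} {c : ℝ} (hc : 0 < c) :
    Integrable (fun ξ : Space n => ((cutoff (c * ‖ξ‖) : ℝ) : ℂ)) :=
  (contDiff_cutoff_norm c).continuous.integrable_of_hasCompactSupport
    (hasCompactSupport_cutoff_norm hc)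

theorem integrable_multiplier {n : ℕ} (hn : 1 ≤ n) {δ γ : ℝ} (hδ : -1 < δ) (hγ : 0 < γ) :
    Integrable (multiplier δ γ 1 : Space n → ℂ) := by
  have h := ((integrable_posPow_mul hn hδ (contDiff_sphereFactor (δ := δ) hγ).continuous).add
    (integrable_cutoff_norm (n := n) (c := 8) (by norm_num))).add (integrable_originPart δ hγ)
  refine h.congr (Eventually.of_forall fun ξ => ?_)
  simp only [Pi.add_apply, ← multiplier_sub_originPart hγ]
  ring

/-- Three pieces: the part at the origin decays with exponent n + γ, the smooth bump at least with
n, and the part at the sphere with (n+1)/2 + δ. Since (n+1)/2 + δ ≤ n, the sphere determines the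
rate. -/
theorem exists_norm_fourier_multiplier_le {n : ℕ} (hn : 1 ≤ n) {δ γ : ℝ} (hδ : -1 < δ)
    (hγ : 0 < γ) (hδn : (n + 1) / 2 + δ ≤ n) : ∃ C : ℝ, 0 ≤ C ∧ ∀ y : Space n,
      ‖𝓕 (multiplier δ γ 1 : Space n → ℂ) y‖ ≤ C * (1 + ‖y‖) ^ (-((n + 1) / 2 + δ)) := by
  have hn1 : (1 : ℝ) ≤ n := by exact_mod_cast hn
  set s : ℝ := (n + 1) / 2 + δ with hs
  have hs0 : 0 ≤ s := by linarith
  obtain ⟨C₁, hC₁, h₁⟩ := exists_norm_fourier_originPart_le hn δ hγ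
  obtain ⟨N, hN⟩ := exists_nat_gt (n - δ)
  obtain ⟨C₂, hC₂, h₂⟩ := exists_norm_fourier_posPow_mul_le hn hδn N δ hδ (by linarith) le_rfl
    (sphereFactor δ γ) (contDiff_sphereFactor hγ) (contDiffAt_sphereFactor_one hγ)
  set κ : Space n → ℂ := fun ξ => ((cutoff (8 * ‖ξ‖) : ℝ) : ℂ) with hκ
  set C₃ := ∫ x, ‖iteratedFDeriv ℝ n κ x‖
  have hC₃ : 0 ≤ C₃ := integral_nonneg fun _ => norm_nonneg _
  refine ⟨_, ?_, exists_norm_le_one_add_norm_rpow (s := s) (A := ∫ x : Space n,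
    ‖multiplier δ γ 1 x‖) (B := C₁ + C₂ + C₃) hs0 (by positivity) (by positivity)
    (fun y => norm_fourier_le_integral_norm _ y) (fun y hy => ?_)⟩
  · positivity
  have hy0 : 0 < ‖y‖ := by linarith
  have hsplit : (multiplier δ γ 1 : Space n → ℂ) = fun ξ => originPart δ γ ξ +
      (ballWeight δ ξ * sphereFactor δ γ (‖ξ‖ ^ 2) + κ ξ) := by
    ext ξ
    rw [hκ, ← multiplier_sub_originPart hγ]
    ring
  have hi₂ := integrable_posPow_mul hn hδ (contDiff_sphereFactor (δ := δ) hγ).continuous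
  have hi₃ : Integrable κ := integrable_cutoff_norm (n := n) (c := 8) (by norm_num)
  have hi : Integrable fun ξ : Space n =>
      ballWeight δ ξ * sphereFactor δ γ (‖ξ‖ ^ 2) + κ ξ := hi₂.add hi₃
  rw [hsplit, fourier_add_of_integrable (integrable_originPart δ hγ) hi,
    fourier_add_of_integrable hi₂ hi₃]
  have e1 : ‖𝓕 (originPart δ γ : Space n → ℂ) y‖ ≤ C₁ * ‖y‖ ^ (-s) := by
    refine (h₁ y).trans ?_
    gcongr
    calc _ ≤ ‖y‖ ^ (-(n + γ)) :=
          Real.rpow_le_rpow_of_nonpos hy0 (by linarith) (by linarith)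
      _ ≤ _ := Real.rpow_le_rpow_of_exponent_le hy (by linarith)
  have e3 : ‖𝓕 κ y‖ ≤ C₃ * ‖y‖ ^ (-s) := by
    have h := pow_mul_norm_fourier_le (K := n) (f := κ)
      ((contDiff_cutoff_norm 8).of_le (by exact_mod_cast le_top))
      (hasCompactSupport_cutoff_norm (by norm_num)) y
    rw [mul_comm, ← le_div_iff₀ (by positivity)] at h
    refine h.trans ?_
    rw [div_eq_mul_inv]
    gcongr
    rw [← Real.rpow_natCast, ← Real.rpow_neg hy0.le]
    exact Real.rpow_le_rpow_of_exponent_le hy (by linarith)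
  have e2 := h₂ y hy
  calc _ ≤ _ := norm_add_le _ _
    _ ≤ _ := add_le_add le_rfl (norm_add_le _ _)
    _ ≤ _ := by linarith

theorem kernel_eq_fourier {n : ℕ} (δ γ R : ℝ) :
    (kernel δ γ R : Space n → ℂ) = 𝓕 (multiplier δ γ R : Space n → ℂ) := by
  rw [kernel, Real.fourierInv_eq_fourier_comp_neg]
  congr 1
  ext ξ
  simp [multiplier]

/-! ### Multiplication formula and modulation. -/

section FourierIdentities

variable {H : Type*} [NormedAddCommGroup H] [InnerProductSpace ℝ H] [FiniteDimensional ℝ H]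
  [MeasurableSpace H] [BorelSpace H]

theorem integral_fourier_mul {f g : H → ℂ} (hf : Integrable f) (hg : Integrable g) :
    ∫ x, 𝓕 f x * g x = ∫ x, f x * 𝓕 g x := by
  have h := VectorFourier.integral_fourierIntegral_smul_eq_flip (L := innerₗ H)
    (μ := volume) (ν := volume) Real.continuous_fourierChar continuous_inner hf hg
  rwa [flip_innerₗ] at h

theorem fourier_exp_mul (ψ : H → ℂ) (z x : H) :
    𝓕 (fun ξ => Complex.exp (((-2 * Real.pi * inner ℝ ξ z : ℝ) : ℂ) * Complex.I) * ψ ξ) x =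
      𝓕 ψ (x + z) := by
  rw [Real.fourier_eq', Real.fourier_eq']
  refine integral_congr_ae (Eventually.of_forall fun ξ => ?_)
  simp only [smul_eq_mul]
  rw [← mul_assoc, ← Complex.exp_add, inner_add_right]
  congr 2
  push_cast
  ring

theorem integrable_exp_mul {ψ : H → ℂ} (hψ : Integrable ψ) (z : H) : Integrable fun ξ =>
    Complex.exp (((-2 * Real.pi * inner ℝ ξ z : ℝ) : ℂ) * Complex.I) * ψ ξ := by
  simpa [Circle.smul_def, Real.fourierChar_apply] using
      (Real.fourierIntegral_convergent_iff z).2 hψ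

/-- The multiplication formula for k against the modulated ψ. Fourier inversion is avoided, so
integrability of k and ψ is enough. -/
theorem fourier_fourier_mul {k ψ : H → ℂ} (hk : Integrable k) (hψ : Integrable ψ) (y : H) :
    𝓕 (fun ξ => 𝓕 k ξ * ψ ξ) y = ∫ x, k x * 𝓕 ψ (x + y) := by
  simp_rw [← fourier_exp_mul ψ y]
  rw [← integral_fourier_mul hk (integrable_exp_mul hψ y), Real.fourier_eq']
  refine integral_congr_ae (Eventually.of_forall fun ξ => ?_)
  simp only [smul_eq_mul]
  ring

end FourierIdentities

/-! ### The high-frequency kernel of the Riesz potential. -/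

theorem integrable_tsum {X : Type*} [MeasurableSpace X] {μ : Measure X} {F : ℕ → X → ℂ}
    (hF : ∀ j, Integrable (F j) μ) (hs : Summable fun j => ∫ x, ‖F j x‖ ∂μ)
    (hp : ∀ᵐ x ∂μ, Summable fun j => F j x) : Integrable (fun x => ∑' j, F j x) μ := by
  refine ⟨?_, ?_⟩
  · refine aestronglyMeasurable_of_tendsto_ae atTop
      (f := fun N x => ∑ j ∈ Finset.range N, F j x) (fun N => ?_) ?_
    · exact Finset.aestronglyMeasurable_fun_sum _ fun j _ => (hF j).1
    · filter_upwards [hp] with x hx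
      exact hx.hasSum.tendsto_sum_nat
  · calc ∫⁻ x, ‖∑' j, F j x‖ₑ ∂μ ≤ ∫⁻ x, ∑' j, ‖F j x‖ₑ ∂μ :=
          lintegral_mono fun x => enorm_tsum_le_tsum_enorm
      _ = ∑' j, ∫⁻ x, ‖F j x‖ₑ ∂μ := lintegral_tsum fun j => (hF j).1.enorm
      _ = ∑' j, ENNReal.ofReal (∫ x, ‖F j x‖ ∂μ) := by
          congr 1; ext j
          rw [ofReal_integral_norm_eq_lintegral_enorm (hF j)]
      _ < ⊤ := by
          rw [← ENNReal.ofReal_tsum_of_nonneg (fun j => by positivity) hs]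
          exact ENNReal.ofReal_lt_top

theorem contDiff_rpow_mul_cutoff_sub {n : ℕ} (c' c a : ℝ) : ContDiff ℝ ∞ (fun ξ : Space n =>
    ((‖ξ‖ ^ a * (cutoff (c' * ‖ξ‖) - cutoff (c * ‖ξ‖)) : ℝ) : ℂ)) := by
  rw [contDiff_iff_contDiffAt]
  intro ξ
  rcases eq_or_ne ξ 0 with rfl | hξ
  · refine (contDiffAt_const (c := (0 : ℂ))).congr_of_eventuallyEq ?_
    have h1 : ∀ c : ℝ, Tendsto (fun z : Space n => c * ‖z‖) (𝓝 0) (𝓝 0) := fun c => by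
      have h : Continuous fun z : Space n => c * ‖z‖ := by fun_prop
      simpa using h.tendsto 0
    filter_upwards [(h1 c).eventually (gt_mem_nhds one_pos),
      (h1 c').eventually (gt_mem_nhds one_pos)] with z hz hz'
    rw [cutoff_of_le_one hz.le, cutoff_of_le_one hz'.le]; simp
  · have hN := contDiffAt_norm (n := ∞) ℝ hξ
    refine Complex.ofRealCLM.contDiff.contDiffAt.comp _ (ContDiffAt.mul ?_ (ContDiffAt.sub ?_ ?_))
    · exact hN.rpow_const_of_ne (norm_pos_iff.2 hξ).ne'
    · exact (contDiff_cutoff (m := ⊤)).contDiffAt.comp _ (contDiffAt_const.mul hN)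
    · exact (contDiff_cutoff (m := ⊤)).contDiffAt.comp _ (contDiffAt_const.mul hN)

/-- The high frequency part of the Riesz potential is convolution with a kernel that is integrable
against `(1 + ‖x‖) ^ n`. -/
theorem exists_fourier_eq_rpow_mul_one_sub_cutoff {n : ℕ} {lam c : ℝ} (hlam : 0 < lam)
    (hc : 0 < c) : ∃ k : Space n → ℂ, Integrable k ∧
      Integrable (fun x => (((1 + ‖x‖) ^ n : ℝ) : ℂ) * k x) ∧
      ∀ ξ, 𝓕 k ξ = ((‖ξ‖ ^ (-lam) * (1 - cutoff (c * ‖ξ‖)) : ℝ) : ℂ) := by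
  -- The dyadic block of |ξ|^(-lam). Its dilates by powers of 2 telescope to |ξ|^(-lam) (1 -
  -- cutoff(c|ξ|)).
  set a : Space n → ℂ := fun ξ =>
    ((‖ξ‖ ^ (-lam) * (cutoff (c / 2 * ‖ξ‖) - cutoff (c * ‖ξ‖)) : ℝ) : ℂ) with ha
  have hacs : HasCompactSupport a := by
    refine HasCompactSupport.intro (isCompact_closedBall (0 : Space n) (4 / c)) fun ξ hξ => ?_
    rw [mem_closedBall_zero_iff, not_le, div_lt_iff₀ hc] at hξ
    rw [ha]
    simp only
    rw [cutoff_of_two_le (by linarith), cutoff_of_two_le (by linarith)]; simp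
  set aS : 𝓢(Space n, ℂ) := hacs.toSchwartzMap (contDiff_rpow_mul_cutoff_sub (c / 2) c (-lam)) with haS
  have haSa : (aS : Space n → ℂ) = a := rfl
  set k₀ : 𝓢(Space n, ℂ) := 𝓕 aS with hk₀
  have hFk₀ : ∀ ξ, 𝓕 (k₀ : Space n → ℂ) ξ = a ξ := by
    intro ξ
    have h1 : 𝓕⁻ (k₀ : Space n → ℂ) = a := by
      rw [← haSa, ← SchwartzMap.fourierInv_coe, hk₀, FourierTransform.fourierInv_fourier_eq]
    have h2 : a ξ = a (-ξ) := by simp [ha]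
    rw [h2, ← h1, Real.fourierInv_eq_fourier_neg, neg_neg]
  set r : ℝ := 2 ^ (-lam) with hr
  have hr0 : 0 < r := by positivity
  have hr1 : r < 1 := Real.rpow_lt_one_of_one_lt_of_neg one_lt_two (by linarith)
  have hgeo : Summable fun j : ℕ => r ^ j := summable_geometric_of_lt_one hr0.le hr1
  -- The block at frequency 2^j: an L¹-normalized dilate of k₀ with weight r^j = 2^(-lam j). As lam
  -- > 0 the weights are summable, and concentration at the origin only decreases the moments
  -- against (1+‖x‖)^n.
  set F : ℕ → Space n → ℂ := fun j x =>
    ((r ^ j * ((2 : ℝ) ^ j) ^ n : ℝ) : ℂ) * k₀ ((2 : ℝ) ^ j • x) with hF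
  have h2j : ∀ j : ℕ, (1 : ℝ) ≤ 2 ^ j := fun j => one_le_pow₀ (by norm_num)
  have hkint : Integrable fun x : Space n => (1 + ‖x‖) ^ n * ‖k₀ x‖ := by
    have h1 := k₀.integrable_pow_mul volume n
    have h2 := (k₀.integrable (μ := volume)).norm
    refine Integrable.mono' ((h1.add h2).const_mul (2 ^ n)) ?_ (Eventually.of_forall fun x => ?_)
    · exact (by fun_prop : Continuous fun x : Space n => (1 + ‖x‖) ^ n * ‖k₀ x‖).aestronglyMeasurable
    · rw [Real.norm_of_nonneg (by positivity)]
      simp only [Pi.add_apply]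
      have h3 : (1 + ‖x‖) ^ n ≤ 2 ^ n * (‖x‖ ^ n + 1) := by
        rcases le_total ‖x‖ 1 with h | h
        · calc (1 + ‖x‖) ^ n ≤ 2 ^ n := by gcongr; linarith
            _ ≤ _ := le_mul_of_one_le_right (by positivity) (by linarith [pow_nonneg (norm_nonneg x) n])
        · calc (1 + ‖x‖) ^ n ≤ (2 * ‖x‖) ^ n := by gcongr; linarith
            _ = 2 ^ n * ‖x‖ ^ n := by rw [mul_pow]
            _ ≤ _ := by gcongr; linarith
      calc _ ≤ 2 ^ n * (‖x‖ ^ n + 1) * ‖k₀ x‖ := by gcongr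
        _ = _ := by ring
  set M := ∫ x : Space n, (1 + ‖x‖) ^ n * ‖k₀ x‖ with hM
  set G : ℕ → Space n → ℂ := fun j x => (((1 + ‖x‖) ^ n : ℝ) : ℂ) * F j x with hG
  have hFcont : ∀ j, Continuous (F j) := fun j => by
    have := k₀.continuous
    simp only [hF]
    fun_prop
  have hGle : ∀ j x, ‖G j x‖ ≤ r ^ j * ((2 : ℝ) ^ j) ^ n *
      ((1 + ‖(2 : ℝ) ^ j • x‖) ^ n * ‖k₀ ((2 : ℝ) ^ j • x)‖) := by
    intro j x
    simp only [hG, hF]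
    rw [norm_mul, norm_mul, Complex.norm_real, Complex.norm_real, Real.norm_of_nonneg (by positivity),
      Real.norm_of_nonneg (by positivity)]
    have h3 : 1 + ‖x‖ ≤ 1 + ‖(2 : ℝ) ^ j • x‖ := by
      rw [norm_smul, Real.norm_of_nonneg (by positivity)]
      have := le_mul_of_one_le_left (norm_nonneg x) (h2j j)
      linarith
    calc _ ≤ (1 + ‖(2 : ℝ) ^ j • x‖) ^ n * (r ^ j * ((2 : ℝ) ^ j) ^ n * ‖k₀ ((2 : ℝ) ^ j • x)‖) := by
          gcongr
      _ = _ := by ring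
  have hGb : ∀ j, Integrable fun x : Space n => r ^ j * ((2 : ℝ) ^ j) ^ n *
      ((1 + ‖(2 : ℝ) ^ j • x‖) ^ n * ‖k₀ ((2 : ℝ) ^ j • x)‖) := fun j =>
    (hkint.comp_smul (R := (2 : ℝ) ^ j) (by positivity)).const_mul _
  have hGint : ∀ j, Integrable (G j) := fun j => by
    refine Integrable.mono' (hGb j) ?_ (Eventually.of_forall (hGle j))
    have := hFcont j
    exact (by simp only [hG]; fun_prop : Continuous (G j)).aestronglyMeasurable
  have hGsum : Summable fun j => ∫ x, ‖G j x‖ := by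
    refine Summable.of_nonneg_of_le (fun j => by positivity) (fun j => ?_) (hgeo.mul_right M)
    refine (integral_mono (hGint j).norm (hGb j) (hGle j)).trans (le_of_eq ?_)
    rw [integral_const_mul, Measure.integral_comp_smul volume
      (fun x : Space n => (1 + ‖x‖) ^ n * ‖k₀ x‖), abs_of_pos (by positivity), ← hM]
    simp only [finrank_euclideanSpace, Fintype.card_fin, smul_eq_mul]
    field_simp
  have hFG : ∀ j x, ‖F j x‖ ≤ ‖G j x‖ := by
    intro j x
    simp only [hG]
    rw [norm_mul (((1 + ‖x‖) ^ n : ℝ) : ℂ), Complex.norm_real, Real.norm_of_nonneg (by positivity)]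
    exact le_mul_of_one_le_left (norm_nonneg _) (one_le_pow₀ (by linarith [norm_nonneg x]))
  have hFint : ∀ j, Integrable (F j) := fun j =>
    (hGint j).mono (hFcont j).aestronglyMeasurable (Eventually.of_forall (hFG j))
  have hFsum : Summable fun j => ∫ x, ‖F j x‖ :=
    Summable.of_nonneg_of_le (fun j => by positivity)
      (fun j => integral_mono (hFint j).norm (hGint j).norm (hFG j)) hGsum
  -- Off the origin the decay ‖x‖^(-n) of k₀ cancels the factor 2^(jn). In dimension 0 the origin is
  -- the whole space and this factor is 1.
  have hp : ∀ᵐ x : Space n, Summable fun j => F j x := by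
    rcases Nat.eq_zero_or_pos n with rfl | hn
    · refine Eventually.of_forall fun x => ?_
      refine Summable.of_norm_bounded (g := fun j => r ^ j * ‖k₀ 0‖) (hgeo.mul_right _) fun j => ?_
      simp only [hF, norm_mul, Complex.norm_real, pow_zero, mul_one]
      rw [Real.norm_of_nonneg (by positivity), Subsingleton.elim ((2 : ℝ) ^ j • x) 0]
    have : Nonempty (Fin n) := ⟨⟨0, hn⟩⟩
    have h0 : ∀ᵐ x : Space n, x ≠ 0 := by simp [ae_iff, measure_singleton]
    filter_upwards [h0] with x hx
    obtain ⟨C, hC⟩ := k₀.decay n 0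
    refine Summable.of_norm_bounded (g := fun j => r ^ j * (C / ‖x‖ ^ n)) (hgeo.mul_right _)
      fun j => ?_
    have h1 := hC.2 ((2 : ℝ) ^ j • x)
    have hx' : 0 < ‖x‖ := norm_pos_iff.2 hx
    rw [norm_iteratedFDeriv_zero, norm_smul, Real.norm_of_nonneg (by positivity), mul_pow] at h1
    simp only [hF, norm_mul, Complex.norm_real]
    rw [← norm_mul, Real.norm_of_nonneg (by positivity), mul_assoc]
    gcongr
    rw [le_div_iff₀ (by positivity)]
    linarith
  refine ⟨fun x => ∑' j, F j x, integrable_tsum hFint hFsum hp, ?_, fun ξ => ?_⟩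
  · simp_rw [← tsum_mul_left]
    refine integrable_tsum hGint hGsum ?_
    filter_upwards [hp] with x hx
    exact hx.mul_left _
  · set e : Space n → ℂ := fun v =>
      Complex.exp (((-2 * Real.pi * inner ℝ v ξ : ℝ) : ℂ) * Complex.I) with he
    have hnorm : ∀ j v, ‖e v * F j v‖ = ‖F j v‖ := fun j v => by
      rw [norm_mul, he]
      simp only
      rw [Complex.norm_exp_ofReal_mul_I, one_mul]
    have h1 := hasSum_integral_of_summable_integral_norm (F := fun j v => e v * F j v)
      (fun j => integrable_exp_mul (hFint j) ξ) (by simpa only [hnorm] using hFsum)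
    have h2 : ∀ j, ∫ v, e v * F j v = ((‖ξ‖ ^ (-lam) *
        (cutoff (c / 2 * ((2 : ℝ) ^ j)⁻¹ * ‖ξ‖) - cutoff (c * ((2 : ℝ) ^ j)⁻¹ * ‖ξ‖)) : ℝ) : ℂ) := by
      intro j
      have h3 : ∫ v, e v * F j v = 𝓕 (F j) ξ := by
        rw [Real.fourier_eq']; simp only [smul_eq_mul, he]
      have h2p : (0 : ℝ) < 2 ^ j := by positivity
      rw [h3, hF]
      simp only
      rw [fourier_const_mul, fourier_comp_smul _ h2p, hFk₀, ha]
      simp only [finrank_euclideanSpace, Fintype.card_fin]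
      rw [← Complex.ofReal_mul, ← Complex.ofReal_mul]
      congr 1
      have h4 : r ^ j = ((2 : ℝ) ^ j) ^ (-lam) := by
        rw [hr, ← Real.rpow_natCast, ← Real.rpow_mul (by norm_num), mul_comm (-lam),
          Real.rpow_mul (by norm_num), Real.rpow_natCast]
      rw [norm_smul, Real.norm_of_nonneg (by positivity), Real.mul_rpow (by positivity)
        (norm_nonneg _), h4, Real.inv_rpow h2p.le, inv_pow]
      have h5 : ((2 : ℝ) ^ j) ^ (-lam) ≠ 0 := (Real.rpow_pos_of_pos h2p _).ne'
      field_simp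
    have h6 : Tendsto (fun N => ∑ j ∈ Finset.range N, ∫ v, e v * F j v) atTop
        (𝓝 (((‖ξ‖ ^ (-lam) * (1 - cutoff (c * ‖ξ‖)) : ℝ) : ℂ))) := by
      have h7 : ∀ N, ∑ j ∈ Finset.range N, ∫ v, e v * F j v =
          ((‖ξ‖ ^ (-lam) * (cutoff (c * ((2 : ℝ) ^ N)⁻¹ * ‖ξ‖) - cutoff (c * ‖ξ‖)) : ℝ) : ℂ) := by
        intro N
        simp only [h2]
        induction N with
        | zero => simp
        | succ N ih =>
          rw [Finset.sum_range_succ, ih, ← Complex.ofReal_add]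
          congr 1
          have : c / 2 * ((2 : ℝ) ^ N)⁻¹ * ‖ξ‖ = c * ((2 : ℝ) ^ (N + 1))⁻¹ * ‖ξ‖ := by
            rw [pow_succ]; field_simp
          rw [this]; ring
      refine Tendsto.congr' ?_ tendsto_const_nhds
      have h8 : Tendsto (fun N : ℕ => c * ((2 : ℝ) ^ N)⁻¹ * ‖ξ‖) atTop (𝓝 0) := by
        have := (tendsto_inv_atTop_zero.comp
          (tendsto_pow_atTop_atTop_of_one_lt (one_lt_two (α := ℝ)))).const_mul c |>.mul_const ‖ξ‖
        simpa using this
      filter_upwards [h8.eventually (gt_mem_nhds one_pos)] with N hN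
      rw [h7, cutoff_of_le_one hN.le]
    rw [tendsto_nhds_unique h6 h1.tendsto_sum_nat, Real.fourier_eq']
    refine integral_congr_ae (Eventually.of_forall fun v => ?_)
    simp only [smul_eq_mul, he, tsum_mul_left]

/-! ### Weighted convolution inequalities. -/

/-- Peetre's inequality, from 1 + ‖y‖ ≤ (1 + ‖x‖)(1 + ‖x+y‖). -/
theorem one_add_norm_sub_rpow_le {H : Type*} [NormedAddCommGroup H] {s : ℝ} (hs : 0 ≤ s) (x y : H) :
    (1 + ‖x + y‖) ^ (-s) ≤ (1 + ‖x‖) ^ s * (1 + ‖y‖) ^ (-s) := by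
  have h : 1 + ‖y‖ ≤ (1 + ‖x‖) * (1 + ‖x + y‖) := by
    have h1 : ‖y‖ ≤ ‖x‖ + ‖x + y‖ := by
      calc ‖y‖ = ‖(x + y) - x‖ := by congr 1; abel
        _ ≤ ‖x + y‖ + ‖x‖ := norm_sub_le _ _
        _ = _ := add_comm _ _
    nlinarith [norm_nonneg x, norm_nonneg (x + y)]
  have h2 := Real.rpow_le_rpow (by positivity) h hs
  rw [Real.mul_rpow (by positivity) (by positivity)] at h2
  rw [Real.rpow_neg (by positivity), Real.rpow_neg (by positivity), ← div_eq_mul_inv,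
    le_div_iff₀ (by positivity), inv_mul_le_iff₀ (by positivity), mul_comm]
  exact h2

/-- Where ‖z+y‖ ≥ ‖y‖/2 the power is at most a multiple of ‖y‖^(α-n) and the weight is integrable.
Where ‖z+y‖ < r = ‖y‖/2 the weight is at most r^(-n), and the power integrates to a multiple of r^α.
-/
theorem exists_integral_mul_norm_add_rpow_le {n : ℕ} (hn : 1 ≤ n) {α τ : ℝ} (hα : 0 < α)
    (hαn : α < n) (hτ : 0 < τ) : ∃ C : ℝ, 0 ≤ C ∧ ∀ y : Space n, y ≠ 0 →
      Integrable (fun z : Space n => (1 + ‖z‖) ^ (-(n + τ)) * ‖z + y‖ ^ (α - n)) ∧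
      ∫ z : Space n, (1 + ‖z‖) ^ (-(n + τ)) * ‖z + y‖ ^ (α - n) ≤ C * ‖y‖ ^ (α - n) := by
  have : Nonempty (Fin n) := ⟨⟨0, hn⟩⟩
  have hfr : Module.finrank ℝ (Space n) = n := by simp
  set w : Space n → ℝ := fun z => (1 + ‖z‖) ^ (-(n + τ)) with hw
  have hwi : Integrable w := integrable_one_add_norm (by rw [hfr]; linarith)
  have hw0 : ∀ z, 0 ≤ w z := fun z => by positivity
  set g : Space n → ℝ := (Metric.ball (0 : Space n) 1).indicator (fun x => ‖x‖ ^ (-(n - α)))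
    with hg
  have hgi : Integrable g := IntegrableOn.integrable_indicator
    (integrableOn_ball_norm_rpow (by rw [hfr]; linarith) 1) measurableSet_ball
  have hg0 : ∀ z, 0 ≤ g z := fun z => Set.indicator_nonneg (fun x _ => by positivity) _
  have hn0 : (0 : ℝ) < n := by exact_mod_cast hn
  refine ⟨2 ^ (n - α) * (∫ z, w z) + 2 ^ (n - α) * ∫ z, g z, ?_, fun y hy => ?_⟩
  · have h1 : 0 ≤ ∫ z, w z := integral_nonneg hw0
    have h2 : 0 ≤ ∫ z, g z := integral_nonneg hg0
    positivity
  have hy0 : 0 < ‖y‖ := norm_pos_iff.2 hy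
  set r := ‖y‖ / 2 with hr
  have hr0 : 0 < r := by positivity
  have hrα : r ^ (α - n) = 2 ^ (n - α) * ‖y‖ ^ (α - n) := by
    rw [hr, Real.div_rpow hy0.le (by norm_num), div_eq_mul_inv, ← Real.rpow_neg (by norm_num), mul_comm]
    congr 2; ring
  set D : Space n → ℝ := fun z => r ^ (α - n) * w z +
    (r⁻¹ ^ n * r ^ (α - n)) * g (r⁻¹ • (z + y)) with hD
  have hDi1 : Integrable fun z => (r⁻¹ ^ n * r ^ (α - n)) * g (r⁻¹ • (z + y)) :=
    ((hgi.comp_smul (inv_ne_zero hr0.ne')).comp_add_right y).const_mul _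
  have hDi : Integrable D := (hwi.const_mul _).add hDi1
  have hle : ∀ z, w z * ‖z + y‖ ^ (α - n) ≤ D z := by
    intro z
    simp only [hD]
    rcases lt_or_ge ‖z + y‖ r with h | h
    · have hz : r ≤ 1 + ‖z‖ := by
        have : ‖y‖ ≤ ‖z + y‖ + ‖z‖ := by
          calc ‖y‖ = ‖(z + y) - z‖ := by congr 1; abel
            _ ≤ _ := norm_sub_le _ _
        linarith
      have h1 : w z ≤ r⁻¹ ^ n := by
        calc w z ≤ (1 + ‖z‖) ^ (-(n : ℝ)) :=
              Real.rpow_le_rpow_of_exponent_le (by linarith [norm_nonneg z]) (by linarith)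
          _ ≤ r ^ (-(n : ℝ)) := Real.rpow_le_rpow_of_nonpos hr0 hz (by linarith)
          _ = _ := by rw [Real.rpow_neg hr0.le, Real.rpow_natCast, inv_pow]
      have h2 : r ^ (α - n) * g (r⁻¹ • (z + y)) = ‖z + y‖ ^ (α - n) := by
        have h3 : ‖r⁻¹ • (z + y)‖ = r⁻¹ * ‖z + y‖ := by
          rw [norm_smul, Real.norm_of_nonneg (by positivity)]
        rw [hg, Set.indicator_of_mem, h3, Real.mul_rpow (by positivity) (norm_nonneg _), neg_sub,
          Real.inv_rpow hr0.le]
        · have : r ^ (α - n) ≠ 0 := (Real.rpow_pos_of_pos hr0 _).ne'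
          field_simp
        · rw [mem_ball_zero_iff, h3, inv_mul_lt_iff₀ hr0]; linarith
      rw [mul_assoc, h2]
      have : 0 ≤ r ^ (α - n) * w z := by have := hw0 z; positivity
      have := mul_le_mul_of_nonneg_right h1 (by positivity : 0 ≤ ‖z + y‖ ^ (α - n))
      linarith
    · have h1 : ‖z + y‖ ^ (α - n) ≤ r ^ (α - n) :=
        Real.rpow_le_rpow_of_nonpos hr0 h (by linarith)
      have h2 : 0 ≤ (r⁻¹ ^ n * r ^ (α - n)) * g (r⁻¹ • (z + y)) := by
        have := hg0 (r⁻¹ • (z + y)); positivity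
      have := mul_le_mul_of_nonneg_left h1 (hw0 z)
      linarith
  have hmeas : Measurable fun z : Space n => w z * ‖z + y‖ ^ (α - n) := by
    simp only [hw]; fun_prop
  have hint : Integrable fun z : Space n => w z * ‖z + y‖ ^ (α - n) :=
    hDi.mono' hmeas.aestronglyMeasurable (Eventually.of_forall fun z => by
      rw [Real.norm_of_nonneg (mul_nonneg (hw0 z) (by positivity))]; exact hle z)
  refine ⟨hint, (integral_mono hint hDi hle).trans (le_of_eq ?_)⟩
  simp only [hD]
  rw [integral_add (hwi.const_mul _) hDi1, integral_const_mul, integral_const_mul,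
    integral_add_right_eq_self (fun z => g (r⁻¹ • z)) y, Measure.integral_comp_smul volume g, hfr,
    abs_of_pos (by positivity), hrα, smul_eq_mul]
  field_simp

/-! ### Taylor remainders of the character as symbols. -/

/-- The character `t ↦ exp(-2πit)`. -/
def character (t : ℝ) : ℂ := Complex.exp (((-2 * Real.pi * t : ℝ) : ℂ) * Complex.I)

/-- The Taylor polynomial of degree `< k` of `exp(-2πit)`. -/
def characterTaylor (k : ℕ) (t : ℝ) : ℂ :=
  ∑ j ∈ Finset.range k, (((-2 * Real.pi * t : ℝ) : ℂ) * Complex.I) ^ j / (j.factorial : ℂ)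

theorem norm_character (t : ℝ) : ‖character t‖ = 1 := Complex.norm_exp_ofReal_mul_I _

theorem hasDerivAt_phase (t : ℝ) :
    HasDerivAt (fun t : ℝ => ((-2 * Real.pi * t : ℝ) : ℂ) * Complex.I)
      (-2 * Real.pi * Complex.I) t := by
  have := (((hasDerivAt_id t).const_mul (-2 * Real.pi)).ofReal_comp).mul_const Complex.I
  simpa using this

theorem hasDerivAt_character (t : ℝ) :
    HasDerivAt character (-2 * Real.pi * Complex.I * character t) t := by
  exact (hasDerivAt_phase t).cexp.congr_deriv (mul_comm _ _)

theorem hasDerivAt_characterTaylor (k : ℕ) (t : ℝ) :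
    HasDerivAt (characterTaylor k) (-2 * Real.pi * Complex.I * characterTaylor (k - 1) t) t := by
  cases k with
  | zero =>
    have : characterTaylor 0 = fun _ => 0 := by ext; simp [characterTaylor]
    rw [Nat.zero_sub, this, mul_zero]
    exact hasDerivAt_const t 0
  | succ k =>
    have h : ∀ j ∈ Finset.range (k + 1), HasDerivAt
        (fun t : ℝ => (((-2 * Real.pi * t : ℝ) : ℂ) * Complex.I) ^ j / (j.factorial : ℂ))
        (j * (((-2 * Real.pi * t : ℝ) : ℂ) * Complex.I) ^ (j - 1) * (-2 * Real.pi * Complex.I) /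
          (j.factorial : ℂ)) t := fun j _ => ((hasDerivAt_phase t).fun_pow j).div_const _
    have h1 := HasDerivAt.fun_sum h
    refine (h1.congr_deriv ?_)
    rw [Finset.sum_range_succ', characterTaylor, Finset.mul_sum]
    simp only [Nat.cast_zero, zero_mul, zero_div, add_zero, Nat.add_sub_cancel]
    refine Finset.sum_congr rfl fun j _ => ?_
    have hj : (j.factorial : ℂ) ≠ 0 := by exact_mod_cast j.factorial_ne_zero
    have hj1 : ((j : ℂ) + 1) ≠ 0 := by exact_mod_cast j.succ_ne_zero
    rw [Nat.factorial_succ]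
    push_cast
    field_simp

theorem contDiff_character {m : WithTop ℕ∞} : ContDiff ℝ m character := by
  have h1 : ContDiff ℝ m fun t : ℝ => ((-2 * Real.pi * t : ℝ) : ℂ) :=
    Complex.ofRealCLM.contDiff.comp (contDiff_const.mul contDiff_id)
  exact (h1.mul contDiff_const).cexp

theorem contDiff_characterTaylor {m : WithTop ℕ∞} (k : ℕ) : ContDiff ℝ m (characterTaylor k) := by
  have h1 : ContDiff ℝ m fun t : ℝ => ((-2 * Real.pi * t : ℝ) : ℂ) :=
    Complex.ofRealCLM.contDiff.comp (contDiff_const.mul contDiff_id)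
  exact ContDiff.sum fun j _ => ((h1.mul contDiff_const).pow j).div_const _

@[fun_prop]
theorem continuous_character : Continuous character := (contDiff_character (m := 0)).continuous

@[fun_prop]
theorem continuous_characterTaylor (k : ℕ) : Continuous (characterTaylor k) :=
  (contDiff_characterTaylor (m := 0) k).continuous

theorem iteratedDeriv_characterTaylor (i k : ℕ) :
    iteratedDeriv i (characterTaylor k) =
      fun t => (-2 * Real.pi * Complex.I) ^ i * characterTaylor (k - i) t := by
  induction i with
  | zero => simp
  | succ i ih =>
    rw [iteratedDeriv_succ, ih]
    ext t
    rw [((hasDerivAt_characterTaylor (k - i) t).const_mul _).deriv, Nat.sub_sub, pow_succ]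
    ring

theorem iteratedDeriv_character (i : ℕ) :
    iteratedDeriv i character = fun t => (-2 * Real.pi * Complex.I) ^ i * character t := by
  induction i with
  | zero => simp
  | succ i ih =>
    rw [iteratedDeriv_succ, ih]
    ext t
    rw [((hasDerivAt_character t).const_mul _).deriv, pow_succ]
    ring

theorem norm_neg_two_pi_I : ‖(-2 * Real.pi * Complex.I : ℂ)‖ = 2 * Real.pi := by
  simp [abs_of_pos Real.pi_pos]

theorem norm_character_sub_le (k : ℕ) (t : ℝ) :
    ‖character t - characterTaylor k t‖ ≤ (2 * Real.pi * |t|) ^ k * Real.exp (2 * Real.pi * |t|) := by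
  have h := Complex.norm_exp_sub_sum_le_norm_mul_exp (((-2 * Real.pi * t : ℝ) : ℂ) * Complex.I) k
  have h1 : ‖((-2 * Real.pi * t : ℝ) : ℂ) * Complex.I‖ = 2 * Real.pi * |t| := by
    rw [norm_mul, Complex.norm_real, Complex.norm_I, mul_one, Real.norm_eq_abs, abs_mul, abs_mul,
      abs_of_pos Real.pi_pos]
    norm_num
  rwa [h1] at h

theorem norm_characterTaylor_le {k : ℕ} {ρ t : ℝ} (hk : 1 ≤ k) (ht : |t| ≤ ρ) :
    ‖characterTaylor k t‖ ≤ Real.exp (2 * Real.pi) * (1 + ρ) ^ (k - 1) := by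
  have hρ : 0 ≤ ρ := (abs_nonneg t).trans ht
  calc ‖characterTaylor k t‖
      ≤ ∑ j ∈ Finset.range k, (2 * Real.pi) ^ j / j.factorial * (1 + ρ) ^ (k - 1) := by
        refine (norm_sum_le _ _).trans (Finset.sum_le_sum fun j hj => ?_)
        have h1 : ‖((-2 * Real.pi * t : ℝ) : ℂ) * Complex.I‖ = 2 * Real.pi * |t| := by
          rw [norm_mul, Complex.norm_real, Complex.norm_I, mul_one, Real.norm_eq_abs, abs_mul,
            abs_mul, abs_of_pos Real.pi_pos]
          norm_num
        rw [norm_div, norm_pow, h1, mul_pow, Complex.norm_natCast, mul_div_right_comm]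
        have hpi := Real.pi_pos
        gcongr
        have hj' := Finset.mem_range.1 hj
        calc |t| ^ j ≤ (1 + ρ) ^ j := by gcongr; linarith
          _ ≤ _ := pow_le_pow_right₀ (by linarith) (by omega)
    _ = (∑ j ∈ Finset.range k, (2 * Real.pi) ^ j / j.factorial) * (1 + ρ) ^ (k - 1) := by
        rw [Finset.sum_mul]
    _ ≤ _ := by
        gcongr
        exact Real.sum_le_exp_of_nonneg (by positivity) k

section Inner

variable {H : Type*} [NormedAddCommGroup H] [InnerProductSpace ℝ H]

theorem norm_iteratedFDeriv_comp_inner_le {h : ℝ → ℂ} (hh : ContDiff ℝ ∞ h) (i : ℕ) (z ξ : H) :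
    ‖iteratedFDeriv ℝ i (fun ξ => h (inner ℝ ξ z)) ξ‖ ≤
      ‖iteratedDeriv i h (inner ℝ ξ z)‖ * ‖z‖ ^ i := by
  have h0 : (fun ξ => h (inner ℝ ξ z)) = h ∘ (innerSL ℝ z) := by
    ext ξ; simp [real_inner_comm]
  rw [h0, ContinuousLinearMap.iteratedFDeriv_comp_right (innerSL ℝ z) hh ξ
    (i := i) (by exact_mod_cast le_top)]
  refine (ContinuousMultilinearMap.norm_compContinuousLinearMap_le _ _).trans ?_
  rw [Finset.prod_const, Finset.card_univ, Fintype.card_fin, innerSL_apply_norm,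
    norm_iteratedFDeriv_eq_norm_iteratedDeriv, innerSL_apply_apply, real_inner_comm]

theorem symbolBound_comp_inner {K : ℕ} {A : ℝ} {h : ℝ → ℂ} (hh : ContDiff ℝ ∞ h) {z ξ : H}
    (hA : ∀ i ≤ K, ‖iteratedDeriv i h (inner ℝ ξ z)‖ * (‖z‖ * ‖ξ‖) ^ i ≤ A) :
    SymbolBound K A (fun ξ => h (inner ℝ ξ z)) ξ := by
  refine ⟨?_, fun i hi => ?_⟩
  · have h0 : (fun ξ => h (inner ℝ ξ z)) = h ∘ (innerSL ℝ z) := by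
      ext ξ; simp [real_inner_comm]
    rw [h0]
    exact ((hh.of_le (by exact_mod_cast le_top)).comp (innerSL ℝ z).contDiff).contDiffAt
  · calc _ ≤ ‖iteratedDeriv i h (inner ℝ ξ z)‖ * ‖z‖ ^ i * ‖ξ‖ ^ i := by
          gcongr; exact norm_iteratedFDeriv_comp_inner_le hh i z ξ
      _ = _ := by rw [mul_pow]; ring
      _ ≤ A := hA i hi

/-- With ρ = ‖z‖‖ξ‖, each ξ-derivative brings out a factor ‖z‖ and lowers the Taylor order by one,
so every scale-invariant derivative is still O(ρ^k) for ρ ≤ 2. -/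
theorem symbolBound_character_sub (K k : ℕ) {z ξ : H} (hρ : ‖z‖ * ‖ξ‖ ≤ 2) :
    SymbolBound K ((2 * Real.pi) ^ (k + K) * Real.exp (4 * Real.pi) * 2 ^ K * (‖z‖ * ‖ξ‖) ^ k)
      (fun ξ => character (inner ℝ ξ z) - characterTaylor k (inner ℝ ξ z)) ξ := by
  refine symbolBound_comp_inner (h := fun t => character t - characterTaylor k t)
    (contDiff_character.sub (contDiff_characterTaylor k)) fun i hi => ?_
  have hd : iteratedDeriv i (fun t => character t - characterTaylor k t) (inner ℝ ξ z) =
      (-2 * Real.pi * Complex.I) ^ i *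
        (character (inner ℝ ξ z) - characterTaylor (k - i) (inner ℝ ξ z)) := by
    rw [iteratedDeriv_fun_sub contDiff_character.contDiffAt
      (contDiff_characterTaylor k).contDiffAt, iteratedDeriv_character,
      iteratedDeriv_characterTaylor]
    ring
  set ρ := ‖z‖ * ‖ξ‖ with hρd
  have hρ0 : 0 ≤ ρ := by positivity
  have hin : |inner ℝ ξ z| ≤ ρ := by
    rw [hρd, mul_comm]; exact abs_real_inner_le_norm ξ z
  have hpi := Real.pi_gt_three
  rw [hd, norm_mul, norm_pow, norm_neg_two_pi_I]
  calc _ ≤ (2 * Real.pi) ^ i * ((2 * Real.pi * ρ) ^ (k - i) * Real.exp (2 * Real.pi * 2)) *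
        ρ ^ i := by
        gcongr
        refine (norm_character_sub_le _ _).trans ?_
        gcongr
        exact hin.trans hρ
    _ = (2 * Real.pi) ^ (i + (k - i)) * Real.exp (4 * Real.pi) * ρ ^ ((k - i) + i) := by
        rw [mul_pow, pow_add, pow_add, show 2 * Real.pi * 2 = 4 * Real.pi by ring]; ring
    _ ≤ (2 * Real.pi) ^ (k + K) * Real.exp (4 * Real.pi) * (2 ^ K * ρ ^ k) := by
        refine mul_le_mul (mul_le_mul_of_nonneg_right (pow_le_pow_right₀ (by linarith) (by omega))
          (by positivity)) ?_ (by positivity) (by positivity)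
        -- With truncated subtraction the exponent is max k i; its excess over k is at most K and is
        -- paid for by ρ ≤ 2.
        rw [show k - i + i = (k - i + i - k) + k by omega, pow_add]
        refine mul_le_mul_of_nonneg_right ?_ (by positivity)
        calc ρ ^ (k - i + i - k) ≤ 2 ^ (k - i + i - k) := by gcongr
          _ ≤ 2 ^ K := pow_le_pow_right₀ (by norm_num) (by omega)
    _ = _ := by ring

/-- The complementary regime: a polynomial of degree at most k-1 in ξ·z, whose top power dominates
once ρ ≥ 1. -/
theorem symbolBound_characterTaylor (K : ℕ) {k : ℕ} {z ξ : H} (hρ : 1 ≤ ‖z‖ * ‖ξ‖) :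
    SymbolBound K ((2 * Real.pi) ^ k * Real.exp (2 * Real.pi) * 2 ^ k * (‖z‖ * ‖ξ‖) ^ (k - 1))
      (fun ξ => characterTaylor k (inner ℝ ξ z)) ξ := by
  refine symbolBound_comp_inner (contDiff_characterTaylor k) fun i hi => ?_
  set ρ := ‖z‖ * ‖ξ‖ with hρd
  have hin : |inner ℝ ξ z| ≤ ρ := by
    rw [hρd, mul_comm]; exact abs_real_inner_le_norm ξ z
  have hpi := Real.pi_gt_three
  rw [iteratedDeriv_characterTaylor, norm_mul, norm_pow, norm_neg_two_pi_I]
  rcases le_or_gt k i with h | h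
  · have : characterTaylor 0 (inner ℝ ξ z) = 0 := by simp [characterTaylor]
    rw [Nat.sub_eq_zero_of_le h, this, norm_zero, mul_zero, zero_mul]
    positivity
  · calc _ ≤ (2 * Real.pi) ^ i * (Real.exp (2 * Real.pi) * (1 + ρ) ^ (k - i - 1)) * ρ ^ i := by
          gcongr
          exact norm_characterTaylor_le (by omega) hin
      _ ≤ (2 * Real.pi) ^ k * (Real.exp (2 * Real.pi) * (2 * ρ) ^ (k - i - 1)) * ρ ^ i := by
          gcongr
          · linarith
          · linarith
      _ = (2 * Real.pi) ^ k * Real.exp (2 * Real.pi) * 2 ^ (k - i - 1) * ρ ^ (k - i - 1 + i) := by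
          rw [mul_pow, pow_add]; ring
      _ ≤ _ := by
          rw [show k - i - 1 + i = k - 1 by omega]
          gcongr
          · norm_num
          · omega

end Inner

theorem integrable_of_symbolBound {n : ℕ} (hn : 1 ≤ n) {α A : ℝ} (hα : α < n) {σ : Space n → ℂ}
    (hσ : ∀ ξ, ξ ≠ 0 → SymbolBound n (A * ‖ξ‖ ^ (-α)) σ ξ) (h0 : ∀ ξ, 1 ≤ ‖ξ‖ → σ ξ = 0) :
    Integrable σ := by
  have : Nonempty (Fin n) := ⟨⟨0, hn⟩⟩
  have hI : IntegrableOn (fun x : Space n => A * ‖x‖ ^ (-α)) (Metric.ball 0 1) :=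
    (integrableOn_ball_norm_rpow (by simpa using hα) 1).const_mul A
  have hae : ∀ᵐ x : Space n, x ≠ 0 := by simp [ae_iff, measure_singleton]
  refine Integrable.mono' (IntegrableOn.integrable_indicator hI measurableSet_ball) ?_ ?_
  · have hc : ContinuousOn σ {0}ᶜ := fun ξ hξ => (hσ ξ hξ).1.continuousAt.continuousWithinAt
    have h1 := hc.aestronglyMeasurable (μ := volume) (measurableSet_singleton 0).compl
    rwa [Measure.restrict_eq_self_of_ae_mem (s := ({0}ᶜ : Set (Space n))) hae] at h1
  · filter_upwards [hae] with ξ hξ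
    by_cases h : ‖ξ‖ < 1
    · rw [Set.indicator_of_mem (by simpa using h)]
      exact (hσ ξ hξ).norm_le
    · rw [Set.indicator_of_notMem (by simpa using h), h0 ξ (not_lt.1 h), norm_zero]

theorem exists_symbolBound_cutoff_norm {n : ℕ} (K : ℕ) : ∃ C : ℝ, 0 ≤ C ∧ ∀ c : ℝ, 0 < c →
    ∀ ξ : Space n, ξ ≠ 0 → SymbolBound K C (fun ξ : Space n => ((cutoff (c * ‖ξ‖) : ℝ) : ℂ)) ξ := by
  obtain ⟨M, hM0, hM⟩ := exists_symbolBound_comp_norm (F := ℂ) (H := Space n) K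
  obtain ⟨Cκ, hCκ1, hCκ⟩ := exists_symbolBound_cutoff K
  exact ⟨M * Cκ, by positivity, fun c hc ξ hξ =>
    hM (fun t => (cutoff (c * t) : ℂ)) Cκ ξ hξ (hCκ c _ hc (norm_pos_iff.2 hξ))⟩

theorem exists_symbolBound_norm_rpow {n : ℕ} (K : ℕ) (a : ℝ) : ∃ C : ℝ, 0 ≤ C ∧
    ∀ ξ : Space n, ξ ≠ 0 → SymbolBound K (C * ‖ξ‖ ^ a) (fun ξ : Space n => ((‖ξ‖ ^ a : ℝ) : ℂ)) ξ := by
  obtain ⟨M, hM0, hM⟩ := exists_symbolBound_comp_norm (F := ℂ) (H := Space n) K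
  obtain ⟨C, hC0, hC⟩ := exists_symbolBound_rpow K a
  exact ⟨M * C, by positivity, fun ξ hξ =>
    (hM _ _ ξ hξ (hC _ (norm_pos_iff.2 hξ))).mono (le_of_eq (by ring))⟩

theorem SymbolBound.one_sub {V : Type*} [NormedAddCommGroup V] [NormedSpace ℝ V] {K : ℕ} {A : ℝ}
    {f : V → ℂ} {x : V} (h : SymbolBound K A f x) : SymbolBound K (1 + A) (fun y => 1 - f y) x := by
  have h2 : SymbolBound K A (fun y => -f y) x := by
    refine ⟨h.1.neg, fun k hk => ?_⟩
    have : (fun y => -f y) = -f := rfl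
    rw [this, iteratedFDeriv_neg, Pi.neg_apply, norm_neg]
    exact h.2 k hk
  simpa [sub_eq_add_neg] using (symbolBound_const K (1 : ℂ) x).add h2

/-- The symbol `|ξ|^(-lam) θ(ξ) (exp(-2πiz·ξ) - T_k(z·ξ))`. -/
def remainderSymbol {n : ℕ} (lam : ℝ) (k : ℕ) (z ξ : Space n) : ℂ :=
  ((‖ξ‖ ^ (-lam) : ℝ) : ℂ) * ((cutoff (32 * ‖ξ‖) : ℝ) *
    (character (inner ℝ ξ z) - characterTaylor k (inner ℝ ξ z)))

/-- The symbol is cut at ρ = ‖z‖‖ξ‖ ~ 1. Inside, the remainder is O(ρ^k), hence O(ρ^β). Outside, the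
Taylor polynomial is O(ρ^(k-1)), hence O(ρ^β), and 1 ≤ ρ^β. Outside, the character is not a symbol
uniformly in z, but as a modulation it translates the transform by z; this is the origin of the term
‖z+y‖^(α-n). -/
theorem exists_norm_fourier_remainderSymbol_le {n k : ℕ} (hn : 1 ≤ n) {α β lam : ℝ} (hα : 0 < α)
    (hαn : α < n) (hk : 1 ≤ k) (hkβ : (k : ℝ) - 1 ≤ β) (hβk : β ≤ k) (hβ : lam - α ≤ β) :
    ∃ C : ℝ, 0 ≤ C ∧ ∀ z : Space n, z ≠ 0 → Integrable (remainderSymbol lam k z) ∧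
      ∀ y : Space n, y ≠ 0 → y + z ≠ 0 → ‖𝓕 (remainderSymbol lam k z) y‖ ≤
        C * ‖z‖ ^ β * (‖y‖ ^ (α - n) + ‖z + y‖ ^ (α - n)) := by
  obtain ⟨C₀, hC₀, hF⟩ := exists_norm_fourier_le_of_symbolBound (K := n) hn hαn (by linarith)
  obtain ⟨Cκ, hCκ0, hCκ⟩ := exists_symbolBound_cutoff_norm (n := n) n
  obtain ⟨Cr, hCr0, hCr⟩ := exists_symbolBound_norm_rpow (n := n) n (-lam)
  have hβ0 : 0 ≤ β := by
    have : (1 : ℝ) ≤ k := by exact_mod_cast hk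
    linarith
  set p : Space n → ℂ := fun ξ => ((‖ξ‖ ^ (-lam) : ℝ) : ℂ) * (cutoff (32 * ‖ξ‖) : ℝ) with hp
  set P := 2 ^ n * Cr * Cκ with hP
  have hP0 : 0 ≤ P := by positivity
  have hpSB : ∀ ξ, ξ ≠ 0 → SymbolBound n (P * ‖ξ‖ ^ (-lam)) p ξ := fun ξ hξ =>
    ((hCr ξ hξ).mul (hCκ 32 (by norm_num) ξ hξ)).mono (le_of_eq (by ring))
  have hp0 : ∀ ξ, 1 / 16 ≤ ‖ξ‖ → p ξ = 0 := fun ξ hξ => by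
    rw [hp]; simp only; rw [cutoff_of_two_le (by linarith)]; simp
  -- Any factor τ whose symbol bound b satisfies b|ξ|^(-lam) ≤ A|ξ|^(-α) on the unit ball yields a
  -- kernel of size A‖y‖^(α-n); beyond the unit ball p is zero.
  have hprod : ∀ (τ : Space n → ℂ) (A : ℝ), 0 ≤ A → (∀ ξ, ξ ≠ 0 → ‖ξ‖ ≤ 1 →
      ∃ b, SymbolBound n b τ ξ ∧ b * ‖ξ‖ ^ (-lam) ≤ A * ‖ξ‖ ^ (-α)) →
      Integrable (fun ξ => p ξ * τ ξ) ∧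
      ∀ y, y ≠ 0 → ‖𝓕 (fun ξ => p ξ * τ ξ) y‖ ≤ C₀ * (2 ^ n * P * A) * ‖y‖ ^ (α - n) := by
    intro τ A hA hτ
    have hSB : ∀ ξ, ξ ≠ 0 → SymbolBound n (2 ^ n * P * A * ‖ξ‖ ^ (-α)) (fun ξ => p ξ * τ ξ) ξ := by
      intro ξ hξ
      rcases le_or_gt ‖ξ‖ 1 with h | h
      · obtain ⟨b, hb, hbA⟩ := hτ ξ hξ h
        refine ((hpSB ξ hξ).mul hb).mono ?_
        calc _ = 2 ^ n * P * (b * ‖ξ‖ ^ (-lam)) := by ring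
          _ ≤ 2 ^ n * P * (A * ‖ξ‖ ^ (-α)) := by gcongr
          _ = _ := by ring
      · have h0 : (fun ξ => p ξ * τ ξ) =ᶠ[𝓝 ξ] fun _ => (0 : ℂ) := by
          filter_upwards [(isOpen_lt continuous_const continuous_norm).mem_nhds
            (show (1 / 16 : ℝ) < ‖ξ‖ by linarith)] with x hx
          rw [hp0 x (le_of_lt hx), zero_mul]
        refine ((symbolBound_const n 0 ξ).congr h0).mono ?_
        rw [norm_zero]; positivity
    have hint := integrable_of_symbolBound hn hαn hSB fun ξ hξ => by
      rw [hp0 ξ (by linarith), zero_mul]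
    exact ⟨hint, hF _ _ (by positivity) hint hSB⟩
  set CA := 2 ^ n * Cκ * ((2 * Real.pi) ^ (k + n) * Real.exp (4 * Real.pi) * 2 ^ n) * 2 ^ k with hCA
  set CB := 2 ^ n * (1 + Cκ) * ((2 * Real.pi) ^ k * Real.exp (2 * Real.pi) * 2 ^ k) with hCB
  have hpi := Real.pi_pos
  have hCA0 : 0 ≤ CA := by positivity
  have hCB0 : 0 ≤ CB := by positivity
  refine ⟨C₀ * (2 ^ n * P * CA) + C₀ * (2 ^ n * P * CB) + C₀ * (2 ^ n * P * (1 + Cκ)),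
    by positivity, fun z hz => ?_⟩
  have hz0 : 0 < ‖z‖ := norm_pos_iff.2 hz
  -- This is where β ≥ lam - α enters: |ξ|^(β-lam) ≤ |ξ|^(-α) for |ξ| ≤ 1.
  have hnum : ∀ ξ : Space n, ξ ≠ 0 → ‖ξ‖ ≤ 1 →
      (‖z‖ * ‖ξ‖) ^ β * ‖ξ‖ ^ (-lam) ≤ ‖z‖ ^ β * ‖ξ‖ ^ (-α) := by
    intro ξ hξ h1
    have hξ0 : 0 < ‖ξ‖ := norm_pos_iff.2 hξ
    rw [Real.mul_rpow hz0.le hξ0.le, mul_assoc, ← Real.rpow_add hξ0]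
    refine mul_le_mul_of_nonneg_left ?_ (by positivity)
    exact Real.rpow_le_rpow_of_exponent_ge hξ0 h1 (by linarith)
  set χ : Space n → ℂ := fun ξ => ((cutoff (‖z‖ * ‖ξ‖) : ℝ) : ℂ) with hχ
  have hχSB : ∀ ξ, ξ ≠ 0 → SymbolBound n Cκ χ ξ := fun ξ hξ => hCκ _ hz0 ξ hξ
  have hsmall : ∀ ξ, ‖z‖ * ‖ξ‖ < 1 → ∀ τ : Space n → ℂ,
      (fun ξ => (1 - χ ξ) * τ ξ) =ᶠ[𝓝 ξ] fun _ => 0 := by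
    intro ξ hξ τ
    filter_upwards [(isOpen_lt (continuous_const.mul continuous_norm) continuous_const).mem_nhds
      hξ] with x hx
    simp only [hχ]
    have hx' : ‖z‖ * ‖x‖ < 1 := hx
    rw [cutoff_of_le_one hx'.le]; simp
  obtain ⟨hAi, hA⟩ := hprod (fun ξ => χ ξ * (character (inner ℝ ξ z) -
      characterTaylor k (inner ℝ ξ z))) (CA * ‖z‖ ^ β) (by positivity) (by
    intro ξ hξ h1
    have hξ0 : 0 < ‖ξ‖ := norm_pos_iff.2 hξ
    rcases le_or_gt (‖z‖ * ‖ξ‖) 2 with h | h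
    · refine ⟨_, (hχSB ξ hξ).mul (symbolBound_character_sub n k h), ?_⟩
      have hρ : (‖z‖ * ‖ξ‖) ^ k ≤ 2 ^ k * (‖z‖ * ‖ξ‖) ^ β := by
        rw [← Real.rpow_natCast (‖z‖ * ‖ξ‖), show (k : ℝ) = (k - β) + β by ring,
          Real.rpow_add (by positivity)]
        gcongr
        calc (‖z‖ * ‖ξ‖) ^ ((k : ℝ) - β) ≤ 2 ^ ((k : ℝ) - β) := by
              gcongr
          _ ≤ 2 ^ (k : ℝ) := Real.rpow_le_rpow_of_exponent_le (by norm_num) (by linarith)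
          _ = _ := Real.rpow_natCast _ _
      calc _ = 2 ^ n * Cκ * ((2 * Real.pi) ^ (k + n) * Real.exp (4 * Real.pi) * 2 ^ n) *
            ((‖z‖ * ‖ξ‖) ^ k * ‖ξ‖ ^ (-lam)) := by ring
        _ ≤ 2 ^ n * Cκ * ((2 * Real.pi) ^ (k + n) * Real.exp (4 * Real.pi) * 2 ^ n) *
            (2 ^ k * (‖z‖ * ‖ξ‖) ^ β * ‖ξ‖ ^ (-lam)) := by gcongr
        _ = CA * ((‖z‖ * ‖ξ‖) ^ β * ‖ξ‖ ^ (-lam)) := by rw [hCA]; ring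
        _ ≤ CA * (‖z‖ ^ β * ‖ξ‖ ^ (-α)) := by gcongr CA * ?_; exact hnum ξ hξ h1
        _ = _ := by ring
    · refine ⟨0, ?_, by rw [zero_mul]; positivity⟩
      have h0 : (fun ξ => χ ξ * (character (inner ℝ ξ z) - characterTaylor k (inner ℝ ξ z)))
          =ᶠ[𝓝 ξ] fun _ => (0 : ℂ) := by
        filter_upwards [(isOpen_lt continuous_const
          (continuous_const.mul continuous_norm)).mem_nhds h] with x hx
        simp only [hχ]
        have hx' : 2 < ‖z‖ * ‖x‖ := hx
        rw [cutoff_of_two_le hx'.le]; simp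
      simpa using (symbolBound_const n 0 ξ).congr h0)
  obtain ⟨hBi, hB⟩ := hprod (fun ξ => (1 - χ ξ) * characterTaylor k (inner ℝ ξ z))
      (CB * ‖z‖ ^ β) (by positivity) (by
    intro ξ hξ h1
    have hξ0 : 0 < ‖ξ‖ := norm_pos_iff.2 hξ
    rcases lt_or_ge (‖z‖ * ‖ξ‖) 1 with h | h
    · refine ⟨0, ?_, by rw [zero_mul]; positivity⟩
      simpa using (symbolBound_const n 0 ξ).congr (hsmall ξ h _)
    · refine ⟨_, (hχSB ξ hξ).one_sub.mul (symbolBound_characterTaylor n (k := k) h), ?_⟩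
      have hρ : (‖z‖ * ‖ξ‖) ^ (k - 1) ≤ (‖z‖ * ‖ξ‖) ^ β := by
        rw [← Real.rpow_natCast]
        exact Real.rpow_le_rpow_of_exponent_le h (by rw [Nat.cast_sub hk]; simpa using hkβ)
      calc _ = CB * ((‖z‖ * ‖ξ‖) ^ (k - 1) * ‖ξ‖ ^ (-lam)) := by rw [hCB]; ring
        _ ≤ CB * ((‖z‖ * ‖ξ‖) ^ β * ‖ξ‖ ^ (-lam)) := by gcongr
        _ ≤ CB * (‖z‖ ^ β * ‖ξ‖ ^ (-α)) := by gcongr CB * ?_; exact hnum ξ hξ h1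
        _ = _ := by ring)
  obtain ⟨hDi, hD⟩ := hprod (fun ξ => (1 - χ ξ) * 1) ((1 + Cκ) * ‖z‖ ^ β) (by positivity) (by
    intro ξ hξ h1
    have hξ0 : 0 < ‖ξ‖ := norm_pos_iff.2 hξ
    rcases lt_or_ge (‖z‖ * ‖ξ‖) 1 with h | h
    · refine ⟨0, ?_, by rw [zero_mul]; positivity⟩
      simpa using (symbolBound_const n 0 ξ).congr (hsmall ξ h fun _ => 1)
    · refine ⟨1 + Cκ, by simpa using (hχSB ξ hξ).one_sub, ?_⟩
      have hρ : 1 ≤ (‖z‖ * ‖ξ‖) ^ β := Real.one_le_rpow h hβ0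
      calc _ = (1 + Cκ) * (1 * ‖ξ‖ ^ (-lam)) := by ring
        _ ≤ (1 + Cκ) * ((‖z‖ * ‖ξ‖) ^ β * ‖ξ‖ ^ (-lam)) := by gcongr
        _ ≤ (1 + Cκ) * (‖z‖ ^ β * ‖ξ‖ ^ (-α)) := by gcongr (1 + Cκ) * ?_; exact hnum ξ hξ h1
        _ = _ := by ring)
  have hsplit : remainderSymbol lam k z = fun ξ =>
      (p ξ * (χ ξ * (character (inner ℝ ξ z) - characterTaylor k (inner ℝ ξ z))) +
        (-1) * (p ξ * ((1 - χ ξ) * characterTaylor k (inner ℝ ξ z)))) +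
      Complex.exp (((-2 * Real.pi * inner ℝ ξ z : ℝ) : ℂ) * Complex.I) *
        (p ξ * ((1 - χ ξ) * 1)) := by
    ext ξ
    have : Complex.exp (((-2 * Real.pi * inner ℝ ξ z : ℝ) : ℂ) * Complex.I) =
        character (inner ℝ ξ z) := rfl
    rw [this, remainderSymbol, hp]
    ring
  have hBi' := hBi.const_mul (-1)
  have hDi' := integrable_exp_mul hDi z
  have hABi : Integrable fun ξ =>
      p ξ * (χ ξ * (character (inner ℝ ξ z) - characterTaylor k (inner ℝ ξ z))) +
        (-1) * (p ξ * ((1 - χ ξ) * characterTaylor k (inner ℝ ξ z))) := hAi.add hBi'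
  rw [hsplit]
  refine ⟨hABi.add hDi', fun y hy hyz => ?_⟩
  rw [fourier_add_of_integrable hABi hDi', fourier_add_of_integrable hAi hBi', fourier_const_mul,
    fourier_exp_mul]
  have e1 := hA y hy
  have e2 := hB y hy
  have e3 := hD (y + z) hyz
  rw [add_comm y z] at e3 ⊢
  refine (norm_add₃_le).trans ?_
  rw [norm_mul, norm_neg, norm_one, one_mul]
  have q1 : 0 ≤ C₀ * (2 ^ n * P * CA) * ‖z‖ ^ β * ‖z + y‖ ^ (α - n) := by positivity
  have q2 : 0 ≤ C₀ * (2 ^ n * P * CB) * ‖z‖ ^ β * ‖z + y‖ ^ (α - n) := by positivity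
  have q3 : 0 ≤ C₀ * (2 ^ n * P * (1 + Cκ)) * ‖z‖ ^ β * ‖y‖ ^ (α - n) := by positivity
  linarith

/-! ### Decay of low-frequency test functions. -/

theorem one_add_pow_le {r : ℝ} (hr : 0 ≤ r) (N : ℕ) : (1 + r) ^ N ≤ 2 ^ N * (1 + r ^ N) := by
  rcases le_total r 1 with h | h
  · calc (1 + r) ^ N ≤ 2 ^ N := by gcongr; linarith
      _ ≤ _ := le_mul_of_one_le_right (by positivity) (by linarith [pow_nonneg hr N])
  · calc (1 + r) ^ N ≤ (2 * r) ^ N := by gcongr; linarith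
      _ = 2 ^ N * r ^ N := by rw [mul_pow]
      _ ≤ _ := by gcongr; linarith

/-- The low frequency cutoff. -/
def lowCutoff {n : ℕ} (ξ : Space n) : ℂ := (cutoff (32 * ‖ξ‖) : ℝ)

theorem contDiff_lowCutoff {n : ℕ} : ContDiff ℝ ∞ (lowCutoff : Space n → ℂ) :=
  contDiff_cutoff_norm 32

theorem lowCutoff_of_le {n : ℕ} {ξ : Space n} (h : 1 / 16 ≤ ‖ξ‖) : lowCutoff ξ = 0 := by
  rw [lowCutoff, cutoff_of_two_le (by linarith)]; simp

theorem hasCompactSupport_lowCutoff {n : ℕ} : HasCompactSupport (lowCutoff : Space n → ℂ) :=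
  hasCompactSupport_cutoff_norm (by norm_num)

theorem norm_lowCutoff_le {n : ℕ} (ξ : Space n) : ‖lowCutoff ξ‖ ≤ 1 := by
  rw [lowCutoff, Complex.norm_real, Real.norm_of_nonneg (cutoff_nonneg _)]
  exact cutoff_le_one _

theorem integrable_lowCutoff {n : ℕ} : Integrable (lowCutoff : Space n → ℂ) :=
  integrable_cutoff_norm (by norm_num)

@[fun_prop]
theorem continuous_lowCutoff {n : ℕ} : Continuous (lowCutoff : Space n → ℂ) :=
  contDiff_lowCutoff.continuous

/-- Integration by parts over the fixed support of the cutoff. The bound is linear in S and its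
constant does not depend on a, so it gives majorants uniform in the parameters z, η and s that can
be integrated against a tempered f. -/
theorem exists_norm_fourier_lowCutoff_mul_le (n N : ℕ) : ∃ C : ℝ, 0 ≤ C ∧
    ∀ (a : Space n → ℂ) (S : ℝ), ContDiff ℝ ∞ a →
      (∀ ξ, ‖ξ‖ ≤ 1 / 16 → ∀ i ≤ N, ‖iteratedFDeriv ℝ i a ξ‖ ≤ S) →
      ∀ x, ‖𝓕 (fun ξ => lowCutoff ξ * a ξ) x‖ ≤ C * S * ((1 + ‖x‖) ^ N)⁻¹ := by
  set B := Metric.closedBall (0 : Space n) (1 / 16) with hB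
  have hBfin : volume B ≠ ⊤ := (isCompact_closedBall _ _).measure_lt_top.ne
  obtain ⟨M, hM0, hM⟩ := exists_iteratedFDeriv_le_of_isCompact N
    (isCompact_closedBall (0 : Space n) (1 / 16)) (f := (lowCutoff : Space n → ℂ))
    (fun x _ => (contDiff_lowCutoff.of_le (by exact_mod_cast le_top)).contDiffAt)
  refine ⟨2 ^ N * (2 * (2 ^ N * M * volume.real B)), by positivity, fun a S ha hS x => ?_⟩
  have hS0 : 0 ≤ S := (norm_nonneg _).trans (hS 0 (by simp) 0 (Nat.zero_le _))
  set h : Space n → ℂ := fun ξ => lowCutoff ξ * a ξ with hh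
  have hcd : ContDiff ℝ ∞ h := contDiff_lowCutoff.mul ha
  have hcs : HasCompactSupport h := hasCompactSupport_lowCutoff.mul_right
  have hi : ∀ i ≤ N, ∫ ξ, ‖iteratedFDeriv ℝ i h ξ‖ ≤ 2 ^ N * M * volume.real B * S := by
    intro i hiN
    have hpt : ∀ ξ, ‖iteratedFDeriv ℝ i h ξ‖ ≤ B.indicator (fun _ => 2 ^ N * M * S) ξ := by
      intro ξ
      by_cases hξ : ξ ∈ B
      · rw [Set.indicator_of_mem hξ]
        refine (norm_iteratedFDeriv_mul_le contDiff_lowCutoff ha ξ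
          (by exact_mod_cast le_top)).trans ?_
        calc _ ≤ ∑ j ∈ Finset.range (i + 1), (i.choose j : ℝ) * M * S := by
              refine Finset.sum_le_sum fun j hj => ?_
              have hj' := Finset.mem_range.1 hj
              gcongr
              · exact hM ξ hξ j (by omega)
              · exact hS ξ (by simpa [hB] using hξ) _ (by omega)
          _ = 2 ^ i * M * S := by
              rw [← Finset.sum_mul, ← Finset.sum_mul]
              congr 2
              exact_mod_cast Nat.sum_range_choose i
          _ ≤ _ := by gcongr; norm_num
      · have h0 : h =ᶠ[𝓝 ξ] fun _ => 0 := by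
          rw [hB, mem_closedBall_zero_iff, not_le] at hξ
          filter_upwards [(isOpen_lt continuous_const continuous_norm).mem_nhds hξ] with z hz
          rw [hh]
          simp only
          rw [lowCutoff_of_le (le_of_lt hz), zero_mul]
        rw [Set.indicator_of_notMem hξ, (h0.iteratedFDeriv ℝ i).eq_of_nhds]
        have : iteratedFDeriv ℝ i (fun _ : Space n => (0 : ℂ)) = 0 := iteratedFDeriv_fun_zero
        simp [this]
    calc _ ≤ ∫ ξ, B.indicator (fun _ => 2 ^ N * M * S) ξ := by
          refine integral_mono_of_nonneg (Eventually.of_forall fun _ => norm_nonneg _) ?_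
            (Eventually.of_forall hpt)
          exact (integrable_indicator_iff measurableSet_closedBall).2
            (integrableOn_const hBfin)
      _ = _ := by
          rw [integral_indicator measurableSet_closedBall, setIntegral_const, smul_eq_mul]
          ring
  have h1 := pow_mul_norm_fourier_le (K := 0) (hcd.of_le (by exact_mod_cast le_top)) hcs x
  have h2 := pow_mul_norm_fourier_le (K := N) (hcd.of_le (by exact_mod_cast le_top)) hcs x
  have h3 := hi 0 (Nat.zero_le _)
  have h4 := hi N le_rfl
  rw [pow_zero, one_mul] at h1
  rw [← div_eq_mul_inv, le_div_iff₀ (by positivity)]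
  calc ‖𝓕 h x‖ * (1 + ‖x‖) ^ N ≤ ‖𝓕 h x‖ * (2 ^ N * (1 + ‖x‖ ^ N)) := by
        gcongr
        exact one_add_pow_le (norm_nonneg x) N
    _ = 2 ^ N * (‖𝓕 h x‖ + ‖x‖ ^ N * ‖𝓕 h x‖) := by ring
    _ ≤ 2 ^ N * (2 ^ N * M * volume.real B * S + 2 ^ N * M * volume.real B * S) := by
        exact mul_le_mul_of_nonneg_left (add_le_add (h1.trans h3) (h2.trans h4)) (by positivity)
    _ = _ := by ring

theorem exists_norm_fourier_lowCutoff_mul_character_le (n N : ℕ) : ∃ C : ℝ, 0 ≤ C ∧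
    ∀ z x : Space n, ‖𝓕 (fun ξ => lowCutoff ξ * character (inner ℝ ξ z)) x‖ ≤
      C * (1 + ‖z‖) ^ N * ((1 + ‖x‖) ^ N)⁻¹ := by
  obtain ⟨C, hC0, hC⟩ := exists_norm_fourier_lowCutoff_mul_le n N
  have hpi := Real.pi_gt_three
  refine ⟨C * (2 * Real.pi) ^ N, by positivity, fun z x => ?_⟩
  have hcd : ContDiff ℝ ∞ fun ξ : Space n => character (inner ℝ ξ z) :=
    contDiff_character.comp (contDiff_id.inner ℝ contDiff_const)
  refine (hC _ ((2 * Real.pi) ^ N * (1 + ‖z‖) ^ N) hcd (fun ξ _ i hi => ?_) x).trans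
    (le_of_eq (by ring))
  refine (norm_iteratedFDeriv_comp_inner_le contDiff_character i z ξ).trans ?_
  rw [iteratedDeriv_character, norm_mul, norm_pow, norm_neg_two_pi_I, norm_character, mul_one]
  refine mul_le_mul (pow_le_pow_right₀ (by linarith) hi) ?_ (by positivity) (by positivity)
  calc ‖z‖ ^ i ≤ (1 + ‖z‖) ^ i := by gcongr; linarith
    _ ≤ _ := pow_le_pow_right₀ (by linarith [norm_nonneg z]) hi

/-- In contrast with the full character, the growth in z is limited by the degree k-1, whatever the
decay N required in x. The undamped function v can be integrated against this growth. -/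
theorem exists_norm_fourier_lowCutoff_mul_characterTaylor_le (n N : ℕ) {k : ℕ} :
    ∃ C : ℝ, 0 ≤ C ∧
    ∀ z x : Space n, ‖𝓕 (fun ξ => lowCutoff ξ * characterTaylor k (inner ℝ ξ z)) x‖ ≤
      C * (1 + ‖z‖) ^ (k - 1) * ((1 + ‖x‖) ^ N)⁻¹ := by
  obtain ⟨C, hC0, hC⟩ := exists_norm_fourier_lowCutoff_mul_le n N
  have hpi := Real.pi_gt_three
  refine ⟨C * ((2 * Real.pi) ^ k * Real.exp (2 * Real.pi)), by positivity, fun z x => ?_⟩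
  have hcd : ContDiff ℝ ∞ fun ξ : Space n => characterTaylor k (inner ℝ ξ z) :=
    (contDiff_characterTaylor k).comp (contDiff_id.inner ℝ contDiff_const)
  refine (hC _ ((2 * Real.pi) ^ k * Real.exp (2 * Real.pi) * (1 + ‖z‖) ^ (k - 1)) hcd
    (fun ξ hξ i hi => ?_) x).trans (le_of_eq (by ring))
  refine (norm_iteratedFDeriv_comp_inner_le (contDiff_characterTaylor k) i z ξ).trans ?_
  rw [iteratedDeriv_characterTaylor, norm_mul, norm_pow, norm_neg_two_pi_I]
  rcases le_or_gt k i with h | h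
  · have : characterTaylor 0 (inner ℝ ξ z) = 0 := by simp [characterTaylor]
    rw [Nat.sub_eq_zero_of_le h, this, norm_zero, mul_zero, zero_mul]
    positivity
  · have hin : |inner ℝ ξ z| ≤ ‖z‖ := (abs_real_inner_le_norm ξ z).trans
      (mul_le_of_le_one_left (norm_nonneg _) (by linarith))
    calc _ ≤ (2 * Real.pi) ^ i * (Real.exp (2 * Real.pi) * (1 + ‖z‖) ^ (k - i - 1)) *
          (1 + ‖z‖) ^ i := by
          gcongr
          · exact norm_characterTaylor_le (by omega) hin
          · linarith
      _ = (2 * Real.pi) ^ i * Real.exp (2 * Real.pi) * (1 + ‖z‖) ^ (k - 1) := by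
          rw [show k - 1 = (k - i - 1) + i by omega, pow_add]; ring
      _ ≤ _ := by
          gcongr
          linarith

/-! ### Gaussian regularization and the heat kernel. -/

section Gaussian

variable {H : Type*} [NormedAddCommGroup H] [InnerProductSpace ℝ H]

theorem exists_pow_mul_norm_iteratedFDeriv_exp_neg_norm_sq_le (m j : ℕ) : ∃ C : ℝ, ∀ x : H,
    ‖x‖ ^ m * ‖iteratedFDeriv ℝ j (fun x : H => ((Real.exp (-‖x‖ ^ 2) : ℝ) : ℂ)) x‖ ≤ C := by
  obtain ⟨k, C, hC0, hC⟩ :=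
    (Function.hasTemperateGrowth_norm_sq H).norm_iteratedFDeriv_le_uniform j
  set M := m + k * j with hM
  refine ⟨j.factorial * (C + 1) ^ j * (M.factorial * Real.exp 2), fun x => ?_⟩
  have hr := norm_nonneg x
  have hf : ContDiff ℝ ∞ fun x : H => -‖x‖ ^ 2 := (contDiff_norm_sq ℝ).neg
  have h0 : ‖iteratedFDeriv ℝ j (fun x : H => ((Real.exp (-‖x‖ ^ 2) : ℝ) : ℂ)) x‖ =
      ‖iteratedFDeriv ℝ j (fun x : H => Real.exp (-‖x‖ ^ 2)) x‖ :=
    Complex.ofRealLI.norm_iteratedFDeriv_comp_left (n := ∞)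
      (f := fun x : H => Real.exp (-‖x‖ ^ 2)) hf.exp.contDiffAt (by exact_mod_cast le_top)
  have h1 : ‖iteratedFDeriv ℝ j (fun x : H => Real.exp (-‖x‖ ^ 2)) x‖ ≤
      j.factorial * Real.exp (-‖x‖ ^ 2) * ((C + 1) * (1 + ‖x‖) ^ k) ^ j := by
    refine norm_iteratedFDeriv_comp_le (g := Real.exp) (N := ∞) Real.contDiff_exp hf
      (by exact_mod_cast le_top) x (fun i _ => ?_) (fun i hi1 hi => ?_)
    · rw [norm_iteratedFDeriv_eq_norm_iteratedDeriv, iteratedDeriv_eq_iterate, Real.iter_deriv_exp,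
        Real.norm_of_nonneg (Real.exp_pos _).le]
    · have h2 : iteratedFDeriv ℝ i (fun x : H => -‖x‖ ^ 2) x =
          -iteratedFDeriv ℝ i (fun x : H => ‖x‖ ^ 2) x := by
        have : (fun x : H => -‖x‖ ^ 2) = -fun x : H => ‖x‖ ^ 2 := rfl
        rw [this, iteratedFDeriv_neg, Pi.neg_apply]
      rw [h2, norm_neg]
      have h3 : (1 : ℝ) ≤ (1 + ‖x‖) ^ k := one_le_pow₀ (by linarith)
      calc _ ≤ C * (1 + ‖x‖) ^ k := hC i hi x
        _ ≤ (C + 1) * (1 + ‖x‖) ^ k := by gcongr; linarith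
        _ ≤ _ := le_self_pow₀ (by nlinarith) (by omega)
  have h4 : (1 + ‖x‖) ^ M * Real.exp (-‖x‖ ^ 2) ≤ M.factorial * Real.exp 2 := by
    have h5 := Real.pow_div_factorial_le_exp (1 + ‖x‖) (by positivity) M
    rw [div_le_iff₀ (by positivity)] at h5
    calc _ ≤ (Real.exp (1 + ‖x‖) * M.factorial) * Real.exp (-‖x‖ ^ 2) := by gcongr
      _ = M.factorial * Real.exp (1 + ‖x‖ + -‖x‖ ^ 2) := by
        rw [Real.exp_add (1 + ‖x‖)]; ring
      _ ≤ _ := by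
        gcongr
        nlinarith [sq_nonneg (‖x‖ - 1 / 2)]
  rw [h0]
  calc _ ≤ (1 + ‖x‖) ^ m * (j.factorial * Real.exp (-‖x‖ ^ 2) * ((C + 1) * (1 + ‖x‖) ^ k) ^ j) := by
        gcongr
        linarith
    _ = j.factorial * (C + 1) ^ j * ((1 + ‖x‖) ^ M * Real.exp (-‖x‖ ^ 2)) := by
        rw [hM, mul_pow, pow_add, pow_mul]; ring
    _ ≤ _ := by gcongr

/-- The Gaussian `exp(-‖x‖²)` as a Schwartz function. -/
def gaussian : 𝓢(H, ℂ) where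
  toFun x := ((Real.exp (-‖x‖ ^ 2) : ℝ) : ℂ)
  smooth' := Complex.ofRealCLM.contDiff.comp (contDiff_norm_sq ℝ).neg.exp
  decay' m j := exists_pow_mul_norm_iteratedFDeriv_exp_neg_norm_sq_le m j

theorem gaussian_apply (x : H) : gaussian x = ((Real.exp (-‖x‖ ^ 2) : ℝ) : ℂ) := rfl

theorem norm_iteratedFDeriv_comp_smul_le {F : Type*} [NormedAddCommGroup F] [NormedSpace ℝ F]
    {f : H → F} (hf : ContDiff ℝ ∞ f) (c : ℝ) (i : ℕ) (x : H) :
    ‖iteratedFDeriv ℝ i (fun x => f (c • x)) x‖ ≤ ‖iteratedFDeriv ℝ i f (c • x)‖ * |c| ^ i := by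
  have h := ContinuousLinearMap.iteratedFDeriv_comp_right (c • ContinuousLinearMap.id ℝ H) hf x
    (i := i) (by exact_mod_cast le_top)
  have h0 : (f ∘ ⇑(c • ContinuousLinearMap.id ℝ H)) = fun x => f (c • x) := rfl
  rw [h0] at h
  rw [h]
  refine (ContinuousMultilinearMap.norm_compContinuousLinearMap_le _ _).trans ?_
  rw [Finset.prod_const, Finset.card_univ, Fintype.card_fin]
  refine mul_le_mul_of_nonneg_left (pow_le_pow_left₀ (norm_nonneg _) ?_ i) (norm_nonneg _)
  refine ContinuousLinearMap.opNorm_le_bound _ (abs_nonneg _) fun y => ?_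
  simp [norm_smul]

end Gaussian

/-- The Fourier transform of `exp(-s²‖y‖²)`. -/
def heatKernel {n : ℕ} (s : ℝ) (ξ : Space n) : ℂ :=
  ((s⁻¹ ^ n : ℝ) : ℂ) * (𝓕 (gaussian : 𝓢(Space n, ℂ))) (s⁻¹ • ξ)

theorem fourier_exp_neg_norm_sq {n : ℕ} {s : ℝ} (hs : 0 < s) (ξ : Space n) :
    𝓕 (fun y : Space n => ((Real.exp (-s ^ 2 * ‖y‖ ^ 2) : ℝ) : ℂ)) ξ = heatKernel s ξ := by
  have h : (fun y : Space n => ((Real.exp (-s ^ 2 * ‖y‖ ^ 2) : ℝ) : ℂ)) =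
      fun y => gaussian (s • y) := by
    ext y
    rw [gaussian_apply, norm_smul, Real.norm_of_nonneg hs.le, mul_pow]
    congr 3
    ring
  rw [h, fourier_comp_smul _ hs, heatKernel, SchwartzMap.fourier_coe]
  simp

theorem integrable_heatKernel {n : ℕ} {s : ℝ} (hs : 0 < s) :
    Integrable (heatKernel s : Space n → ℂ) :=
  (((𝓕 (gaussian : 𝓢(Space n, ℂ))).integrable (μ := volume)).comp_smul
    (inv_ne_zero hs.ne')).const_mul _

/-- Fourier inversion at the origin: the total mass is the value of the Gaussian at 0. -/
theorem integral_heatKernel {n : ℕ} {s : ℝ} (hs : 0 < s) :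
    ∫ ξ : Space n, heatKernel s ξ = 1 := by
  simp only [heatKernel]
  have h0 := Measure.integral_comp_smul (volume : Measure (Space n))
    (fun x => (𝓕 (gaussian : 𝓢(Space n, ℂ))) x) s⁻¹
  rw [integral_const_mul, h0, abs_of_pos (by positivity)]
  have h1 : ∫ x : Space n, (𝓕 (gaussian : 𝓢(Space n, ℂ))) x = 1 := by
    have h2 : 𝓕⁻ (𝓕 (gaussian : 𝓢(Space n, ℂ))) 0 = (gaussian : 𝓢(Space n, ℂ)) 0 := by
      rw [FourierTransform.fourierInv_fourier_eq]
    rw [SchwartzMap.fourierInv_coe, Real.fourierInv_eq'] at h2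
    simpa [gaussian_apply] using h2
  rw [h1, Complex.real_smul, mul_one, finrank_euclideanSpace, Fintype.card_fin,
    ← Complex.ofReal_mul]
  have : s⁻¹ ^ n * ((s⁻¹) ^ n)⁻¹ = 1 := mul_inv_cancel₀ (by positivity)
  rw [this, Complex.ofReal_one]

theorem contDiff_heatKernel {n : ℕ} (s : ℝ) : ContDiff ℝ ∞ (heatKernel s : Space n → ℂ) :=
  contDiff_const.mul (((𝓕 (gaussian : 𝓢(Space n, ℂ))).smooth ⊤).comp (contDiff_id.const_smul s⁻¹))

@[fun_prop]
theorem continuous_heatKernel {n : ℕ} (s : ℝ) : Continuous (heatKernel s : Space n → ℂ) :=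
  (contDiff_heatKernel s).continuous

/-- The separation of ξ and η keeps ‖ξ+η‖ ≥ (1+‖η‖)/18. The rapid decay of the transformed Gaussian
then supplies s^M with M = n+1+N; dilation and differentiation cost at most s^(-n-N), so one power
of s is left. -/
theorem exists_norm_iteratedFDeriv_heatKernel_le (n N : ℕ) : ∃ C : ℝ, 0 ≤ C ∧
    ∀ s : ℝ, 0 < s → s ≤ 1 → ∀ ξ η : Space n, ‖ξ‖ ≤ 1 / 16 → 1 / 8 ≤ ‖η‖ → ∀ i ≤ N,
      ‖iteratedFDeriv ℝ i (fun ξ => heatKernel s (ξ + η)) ξ‖ ≤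
        C * s * ((1 + ‖η‖) ^ (n + 1))⁻¹ := by
  set G : 𝓢(Space n, ℂ) := 𝓕 (gaussian : 𝓢(Space n, ℂ)) with hG
  set M := n + 1 + N with hM
  choose A hA0 hA using fun i => G.decay M i
  set D := ∑ i ∈ Finset.range (N + 1), A i with hD
  have hD0 : 0 ≤ D := Finset.sum_nonneg fun i _ => (hA0 i).le
  refine ⟨D * 18 ^ M, by positivity, fun s hs hs1 ξ η hξ hη i hi => ?_⟩
  have hcd : ContDiff ℝ ∞ fun x : Space n => G (s⁻¹ • x) :=
    (G.smooth ⊤).comp (contDiff_id.const_smul s⁻¹)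
  have hsi : 1 ≤ s⁻¹ := (one_le_inv₀ hs).2 hs1
  rw [iteratedFDeriv_comp_add_right]
  set z := ξ + η with hz
  have hzη : (1 + ‖η‖) / 18 ≤ ‖z‖ := by
    have : ‖η‖ ≤ ‖z‖ + ‖ξ‖ := by
      calc ‖η‖ = ‖z - ξ‖ := by rw [hz]; congr 1; abel
        _ ≤ _ := norm_sub_le _ _
    linarith
  have hz0 : 0 < ‖z‖ := lt_of_lt_of_le (by positivity) hzη
  have h1 : ‖iteratedFDeriv ℝ i (heatKernel s) z‖ ≤
      s⁻¹ ^ n * (‖iteratedFDeriv ℝ i G (s⁻¹ • z)‖ * s⁻¹ ^ i) := by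
    have h2 : (heatKernel s : Space n → ℂ) = fun x => (s⁻¹ ^ n : ℝ) • G (s⁻¹ • x) := by
      ext x; rw [heatKernel, Complex.real_smul]
    rw [h2, iteratedFDeriv_const_smul_apply' (hcd.contDiffAt.of_le (by exact_mod_cast le_top)),
      norm_smul, Real.norm_of_nonneg (by positivity)]
    gcongr
    have := norm_iteratedFDeriv_comp_smul_le (G.smooth ⊤) s⁻¹ i z
    rwa [abs_of_pos (by positivity)] at this
  have h3 : ‖iteratedFDeriv ℝ i G (s⁻¹ • z)‖ ≤ D * (s ^ M * (‖z‖ ^ M)⁻¹) := by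
    have h4 := hA i (s⁻¹ • z)
    rw [norm_smul, Real.norm_of_nonneg (by positivity), mul_pow] at h4
    have h5 : A i ≤ D := Finset.single_le_sum (f := A) (fun j _ => (hA0 j).le)
      (Finset.mem_range.2 (Nat.lt_succ_of_le hi))
    rw [← div_eq_mul_inv, ← mul_div_assoc, le_div_iff₀ (by positivity)]
    calc _ = s ^ M * (s⁻¹ ^ M * ‖z‖ ^ M * ‖iteratedFDeriv ℝ i G (s⁻¹ • z)‖) := by
          rw [inv_pow]; field_simp
      _ ≤ s ^ M * D := by gcongr; exact h4.trans h5
      _ = _ := mul_comm _ _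
  calc _ ≤ s⁻¹ ^ n * (D * (s ^ M * (‖z‖ ^ M)⁻¹) * s⁻¹ ^ N) := by
        refine h1.trans ?_
        gcongr
    _ = D * s * (‖z‖ ^ M)⁻¹ := by
        rw [hM, pow_add, pow_add, pow_one, inv_pow, inv_pow]; field_simp
    _ ≤ D * s * (((1 + ‖η‖) / 18) ^ M)⁻¹ := by gcongr
    _ = D * s * 18 ^ M * ((1 + ‖η‖) ^ M)⁻¹ := by rw [div_pow]; field_simp
    _ ≤ D * s * 18 ^ M * ((1 + ‖η‖) ^ (n + 1))⁻¹ := by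
        gcongr
        · linarith [norm_nonneg η]
        · omega
    _ = _ := by ring

theorem IsTempered.integrable_norm {n N : ℕ} {f : Space n → ℂ}
    (hf : Integrable (fun x => (((1 + ‖x‖) ^ N)⁻¹ : ℝ) • f x)) :
    Integrable fun x => ‖f x‖ * ((1 + ‖x‖) ^ N)⁻¹ := by
  refine hf.norm.congr (Eventually.of_forall fun x => ?_)
  simp only
  rw [norm_smul, Real.norm_of_nonneg (by positivity), mul_comm]

theorem aestronglyMeasurable_of_integrable_weight {n N : ℕ} {f : Space n → ℂ}
    (hf : Integrable (fun x => (((1 + ‖x‖) ^ N)⁻¹ : ℝ) • f x)) : AEStronglyMeasurable f volume := by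
  have h : Continuous fun x : Space n => (1 + ‖x‖) ^ N := by fun_prop
  refine (h.aestronglyMeasurable.smul hf.1).congr (Eventually.of_forall fun x => ?_)
  simp only [Pi.smul_apply']
  rw [smul_smul, mul_inv_cancel₀ (by positivity), one_smul]

/-- Low frequencies do not see the values of `w` away from the origin after a Gauss regularization. -/
theorem tendsto_integral_fourier_lowCutoff_mul_heatKernel {n : ℕ} {f w : Space n → ℂ}
    (hf : IsTempered f) (hw : Integrable fun η => (((1 + ‖η‖) ^ (n + 1))⁻¹ : ℝ) * ‖w η‖)
    (hwm : AEStronglyMeasurable w volume) (hw0 : ∀ η, ‖η‖ < 1 / 8 → w η = 0) :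
    Tendsto (fun s : ℝ => ∫ x, f x * 𝓕 (fun ξ => lowCutoff ξ * ∫ η, w η * heatKernel s (ξ + η)) x)
      (𝓝[>] 0) (𝓝 0) := by
  obtain ⟨N, hN⟩ := hf
  have hfN := IsTempered.integrable_norm hN
  obtain ⟨C₁, hC₁, h₁⟩ := exists_norm_fourier_lowCutoff_mul_le n N
  obtain ⟨C₂, hC₂, h₂⟩ := exists_norm_iteratedFDeriv_heatKernel_le n N
  set W := ∫ η, (((1 + ‖η‖) ^ (n + 1))⁻¹ : ℝ) * ‖w η‖ with hW
  set A := ∫ x, ‖f x‖ * ((1 + ‖x‖) ^ N)⁻¹ with hA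
  have hbound : ∀ s : ℝ, 0 < s → s ≤ 1 →
      ‖∫ x, f x * 𝓕 (fun ξ => lowCutoff ξ * ∫ η, w η * heatKernel s (ξ + η)) x‖ ≤
        A * (C₁ * C₂ * W) * s := by
    intro s hs hs1
    have hF : ∀ x, 𝓕 (fun ξ => lowCutoff ξ * ∫ η, w η * heatKernel s (ξ + η)) x =
        ∫ η, w η * 𝓕 (fun ξ => lowCutoff ξ * heatKernel s (ξ + η)) x := by
      intro x
      simp only [Real.fourier_eq', smul_eq_mul, ← integral_const_mul]
      rw [integral_integral_swap]
      · refine integral_congr_ae (Eventually.of_forall fun η => ?_)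
        refine integral_congr_ae (Eventually.of_forall fun ξ => ?_)
        simp only
        ring
      · have hb := (integrable_lowCutoff (n := n)).norm.mul_prod (hw.const_mul (C₂ * s))
        refine hb.mono' ?_ (Eventually.of_forall fun q => ?_)
        · have c1 : Continuous fun q : Space n × Space n =>
              Complex.exp (((-2 * Real.pi * inner ℝ q.1 x : ℝ) : ℂ) * Complex.I) := by fun_prop
          have c2 : Continuous fun q : Space n × Space n => lowCutoff q.1 := by fun_prop
          have c3 : Continuous fun q : Space n × Space n => heatKernel s (q.1 + q.2) := by fun_prop
          exact c1.aestronglyMeasurable.mul (c2.aestronglyMeasurable.mul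
            (hwm.comp_snd.mul c3.aestronglyMeasurable))
        · simp only [Function.uncurry]
          rw [norm_mul, Complex.norm_exp_ofReal_mul_I, one_mul, norm_mul, norm_mul]
          rcases lt_or_ge ‖q.2‖ (1 / 8) with h | h
          · rw [hw0 _ h]; simp
          rcases le_or_gt ‖q.1‖ (1 / 16) with h' | h'
          · have := h₂ s hs hs1 q.1 q.2 h' h 0 (Nat.zero_le _)
            rw [norm_iteratedFDeriv_zero] at this
            calc _ ≤ ‖lowCutoff q.1‖ * (‖w q.2‖ * (C₂ * s * ((1 + ‖q.2‖) ^ (n + 1))⁻¹)) := by gcongr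
              _ = _ := by ring
          · rw [lowCutoff_of_le h'.le]; simp
    have hFx : ∀ x, ‖𝓕 (fun ξ => lowCutoff ξ * ∫ η, w η * heatKernel s (ξ + η)) x‖ ≤
        C₁ * C₂ * W * s * ((1 + ‖x‖) ^ N)⁻¹ := by
      intro x
      rw [hF]
      refine (norm_integral_le_of_norm_le (hw.const_mul (C₁ * C₂ * s * ((1 + ‖x‖) ^ N)⁻¹))
        (Eventually.of_forall fun η => ?_)).trans (le_of_eq ?_)
      · rw [norm_mul]
        rcases lt_or_ge ‖η‖ (1 / 8) with h | h
        · rw [hw0 _ h]; simp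
        have := h₁ (fun ξ => heatKernel s (ξ + η)) (C₂ * s * ((1 + ‖η‖) ^ (n + 1))⁻¹)
          ((contDiff_heatKernel s).comp (contDiff_id.add contDiff_const))
          (fun ξ hξ i hi => h₂ s hs hs1 ξ η hξ h i hi) x
        calc _ ≤ ‖w η‖ * (C₁ * (C₂ * s * ((1 + ‖η‖) ^ (n + 1))⁻¹) * ((1 + ‖x‖) ^ N)⁻¹) := by gcongr
          _ = _ := by ring
      · rw [integral_const_mul]; ring
    refine (norm_integral_le_of_norm_le (hfN.const_mul (C₁ * C₂ * W * s))
      (Eventually.of_forall fun x => ?_)).trans (le_of_eq ?_)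
    · rw [norm_mul]
      calc _ ≤ ‖f x‖ * (C₁ * C₂ * W * s * ((1 + ‖x‖) ^ N)⁻¹) := by gcongr; exact hFx x
        _ = _ := by ring
    · rw [integral_const_mul]; ring
  refine squeeze_zero_norm' (a := fun s => A * (C₁ * C₂ * W) * s) ?_ ?_
  · filter_upwards [Ioc_mem_nhdsGT (zero_lt_one (α := ℝ))] with s hs
    exact hbound s hs.1 hs.2
  · have : Continuous fun s : ℝ => A * (C₁ * C₂ * W) * s := by fun_prop
    have h := this.tendsto 0
    rw [mul_zero] at h
    exact h.mono_left nhdsWithin_le_nhds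

/-! ### Pairing tempered functions with test functions. -/

theorem hasTemperateGrowth_fourier {n : ℕ} {m : Space n → ℂ}
    (hm : ∀ k : ℕ, Integrable fun ξ => ‖ξ‖ ^ k * ‖m ξ‖) (hmm : AEStronglyMeasurable m volume) :
    Function.HasTemperateGrowth (𝓕 m) := by
  have hm' : ∀ k : ℕ, (k : ℕ∞) ≤ ⊤ → Integrable fun ξ => ‖ξ‖ ^ k * ‖m ξ‖ := fun k _ => hm k
  refine ⟨Real.contDiff_fourier hm', fun k => ⟨0, ∫ ξ,
    (2 * Real.pi * ‖innerSL ℝ (E := Space n)‖) ^ k * (‖ξ‖ ^ k * ‖m ξ‖), fun x => ?_⟩⟩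
  rw [Real.iteratedFDeriv_fourier hm' hmm (by exact_mod_cast le_top), pow_zero, mul_one]
  refine (VectorFourier.norm_fourierIntegral_le_integral_norm _ _ _ _ x).trans ?_
  refine integral_mono_of_nonneg (Eventually.of_forall fun _ => norm_nonneg _)
    ((hm k).const_mul _) (Eventually.of_forall fun ξ => ?_)
  refine (VectorFourier.norm_fourierPowSMulRight_le _ _ _ _).trans (le_of_eq (by ring))

theorem SchwartzMap.exists_norm_le {n : ℕ} (b : 𝓢(Space n, ℂ)) (N : ℕ) :
    ∃ C : ℝ, 0 ≤ C ∧ ∀ x, ‖b x‖ ≤ C * ((1 + ‖x‖) ^ N)⁻¹ := by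
  obtain ⟨C₀, h₀, hC₀⟩ := b.decay 0 0
  obtain ⟨C₁, h₁, hC₁⟩ := b.decay N 0
  refine ⟨2 ^ N * (C₀ + C₁), by positivity, fun x => ?_⟩
  have e0 := hC₀ x
  have e1 := hC₁ x
  rw [norm_iteratedFDeriv_zero] at e0 e1
  rw [pow_zero, one_mul] at e0
  rw [← div_eq_mul_inv, le_div_iff₀ (by positivity)]
  calc ‖b x‖ * (1 + ‖x‖) ^ N ≤ ‖b x‖ * (2 ^ N * (1 + ‖x‖ ^ N)) := by
        gcongr
        exact one_add_pow_le (norm_nonneg x) N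
    _ = 2 ^ N * (‖b x‖ + ‖x‖ ^ N * ‖b x‖) := by ring
    _ ≤ _ := by gcongr

theorem IsTempered.aestronglyMeasurable {n : ℕ} {f : Space n → ℂ} (hf : IsTempered f) :
    AEStronglyMeasurable f volume := by
  obtain ⟨N, hN⟩ := hf
  exact aestronglyMeasurable_of_integrable_weight hN

theorem IsTempered.integrable_mul_schwartz {n : ℕ} {f : Space n → ℂ} (hf : IsTempered f)
    (b : 𝓢(Space n, ℂ)) : Integrable fun x => f x * b x := by
  have hfm := hf.aestronglyMeasurable
  obtain ⟨N, hN⟩ := hf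
  obtain ⟨C, hC0, hC⟩ := SchwartzMap.exists_norm_le b N
  refine ((IsTempered.integrable_norm hN).const_mul C).mono'
    (hfm.mul b.continuous.aestronglyMeasurable) (Eventually.of_forall fun x => ?_)
  rw [norm_mul]
  calc _ ≤ ‖f x‖ * (C * ((1 + ‖x‖) ^ N)⁻¹) := by gcongr; exact hC x
    _ = _ := by ring

/-- The low frequency part of a Schwartz function. -/
def lowPart {n : ℕ} (ψ : 𝓢(Space n, ℂ)) : 𝓢(Space n, ℂ) :=
  (hasCompactSupport_lowCutoff.mul_right (f' := (ψ : Space n → ℂ))).toSchwartzMap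
    (contDiff_lowCutoff.mul (ψ.smooth ⊤))

theorem lowPart_apply {n : ℕ} (ψ : 𝓢(Space n, ℂ)) (ξ : Space n) :
    lowPart ψ ξ = lowCutoff ξ * ψ ξ := rfl

theorem coe_lowPart {n : ℕ} (ψ : 𝓢(Space n, ℂ)) :
    (lowPart ψ : Space n → ℂ) = fun ξ => lowCutoff ξ * ψ ξ := rfl

theorem IsTempered.integrable_mul_fourier {n : ℕ} {f : Space n → ℂ} (hf : IsTempered f)
    (ψ : 𝓢(Space n, ℂ)) : Integrable fun x => f x * 𝓕 (ψ : Space n → ℂ) x := by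
  rw [← SchwartzMap.fourier_coe]
  exact hf.integrable_mul_schwartz _

/-- (1-θ)ψ vanishes near the origin and is therefore an admissible test function, so this part is
transferred to g. The part θψ need not vanish at the origin and has to stay with f. -/
theorem integral_mul_fourier_eq {n : ℕ} {lam : ℝ} {f g : Space n → ℂ} (hf : IsTempered f)
    (hfg : IsRieszPotential lam f g) (ψ : 𝓢(Space n, ℂ)) :
    ∫ x, f x * 𝓕 (ψ : Space n → ℂ) x = (∫ x, f x * 𝓕 (fun ξ => lowCutoff ξ * ψ ξ) x) +
      ∫ x, g x * 𝓕 (fun ξ => ((‖ξ‖ ^ (-lam) : ℝ) : ℂ) * ((1 - lowCutoff ξ) * ψ ξ)) x := by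
  set χ : 𝓢(Space n, ℂ) := ψ - lowPart ψ with hχ
  have hχa : ∀ ξ, χ ξ = (1 - lowCutoff ξ) * ψ ξ := fun ξ => by
    rw [hχ, sub_apply, lowPart_apply]; ring
  have h1 := hfg χ (by
    have : (fun ξ => χ ξ) =ᶠ[𝓝 0] fun _ => (0 : ℂ) := by
      filter_upwards [Metric.ball_mem_nhds (0 : Space n) (show (0 : ℝ) < 1 / 32 by norm_num)]
        with ξ hξ
      rw [mem_ball_zero_iff] at hξ
      rw [hχa, lowCutoff, cutoff_of_le_one (by linarith)]; simp
    exact this.trans_isBigO (Asymptotics.isBigO_zero _ _))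
  simp only [hχa] at h1
  have hlow : Integrable fun x => f x * 𝓕 (fun ξ => lowCutoff ξ * ψ ξ) x :=
    hf.integrable_mul_fourier (lowPart ψ)
  have hχe : (χ : Space n → ℂ) = fun ξ => (1 - lowCutoff ξ) * ψ ξ := funext hχa
  have hhigh : Integrable fun x => f x * 𝓕 (fun ξ => (1 - lowCutoff ξ) * ψ ξ) x := by
    rw [← hχe]
    exact hf.integrable_mul_fourier χ
  rw [← h1, ← integral_add hlow hhigh]
  refine integral_congr_ae (Eventually.of_forall fun x => ?_)
  simp only
  rw [← mul_add, ← fourier_add_of_integrable]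
  · have hsplit : (ψ : Space n → ℂ) = fun ξ => lowCutoff ξ * ψ ξ + (1 - lowCutoff ξ) * ψ ξ := by
      funext ξ
      ring
    exact congrArg (fun h : Space n → ℂ => f x * 𝓕 h x) hsplit
  · exact (lowPart ψ).integrable
  · rw [← hχe]
    exact χ.integrable

/-! ### The high-frequency limit. -/

section KernelConvolution

variable {n : ℕ} {k : Space n → ℂ}

/-- Peetre's inequality moves the weight onto k, at the price of (1+‖x‖)^s ≤ (1+‖x‖)^n. -/
theorem norm_integral_mul_add_le
    (hk : Integrable (fun x => (((1 + ‖x‖) ^ n : ℝ) : ℂ) * k x)) {s A : ℝ} (hs : 0 ≤ s)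
    (hsn : s ≤ n) (hA : 0 ≤ A) {b : Space n → ℂ} (hb : ∀ y, ‖b y‖ ≤ A * (1 + ‖y‖) ^ (-s))
    (y : Space n) : ‖∫ x, k x * b (x + y)‖ ≤
      A * (∫ x, ‖(((1 + ‖x‖) ^ n : ℝ) : ℂ) * k x‖) * (1 + ‖y‖) ^ (-s) := by
  refine (norm_integral_le_of_norm_le (hk.norm.const_mul (A * (1 + ‖y‖) ^ (-s)))
    (Eventually.of_forall fun x => ?_)).trans (le_of_eq ?_)
  · rw [norm_mul, norm_mul, Complex.norm_real, Real.norm_of_nonneg (by positivity)]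
    have h1 : (1 + ‖x‖) ^ s ≤ (1 + ‖x‖) ^ n := by
      rw [← Real.rpow_natCast]
      exact Real.rpow_le_rpow_of_exponent_le (by linarith [norm_nonneg x]) hsn
    calc _ ≤ ‖k x‖ * (A * ((1 + ‖x‖) ^ n * (1 + ‖y‖) ^ (-s))) := by
          gcongr
          refine (hb _).trans ?_
          gcongr
          refine (one_add_norm_sub_rpow_le hs x y).trans ?_
          gcongr
      _ = _ := by ring
  · rw [integral_const_mul]; ring

/-- Two nested dominated convergences. The outer majorant is a multiple of ‖g y‖ ‖y‖^(α-n), because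
s = n - α and (1+‖y‖)^(-s) ≤ ‖y‖^(-s). -/
theorem tendsto_integral_mul_integral_mul {α s A : ℝ} {g : Space n → ℂ} {b : ℝ → Space n → ℂ}
    {b₀ : Space n → ℂ} (hn : 1 ≤ n) (hki : Integrable k)
    (hk : Integrable (fun x => (((1 + ‖x‖) ^ n : ℝ) : ℂ) * k x)) (hs : 0 ≤ s)
    (hsn : s ≤ n) (hsα : α = n - s) (hA : 0 ≤ A) (hg : AEStronglyMeasurable g volume)
    (hgi : Integrable fun y => ‖g y‖ * ‖y‖ ^ (α - n))
    (hbc : ∀ t, Continuous (b t)) (hb : ∀ t y, ‖b t y‖ ≤ A * (1 + ‖y‖) ^ (-s))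
    (hbt : ∀ y, Tendsto (fun t => b t y) (𝓝[>] 0) (𝓝 (b₀ y))) :
    Tendsto (fun t => ∫ y, g y * ∫ x, k x * b t (x + y)) (𝓝[>] 0)
        (𝓝 (∫ y, g y * ∫ x, k x * b₀ (x + y))) ∧
      ‖∫ y, g y * ∫ x, k x * b₀ (x + y)‖ ≤
        A * (∫ x, ‖(((1 + ‖x‖) ^ n : ℝ) : ℂ) * k x‖) * ∫ y, ‖g y‖ * ‖y‖ ^ (α - n) := by
  have : Nonempty (Fin n) := ⟨⟨0, hn⟩⟩
  have hae : ∀ᵐ x : Space n, x ≠ 0 := by simp [ae_iff, measure_singleton]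
  set K := ∫ x, ‖(((1 + ‖x‖) ^ n : ℝ) : ℂ) * k x‖ with hK
  have hK0 : 0 ≤ K := integral_nonneg fun _ => norm_nonneg _
  have hb₀ : ∀ y, ‖b₀ y‖ ≤ A * (1 + ‖y‖) ^ (-s) := fun y =>
    le_of_tendsto (hbt y).norm (Eventually.of_forall fun t => hb t y)
  have hpt : ∀ (c : Space n → ℂ), (∀ y, ‖c y‖ ≤ A * (1 + ‖y‖) ^ (-s)) → ∀ y, y ≠ 0 →
      ‖g y * ∫ x, k x * c (x + y)‖ ≤ A * K * (‖g y‖ * ‖y‖ ^ (α - n)) := by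
    intro c hc y hy
    rw [norm_mul]
    have hy0 : 0 < ‖y‖ := norm_pos_iff.2 hy
    calc _ ≤ ‖g y‖ * (A * K * ‖y‖ ^ (α - n)) := by
          gcongr
          refine (norm_integral_mul_add_le hk hs hsn hA hc y).trans ?_
          gcongr
          rw [show α - n = -s by rw [hsα]; ring]
          exact Real.rpow_le_rpow_of_nonpos hy0 (by linarith) (by linarith)
      _ = _ := by ring
  refine ⟨?_, ?_⟩
  · refine tendsto_integral_filter_of_dominated_convergence
      (fun y => A * K * (‖g y‖ * ‖y‖ ^ (α - n))) (Eventually.of_forall fun t => ?_)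
      (Eventually.of_forall fun t => ?_) (hgi.const_mul _) (Eventually.of_forall fun y => ?_)
    · refine hg.mul ?_
      have h1 : Continuous fun q : Space n × Space n => b t (q.2 + q.1) :=
        (hbc t).comp (continuous_snd.add continuous_fst)
      exact (hki.1.comp_snd.mul h1.aestronglyMeasurable).integral_prod_right'
    · filter_upwards [hae] with y hy
      exact hpt _ (hb t) y hy
    · refine Tendsto.const_mul _ (tendsto_integral_filter_of_dominated_convergence
        (fun x => ‖k x‖ * A) (Eventually.of_forall fun t => ?_)
        (Eventually.of_forall fun t => Eventually.of_forall fun x => ?_)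
        (hki.norm.mul_const _) (Eventually.of_forall fun x => ?_))
      · exact hki.1.mul ((hbc t).comp (continuous_add_const y)).aestronglyMeasurable
      · rw [norm_mul]
        gcongr
        refine (hb t _).trans (mul_le_of_le_one_right hA ?_)
        exact Real.rpow_le_one_of_one_le_of_nonpos (by linarith [norm_nonneg (x + y)])
          (by linarith)
      · exact (hbt _).const_mul _
  · refine (norm_integral_le_of_norm_le (hgi.const_mul (A * K)) ?_).trans (le_of_eq ?_)
    · filter_upwards [hae] with y hy
      exact hpt _ hb₀ y hy
    · rw [integral_const_mul]

end KernelConvolution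

/-! ### Vanishing moments. -/

/-- Letting t → 0 kills the constant coefficient; dividing by t lowers both the degree and β by one.
-/
theorem eq_zero_of_norm_sum_mul_pow_le {C : ℝ} (k : ℕ) (a : ℕ → ℂ) {β : ℝ} (hβ : (k : ℝ) - 1 < β)
    (h : ∀ t : ℝ, 0 < t → t ≤ 1 → ‖∑ j ∈ Finset.range k, a j * (t : ℂ) ^ j‖ ≤ C * t ^ β) :
    ∀ j < k, a j = 0 := by
  induction k generalizing a β with
  | zero => intro j hj; omega
  | succ k ih =>
    push_cast at hβ
    have hβ0 : 0 < β := by have : (0 : ℝ) ≤ k := Nat.cast_nonneg k; linarith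
    have h0 : a 0 = 0 := by
      have h1 : Tendsto (fun t : ℝ => ∑ j ∈ Finset.range (k + 1), a j * (t : ℂ) ^ j) (𝓝[>] 0)
          (𝓝 (∑ j ∈ Finset.range (k + 1), a j * ((0 : ℝ) : ℂ) ^ j)) := by
        have : Continuous fun t : ℝ => ∑ j ∈ Finset.range (k + 1), a j * (t : ℂ) ^ j := by fun_prop
        exact (this.tendsto 0).mono_left nhdsWithin_le_nhds
      have h2 : Tendsto (fun t : ℝ => C * t ^ β) (𝓝[>] 0) (𝓝 0) := by
        have := ((Real.continuousAt_rpow_const (0 : ℝ) β (Or.inr hβ0.le)).tendsto.const_mul C)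
        rw [Real.zero_rpow hβ0.ne', mul_zero] at this
        exact this.mono_left nhdsWithin_le_nhds
      have h3 : Tendsto (fun t : ℝ => ∑ j ∈ Finset.range (k + 1), a j * (t : ℂ) ^ j) (𝓝[>] 0)
          (𝓝 0) := by
        refine squeeze_zero_norm' ?_ h2
        filter_upwards [Ioc_mem_nhdsGT (zero_lt_one' ℝ)] with t ht
        exact h t ht.1 ht.2
      have h4 := tendsto_nhds_unique h1 h3
      rw [Finset.sum_range_succ'] at h4
      simpa using h4
    have h1 := ih (fun j => a (j + 1)) (β := β - 1) (by linarith) fun t ht ht1 => by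
      have h2 := h t ht ht1
      rw [Finset.sum_range_succ', h0, zero_mul, add_zero] at h2
      simp only [pow_succ, ← mul_assoc] at h2
      rw [← Finset.sum_mul, norm_mul, Complex.norm_real, Real.norm_of_nonneg ht.le] at h2
      rw [Real.rpow_sub_one ht.ne', ← mul_div_assoc, le_div_iff₀ ht]
      exact h2
    intro j hj
    cases j with
    | zero => exact h0
    | succ j => exact h1 j (by omega)

/-- The remainder is O(|t|^k) for small t and O(|t|^(k-1)) for large t; any β between the two
exponents serves both ranges. -/
theorem norm_character_sub_characterTaylor_le_rpow {k : ℕ} (hk : 1 ≤ k) {β : ℝ}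
    (hkβ : (k : ℝ) - 1 ≤ β) (hβk : β ≤ k) (t : ℝ) :
    ‖character t - characterTaylor k t‖ ≤
      ((2 * Real.pi) ^ k * Real.exp (2 * Real.pi) + (1 + Real.exp (2 * Real.pi) * 2 ^ (k - 1))) *
        |t| ^ β := by
  have hpi := Real.pi_pos
  rcases le_total |t| 1 with h | h
  · rcases eq_or_lt_of_le (abs_nonneg t) with h0 | h0
    · have ht : t = 0 := abs_eq_zero.1 h0.symm
      have := norm_character_sub_le k t
      rw [← h0, mul_zero, zero_pow (by omega), zero_mul] at this
      exact this.trans (by positivity)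
    calc _ ≤ (2 * Real.pi * |t|) ^ k * Real.exp (2 * Real.pi * |t|) := norm_character_sub_le k t
      _ ≤ (2 * Real.pi) ^ k * Real.exp (2 * Real.pi) * |t| ^ β := by
        rw [mul_pow, mul_right_comm]
        have h2 : 2 * Real.pi * |t| ≤ 2 * Real.pi := mul_le_of_le_one_right (by positivity) h
        have h3 : |t| ^ k ≤ |t| ^ β := by
          rw [← Real.rpow_natCast]
          exact Real.rpow_le_rpow_of_exponent_ge h0 h hβk
        gcongr
      _ ≤ _ := by
        gcongr
        exact le_add_of_nonneg_right (by positivity)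
  · have h1 : |t| ^ (k - 1) ≤ |t| ^ β := by
      rw [← Real.rpow_natCast]
      refine Real.rpow_le_rpow_of_exponent_le h ?_
      rw [Nat.cast_sub hk]; simpa using hkβ
    have h2 : (1 : ℝ) ≤ |t| ^ (k - 1) := one_le_pow₀ h
    calc _ ≤ ‖character t‖ + ‖characterTaylor k t‖ := norm_sub_le _ _
      _ ≤ 1 + Real.exp (2 * Real.pi) * (1 + |t|) ^ (k - 1) := by
        rw [norm_character]
        gcongr
        exact norm_characterTaylor_le hk le_rfl
      _ ≤ |t| ^ β + Real.exp (2 * Real.pi) * (2 ^ (k - 1) * |t| ^ β) := by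
        gcongr
        · linarith
        · calc (1 + |t|) ^ (k - 1) ≤ (2 * |t|) ^ (k - 1) := by gcongr; linarith
            _ = 2 ^ (k - 1) * |t| ^ (k - 1) := mul_pow _ _ _
            _ ≤ _ := by gcongr
      _ = (1 + Real.exp (2 * Real.pi) * 2 ^ (k - 1)) * |t| ^ β := by ring
      _ ≤ _ := by
        refine mul_le_mul_of_nonneg_right (le_add_of_nonneg_left ?_) (by positivity)
        positivity

theorem integrable_mul_norm_rpow {n : ℕ} {A τ β : ℝ} (hτ : 0 < τ)
    {v : Space n → ℂ} (hvm : AEStronglyMeasurable v volume)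
    (hv : ∀ z, ‖v z‖ ≤ A * (1 + ‖z‖) ^ (-(n + τ + β))) :
    Integrable fun z => ‖v z‖ * (1 + ‖z‖) ^ β := by
  have h1 : Integrable fun z : Space n => A * (1 + ‖z‖) ^ (-((n : ℝ) + τ)) :=
    (integrable_one_add_norm (E := Space n) (r := (n : ℝ) + τ) (by simp [hτ])).const_mul A
  refine h1.mono' (hvm.norm.mul ?_) (Eventually.of_forall fun z => ?_)
  · exact (by fun_prop : Measurable fun z : Space n => (1 + ‖z‖) ^ β).aestronglyMeasurable
  · have hz : (0 : ℝ) < 1 + ‖z‖ := by positivity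
    rw [Real.norm_of_nonneg (by positivity)]
    calc _ ≤ A * (1 + ‖z‖) ^ (-(n + τ + β)) * (1 + ‖z‖) ^ β := by gcongr; exact hv z
      _ = _ := by
        rw [mul_assoc, ← Real.rpow_add hz]
        congr 2; ring

theorem characterTaylor_mul (k : ℕ) (t r : ℝ) : characterTaylor k (t * r) =
    ∑ j ∈ Finset.range k,
      ((((-2 * Real.pi * r : ℝ) : ℂ) * Complex.I) ^ j / (j.factorial : ℂ)) * (t : ℂ) ^ j := by
  refine Finset.sum_congr rfl fun j _ => ?_
  rw [div_mul_eq_mul_div, ← mul_pow]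
  congr 2
  push_cast
  ring

/-- The moments of a function whose Fourier transform vanishes to high order at the origin
vanish. -/
theorem integral_mul_characterTaylor_eq_zero {n k : ℕ} (hk : 1 ≤ k) {β A D : ℝ}
    (hkβ : (k : ℝ) - 1 < β) (hβk : β ≤ k) {v : Space n → ℂ} {τ : ℝ} (hτ : 0 < τ)
    (hvm : AEStronglyMeasurable v volume)
    (hv : ∀ z, ‖v z‖ ≤ A * (1 + ‖z‖) ^ (-(n + τ + β)))
    (hD0 : 0 ≤ D) (hD : ∀ ξ, ‖𝓕 v ξ‖ ≤ D * ‖ξ‖ ^ (τ + β)) (ξ : Space n) :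
    ∫ z, v z * characterTaylor k (inner ℝ ξ z) = 0 := by
  have hk1 : (1 : ℝ) ≤ k := by exact_mod_cast hk
  have hβ0 : 0 < β := by linarith
  have hvi := integrable_mul_norm_rpow hτ hvm hv
  have hz1 : ∀ z : Space n, (1 : ℝ) ≤ 1 + ‖z‖ := fun z => by linarith [norm_nonneg z]
  have hv1 : Integrable v := hvi.mono' hvm (Eventually.of_forall fun z =>
    le_mul_of_one_le_right (norm_nonneg _) (Real.one_le_rpow (hz1 z) hβ0.le))
  have hterm : ∀ j ∈ Finset.range k, Integrable fun z =>
      v z * ((((-2 * Real.pi * inner ℝ ξ z : ℝ) : ℂ) * Complex.I) ^ j / (j.factorial : ℂ)) := by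
    intro j hj
    have hj' : (j : ℝ) ≤ k - 1 := by
      have := Finset.mem_range.1 hj
      have : j + 1 ≤ k := this
      have : (j : ℝ) + 1 ≤ k := by exact_mod_cast this
      linarith
    refine (hvi.const_mul ((2 * Real.pi * ‖ξ‖) ^ j / j.factorial)).mono'
      (hvm.mul (by fun_prop : Continuous fun z : Space n =>
        (((-2 * Real.pi * inner ℝ ξ z : ℝ) : ℂ) * Complex.I) ^ j / (j.factorial : ℂ)
        ).aestronglyMeasurable) (Eventually.of_forall fun z => ?_)
    have hpi := Real.pi_pos
    have h1 : ‖((-2 * Real.pi * inner ℝ ξ z : ℝ) : ℂ) * Complex.I‖ ≤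
        2 * Real.pi * ‖ξ‖ * (1 + ‖z‖) := by
      rw [norm_mul, Complex.norm_real, Complex.norm_I, mul_one, Real.norm_eq_abs, abs_mul, abs_mul,
        abs_of_pos Real.pi_pos, abs_neg, abs_two, mul_assoc (2 * Real.pi)]
      gcongr
      exact (abs_real_inner_le_norm _ _).trans (by gcongr; linarith)
    rw [norm_mul, norm_div, norm_pow, Complex.norm_natCast]
    calc _ ≤ ‖v z‖ * ((2 * Real.pi * ‖ξ‖ * (1 + ‖z‖)) ^ j / j.factorial) := by gcongr
      _ = (2 * Real.pi * ‖ξ‖) ^ j / j.factorial * (‖v z‖ * (1 + ‖z‖) ^ (j : ℝ)) := by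
        rw [mul_pow, Real.rpow_natCast]; ring
      _ ≤ _ := by
        gcongr
        · exact hz1 z
        · linarith
  set a : ℕ → ℂ := fun j => ∫ z,
    v z * ((((-2 * Real.pi * inner ℝ ξ z : ℝ) : ℂ) * Complex.I) ^ j / (j.factorial : ℂ)) with ha
  have hsum : ∀ t : ℝ, (∫ z, v z * characterTaylor k (t * inner ℝ ξ z)) =
      ∑ j ∈ Finset.range k, a j * (t : ℂ) ^ j := by
    intro t
    simp_rw [characterTaylor_mul, Finset.mul_sum, ← mul_assoc]
    rw [integral_finsetSum]
    · refine Finset.sum_congr rfl fun j _ => ?_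
      rw [integral_mul_const]
    · exact fun j hj => (hterm j hj).mul_const _
  set M := (2 * Real.pi) ^ k * Real.exp (2 * Real.pi) +
    (1 + Real.exp (2 * Real.pi) * 2 ^ (k - 1)) with hM
  have hM0 : 0 ≤ M := by have := Real.pi_pos; positivity
  have hT : ∀ t : ℝ, Integrable fun z => v z * characterTaylor k (t * inner ℝ ξ z) := by
    intro t
    simp_rw [characterTaylor_mul, Finset.mul_sum, ← mul_assoc]
    exact integrable_finsetSum _ fun j hj => (hterm j hj).mul_const _
  have hchar : ∀ t : ℝ, Integrable fun z => v z * character (t * inner ℝ ξ z) := by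
    intro t
    refine hv1.norm.mono' (hvm.mul (by fun_prop : Continuous fun z : Space n =>
      character (t * inner ℝ ξ z)).aestronglyMeasurable) (Eventually.of_forall fun z => ?_)
    rw [norm_mul, norm_character, mul_one]
  -- The transform of v at tξ is O(t^(τ+β)), and its difference from the polynomial in t formed by
  -- the moments is O(t^β). Hence that polynomial, of degree less than k, is O(t^β) with β > k-1.
  have hbound : ∀ t : ℝ, 0 < t → t ≤ 1 → ‖∑ j ∈ Finset.range k, a j * (t : ℂ) ^ j‖ ≤
      (D * ‖ξ‖ ^ (τ + β) + M * ‖ξ‖ ^ β * ∫ z, ‖v z‖ * (1 + ‖z‖) ^ β) * t ^ β := by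
    intro t ht ht1
    have hF : 𝓕 v (t • ξ) = ∫ z, v z * character (t * inner ℝ ξ z) := by
      rw [Real.fourier_eq']
      refine integral_congr_ae (Eventually.of_forall fun z => ?_)
      simp only [smul_eq_mul, character, inner_smul_right, real_inner_comm]
      rw [mul_comm]
    have hdiff : 𝓕 v (t • ξ) - ∑ j ∈ Finset.range k, a j * (t : ℂ) ^ j =
        ∫ z, v z * (character (t * inner ℝ ξ z) - characterTaylor k (t * inner ℝ ξ z)) := by
      simp_rw [hF, ← hsum, mul_sub]
      rw [integral_sub (hchar t) (hT t)]
    have h1 : ‖𝓕 v (t • ξ) - ∑ j ∈ Finset.range k, a j * (t : ℂ) ^ j‖ ≤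
        M * ‖ξ‖ ^ β * (∫ z, ‖v z‖ * (1 + ‖z‖) ^ β) * t ^ β := by
      rw [hdiff]
      refine (norm_integral_le_of_norm_le (hvi.const_mul (M * ‖ξ‖ ^ β * t ^ β))
        (Eventually.of_forall fun z => ?_)).trans (le_of_eq ?_)
      · rw [norm_mul]
        calc _ ≤ ‖v z‖ * (M * |t * inner ℝ ξ z| ^ β) := by
              gcongr
              exact norm_character_sub_characterTaylor_le_rpow hk hkβ.le hβk _
          _ ≤ ‖v z‖ * (M * (t * (‖ξ‖ * (1 + ‖z‖))) ^ β) := by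
              rw [abs_mul, abs_of_pos ht]
              gcongr
              exact (abs_real_inner_le_norm _ _).trans (by gcongr; linarith)
          _ = _ := by
              rw [Real.mul_rpow ht.le (by positivity), Real.mul_rpow (by positivity)
                (by positivity)]
              ring
      · rw [integral_const_mul]; ring
    have h2 : ‖𝓕 v (t • ξ)‖ ≤ D * ‖ξ‖ ^ (τ + β) * t ^ β := by
      refine (hD _).trans ?_
      rw [norm_smul, Real.norm_of_nonneg ht.le, Real.mul_rpow ht.le (norm_nonneg _)]
      calc _ ≤ D * (t ^ β * ‖ξ‖ ^ (τ + β)) := by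
            gcongr D * (?_ * _)
            exact Real.rpow_le_rpow_of_exponent_ge ht ht1 (by linarith)
        _ = _ := by ring
    have h3 := norm_sub_norm_le (∑ j ∈ Finset.range k, a j * (t : ℂ) ^ j) (𝓕 v (t • ξ))
    rw [norm_sub_rev] at h3
    linarith
  have h0 := eq_zero_of_norm_sum_mul_pow_le k a hkβ hbound
  have h1 := hsum 1
  simp only [one_mul] at h1
  rw [h1]
  exact Finset.sum_eq_zero fun j hj => by rw [h0 j (Finset.mem_range.1 hj), zero_mul]

/-! ### Low-frequency kernels and damping. -/

/-- The function `x ↦ ∫ θ(ξ) h(ξ·z) exp(-2πix·ξ) dξ` with the low frequency cutoff `θ`. -/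
def lowKernel {n : ℕ} (h : ℝ → ℂ) (z x : Space n) : ℂ :=
  𝓕 (fun ξ => lowCutoff ξ * h (inner ℝ ξ z)) x

section LowKernel

variable {n : ℕ}

theorem stronglyMeasurable_lowKernel {h : ℝ → ℂ} (hh : Continuous h) :
    StronglyMeasurable fun w : Space n × Space n => lowKernel h w.1 w.2 := by
  simp only [lowKernel, Real.fourier_eq']
  have : Continuous fun q : (Space n × Space n) × Space n =>
      Complex.exp (((-2 * Real.pi * inner ℝ q.2 q.1.2 : ℝ) : ℂ) * Complex.I) •
        (lowCutoff q.2 * h (inner ℝ q.2 q.1.1)) := by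
    have h1 : Continuous fun q : (Space n × Space n) × Space n => lowCutoff q.2 :=
      continuous_lowCutoff.comp continuous_snd
    fun_prop
  exact this.stronglyMeasurable.integral_prod_right'

theorem lowKernel_character (z x : Space n) :
    lowKernel character z x = 𝓕 (lowCutoff : Space n → ℂ) (x + z) := by
  rw [← fourier_exp_mul, lowKernel]
  refine congrArg (fun h : Space n → ℂ => 𝓕 h x) (funext fun ξ => ?_)
  rw [mul_comm, character]

theorem integrable_lowCutoff_mul {h : Space n → ℂ} (hh : Continuous h) :
    Integrable fun ξ => lowCutoff ξ * h ξ :=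
  (continuous_lowCutoff.mul hh).integrable_of_hasCompactSupport
    hasCompactSupport_lowCutoff.mul_right

theorem lowKernel_add {h₁ h₂ : ℝ → ℂ} (hh₁ : Continuous h₁) (hh₂ : Continuous h₂)
    (z x : Space n) :
    lowKernel (fun t => h₁ t + h₂ t) z x = lowKernel h₁ z x + lowKernel h₂ z x := by
  simp only [lowKernel]
  rw [← fourier_add_of_integrable (integrable_lowCutoff_mul (by fun_prop))
    (integrable_lowCutoff_mul (by fun_prop))]
  simp only [mul_add]

theorem fourier_lowCutoff_mul_fourier {V : Space n → ℂ} (hV : Integrable V) (x : Space n) :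
    𝓕 (fun ξ => lowCutoff ξ * 𝓕 V ξ) x = ∫ z, V z * lowKernel character z x := by
  have h1 := fourier_fourier_mul hV integrable_lowCutoff x
  simp_rw [mul_comm (lowCutoff _), h1, lowKernel_character, add_comm x]

theorem integral_mul_lowKernel {V : Space n → ℂ} {h : ℝ → ℂ} (hV : AEStronglyMeasurable V volume)
    (hh : Continuous h) {m : Space n → ℝ} (hm : Integrable fun z => ‖V z‖ * m z)
    (hhm : ∀ ξ z : Space n, ‖ξ‖ ≤ 1 → ‖h (inner ℝ ξ z)‖ ≤ m z) (x : Space n) :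
    ∫ z, V z * lowKernel h z x = 𝓕 (fun ξ => lowCutoff ξ * ∫ z, V z * h (inner ℝ ξ z)) x := by
  simp only [lowKernel, Real.fourier_eq', smul_eq_mul, ← integral_const_mul]
  rw [integral_integral_swap]
  · refine integral_congr_ae (Eventually.of_forall fun ξ =>
      integral_congr_ae (Eventually.of_forall fun z => ?_))
    simp only
    ring
  · have h1 : Continuous fun q : Space n × Space n =>
        Complex.exp (((-2 * Real.pi * inner ℝ q.2 x : ℝ) : ℂ) * Complex.I) *
          (lowCutoff q.2 * h (inner ℝ q.2 q.1)) := by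
      have h1 : Continuous fun q : Space n × Space n => lowCutoff q.2 :=
        continuous_lowCutoff.comp continuous_snd
      fun_prop
    refine (hm.mul_prod (integrable_lowCutoff (n := n)).norm).mono'
      (hV.comp_fst.mul h1.aestronglyMeasurable) (Eventually.of_forall fun q => ?_)
    simp only [Function.uncurry]
    rw [norm_mul, norm_mul, norm_mul, Complex.norm_exp_ofReal_mul_I, one_mul]
    rcases le_or_gt ‖q.2‖ 1 with hq | hq
    · calc _ ≤ ‖V q.1‖ * (‖lowCutoff q.2‖ * m q.1) := by gcongr; exact hhm _ _ hq
        _ = _ := by ring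
    · rw [lowCutoff_of_le (by linarith)]; simp

/-- Subtracting the Taylor polynomial makes the test function vanish to order k ≥ lam at ξ = 0. That
is the condition under which the potential identity may be used, even though the cutoff does not
vanish there. -/
theorem integral_mul_lowKernel_character_sub {k : ℕ} {lam : ℝ} {f g : Space n → ℂ}
    (hlam : 0 ≤ lam) (hk : lam ≤ k) (hfg : IsRieszPotential lam f g) (z : Space n) :
    ∫ x, f x * lowKernel (fun t => character t - characterTaylor k t) z x =
      ∫ y, g y * 𝓕 (remainderSymbol lam k z) y := by
  have hsm : ContDiff ℝ ∞ fun ξ : Space n => lowCutoff ξ *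
      (character (inner ℝ ξ z) - characterTaylor k (inner ℝ ξ z)) := by
    have hi : ContDiff ℝ ∞ fun ξ : Space n => inner ℝ ξ z := contDiff_id.inner ℝ contDiff_const
    exact contDiff_lowCutoff.mul ((contDiff_character.comp hi).sub
      ((contDiff_characterTaylor k).comp hi))
  set ψ : 𝓢(Space n, ℂ) := (hasCompactSupport_lowCutoff.mul_right (f' := fun ξ : Space n =>
    character (inner ℝ ξ z) - characterTaylor k (inner ℝ ξ z))).toSchwartzMap hsm with hψ
  have hψa : ∀ ξ, ψ ξ = lowCutoff ξ *
      (character (inner ℝ ξ z) - characterTaylor k (inner ℝ ξ z)) := fun ξ => rfl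
  refine hfg ψ ?_
  refine Asymptotics.IsBigO.of_bound ((2 * Real.pi * ‖z‖) ^ k * Real.exp (2 * Real.pi * ‖z‖)) ?_
  filter_upwards [Metric.ball_mem_nhds (0 : Space n) one_pos] with ξ hξ
  rw [mem_ball_zero_iff] at hξ
  have hpi := Real.pi_pos
  rw [hψa, norm_mul, Real.norm_of_nonneg (by positivity)]
  rcases eq_or_ne ξ 0 with rfl | hξ0
  · have := norm_character_sub_le k 0
    rw [inner_zero_left]
    rcases Nat.eq_zero_or_pos k with rfl | hk0
    · have hl : lam = 0 := le_antisymm (by simpa using hk) hlam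
      rw [hl, norm_zero, Real.rpow_zero]
      simp only [abs_zero, mul_zero, pow_zero, one_mul, Real.exp_zero] at this
      calc _ ≤ (1 : ℝ) * 1 := by gcongr; exact norm_lowCutoff_le _
        _ ≤ _ := by
          rw [pow_zero, one_mul, one_mul, mul_one]
          exact Real.one_le_exp (by positivity)
    · rw [abs_zero, mul_zero, zero_pow hk0.ne', zero_mul] at this
      rw [le_antisymm this (norm_nonneg _), mul_zero]
      positivity
  · have hξ' : 0 < ‖ξ‖ := norm_pos_iff.2 hξ0
    have hin : |inner ℝ ξ z| ≤ ‖ξ‖ * ‖z‖ := abs_real_inner_le_norm _ _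
    calc _ ≤ 1 * ((2 * Real.pi * |inner ℝ ξ z|) ^ k * Real.exp (2 * Real.pi * |inner ℝ ξ z|)) := by
          gcongr
          · exact norm_lowCutoff_le _
          · exact norm_character_sub_le _ _
      _ ≤ (2 * Real.pi * (‖ξ‖ * ‖z‖)) ^ k * Real.exp (2 * Real.pi * ‖z‖) := by
          rw [one_mul]
          gcongr
          exact hin.trans (mul_le_of_le_one_left (norm_nonneg _) hξ.le)
      _ = (2 * Real.pi * ‖z‖) ^ k * Real.exp (2 * Real.pi * ‖z‖) * ‖ξ‖ ^ (k : ℝ) := by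
          rw [Real.rpow_natCast, ← mul_assoc, mul_right_comm _ ‖ξ‖, mul_pow]; ring
      _ ≤ _ := by
          gcongr _ * ?_
          exact Real.rpow_le_rpow_of_exponent_ge hξ' hξ.le hk

/-- A function `v` damped by a Gaussian. -/
def damp (v : Space n → ℂ) (s : ℝ) (z : Space n) : ℂ :=
  v z * ((Real.exp (-s ^ 2 * ‖z‖ ^ 2) : ℝ) : ℂ)

theorem norm_damp_le (v : Space n → ℂ) (s : ℝ) (z : Space n) : ‖damp v s z‖ ≤ ‖v z‖ := by
  rw [damp, norm_mul, Complex.norm_real, Real.norm_of_nonneg (Real.exp_pos _).le]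
  refine mul_le_of_le_one_right (norm_nonneg _) (Real.exp_le_one_iff.2 ?_)
  nlinarith [mul_nonneg (sq_nonneg s) (sq_nonneg ‖z‖)]

theorem continuous_damp {v : Space n → ℂ} (hv : Continuous v) (s : ℝ) : Continuous (damp v s) := by
  unfold damp
  fun_prop

theorem tendsto_damp (v : Space n → ℂ) (z : Space n) :
    Tendsto (fun s => damp v s z) (𝓝[>] 0) (𝓝 (v z)) := by
  have : Continuous fun s : ℝ => damp v s z := by unfold damp; fun_prop
  have h := this.tendsto 0
  rw [show damp v 0 z = v z by simp [damp]] at h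
  exact h.mono_left nhdsWithin_le_nhds

theorem integrable_damp {v : Space n → ℂ} (hv : AEStronglyMeasurable v volume) {A : ℝ}
    (hA : ∀ z, ‖v z‖ ≤ A) {s : ℝ} (hs : 0 < s) (M : ℕ) :
    Integrable fun z => ‖damp v s z‖ * (1 + ‖z‖) ^ M := by
  obtain ⟨C, hC0, hC⟩ := SchwartzMap.exists_norm_le (gaussian : 𝓢(Space n, ℂ)) (M + (n + 1))
  have hA0 : 0 ≤ A := (norm_nonneg _).trans (hA 0)
  have h1 : Integrable fun z : Space n =>
      A * C * (1 + s⁻¹) ^ (M + (n + 1)) * (1 + ‖z‖) ^ (-((n : ℝ) + 1)) :=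
    (integrable_one_add_norm (E := Space n) (r := (n : ℝ) + 1) (by simp)).const_mul _
  have hm : AEStronglyMeasurable (fun z => ‖damp v s z‖ * (1 + ‖z‖) ^ M) volume := by
    refine (AEStronglyMeasurable.norm ?_).mul
      (by fun_prop : Continuous fun z : Space n => (1 + ‖z‖) ^ M).aestronglyMeasurable
    unfold damp
    exact hv.mul (by fun_prop : Continuous fun z : Space n =>
      ((Real.exp (-s ^ 2 * ‖z‖ ^ 2) : ℝ) : ℂ)).aestronglyMeasurable
  refine h1.mono' hm (Eventually.of_forall fun z => ?_)
  rw [Real.norm_of_nonneg (by positivity)]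
  have hg : ‖((Real.exp (-s ^ 2 * ‖z‖ ^ 2) : ℝ) : ℂ)‖ ≤
      C * ((1 + ‖s • z‖) ^ (M + (n + 1)))⁻¹ := by
    have := hC (s • z)
    rw [gaussian_apply] at this
    convert this using 5
    rw [norm_smul, mul_pow, Real.norm_eq_abs, sq_abs]; ring
  have h2 : 1 + ‖z‖ ≤ (1 + s⁻¹) * (1 + ‖s • z‖) := by
    rw [norm_smul, Real.norm_of_nonneg hs.le]
    have : s⁻¹ * (s * ‖z‖) = ‖z‖ := by field_simp
    have : 0 < s⁻¹ := by positivity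
    nlinarith [norm_nonneg z, mul_nonneg hs.le (norm_nonneg z)]
  have h3 : ((1 + ‖s • z‖) ^ (M + (n + 1)))⁻¹ ≤
      (1 + s⁻¹) ^ (M + (n + 1)) * ((1 + ‖z‖) ^ (M + (n + 1)))⁻¹ := by
    rw [← div_eq_mul_inv, le_div_iff₀ (by positivity), inv_mul_le_iff₀ (by positivity),
      ← mul_pow, mul_comm (1 + ‖s • z‖)]
    gcongr
  rw [damp, norm_mul]
  calc _ ≤ A * (C * ((1 + s⁻¹) ^ (M + (n + 1)) * ((1 + ‖z‖) ^ (M + (n + 1)))⁻¹)) *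
        (1 + ‖z‖) ^ M := by
        gcongr
        · exact hA z
        · exact hg.trans (by gcongr)
    _ = _ := by
        rw [Real.rpow_neg (by positivity), show (n : ℝ) + 1 = ((n + 1 : ℕ) : ℝ) by push_cast; ring,
          Real.rpow_natCast, pow_add (1 + ‖z‖)]
        field_simp

end LowKernel

/-! ### The low-frequency limit. -/

theorem integrable_prod_mul_lowKernel {n M N : ℕ} {C : ℝ} {h : ℝ → ℂ} (hh : Continuous h)
    (hC : ∀ z x : Space n, ‖lowKernel h z x‖ ≤ C * (1 + ‖z‖) ^ M * ((1 + ‖x‖) ^ N)⁻¹)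
    {f V : Space n → ℂ} (hfm : AEStronglyMeasurable f volume)
    (hf : Integrable fun x => ‖f x‖ * ((1 + ‖x‖) ^ N)⁻¹) (hVm : AEStronglyMeasurable V volume)
    (hV : Integrable fun z => ‖V z‖ * (1 + ‖z‖) ^ M) :
    Integrable fun q : Space n × Space n => f q.1 * (V q.2 * lowKernel h q.2 q.1) := by
  have hm : AEStronglyMeasurable
      (fun q : Space n × Space n => f q.1 * (V q.2 * lowKernel h q.2 q.1)) (volume.prod volume) := by
    refine hfm.comp_fst.mul (hVm.comp_snd.mul ?_)
    exact ((stronglyMeasurable_lowKernel hh).comp_measurable measurable_swap).aestronglyMeasurable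
  refine ((hf.mul_prod hV).const_mul C).mono' hm (Eventually.of_forall fun q => ?_)
  rw [norm_mul, norm_mul]
  calc _ ≤ ‖f q.1‖ * (‖V q.2‖ * (C * (1 + ‖q.2‖) ^ M * ((1 + ‖q.1‖) ^ N)⁻¹)) := by
        gcongr; exact hC _ _
    _ = _ := by ring

/-- The undamped pairing is zero by `hv0`, and the integrability of v against (1+‖z‖)^M permits
passing to it by dominated convergence in z and in x. -/
theorem tendsto_integral_mul_integral_damp_mul_lowKernel {n M N : ℕ} {A C : ℝ} {h : ℝ → ℂ}
    (hh : Continuous h)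
    (hC : ∀ z x : Space n, ‖lowKernel h z x‖ ≤ C * (1 + ‖z‖) ^ M * ((1 + ‖x‖) ^ N)⁻¹)
    {f v : Space n → ℂ} (hfm : AEStronglyMeasurable f volume)
    (hf : Integrable fun x => ‖f x‖ * ((1 + ‖x‖) ^ N)⁻¹) (hvc : Continuous v)
    (hvA : ∀ z, ‖v z‖ ≤ A) (hv : Integrable fun z => ‖v z‖ * (1 + ‖z‖) ^ M)
    (hv0 : ∀ x, ∫ z, v z * lowKernel h z x = 0) :
    Tendsto (fun s => ∫ x, f x * ∫ z, damp v s z * lowKernel h z x) (𝓝[>] 0) (𝓝 0) := by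
  have hmz : ∀ x : Space n, AEStronglyMeasurable (fun z => lowKernel h z x) volume := fun x =>
    ((stronglyMeasurable_lowKernel hh).comp_measurable
      (measurable_id.prodMk measurable_const)).aestronglyMeasurable
  have hpt : ∀ s (x : Space n), ‖f x * ∫ z, damp v s z * lowKernel h z x‖ ≤
      ‖f x‖ * ((1 + ‖x‖) ^ N)⁻¹ * (C * ∫ z, ‖v z‖ * (1 + ‖z‖) ^ M) := by
    intro s x
    rw [norm_mul, mul_assoc]
    gcongr
    refine (norm_integral_le_of_norm_le (hv.const_mul (((1 + ‖x‖) ^ N)⁻¹ * C))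
      (Eventually.of_forall fun z => ?_)).trans (le_of_eq ?_)
    · rw [norm_mul]
      calc _ ≤ ‖v z‖ * (C * (1 + ‖z‖) ^ M * ((1 + ‖x‖) ^ N)⁻¹) := by
            gcongr
            · exact norm_damp_le _ _ _
            · exact hC _ _
        _ = _ := by ring
    · rw [integral_const_mul]; ring
  rw [show (0 : ℂ) = ∫ x, f x * ∫ z, v z * lowKernel h z x by simp [hv0]]
  refine tendsto_integral_filter_of_dominated_convergence _ ?_
    (Eventually.of_forall fun s => Eventually.of_forall fun x => hpt s x) (hf.mul_const _)
    (Eventually.of_forall fun x => Tendsto.const_mul _ ?_)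
  · filter_upwards [self_mem_nhdsWithin] with s hs
    have := (integrable_prod_mul_lowKernel hh hC hfm hf
      (continuous_damp hvc s).aestronglyMeasurable
      (integrable_damp hvc.aestronglyMeasurable hvA hs M)).integral_prod_left
    simp only [integral_const_mul] at this
    exact this.1
  · refine tendsto_integral_filter_of_dominated_convergence
      (fun z => ((1 + ‖x‖) ^ N)⁻¹ * C * (‖v z‖ * (1 + ‖z‖) ^ M))
      (Eventually.of_forall fun s => ?_) (Eventually.of_forall fun s =>
        Eventually.of_forall fun z => ?_) (hv.const_mul _)
      (Eventually.of_forall fun z => (tendsto_damp v z).mul_const _)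
    · exact (continuous_damp hvc s).aestronglyMeasurable.mul (hmz x)
    · rw [norm_mul]
      calc _ ≤ ‖v z‖ * (C * (1 + ‖z‖) ^ M * ((1 + ‖x‖) ^ N)⁻¹) := by
            gcongr
            · exact norm_damp_le _ _ _
            · exact hC _ _
        _ = _ := by ring

/-- Tonelli with the z-integral first: for fixed y ≠ 0 it is at most a multiple of ‖y‖^(α-n). -/
theorem exists_integrable_prod_remainder {n : ℕ} (hn : 1 ≤ n) {α τ : ℝ} (hα : 0 < α) (hαn : α < n)
    (hτ : 0 < τ) : ∃ C : ℝ, 0 ≤ C ∧ ∀ g : Space n → ℂ, AEStronglyMeasurable g volume →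
      (Integrable fun y => ‖g y‖ * ‖y‖ ^ (α - n)) →
      Integrable (fun q : Space n × Space n => ‖g q.2‖ * ((1 + ‖q.1‖) ^ (-(n + τ)) *
        (‖q.2‖ ^ (α - n) + ‖q.1 + q.2‖ ^ (α - n)))) ∧
      ∫ z, ∫ y, ‖g y‖ * ((1 + ‖z‖) ^ (-(n + τ)) * (‖y‖ ^ (α - n) + ‖z + y‖ ^ (α - n))) ≤
        C * ∫ y, ‖g y‖ * ‖y‖ ^ (α - n) := by
  have : Nonempty (Fin n) := ⟨⟨0, hn⟩⟩
  have hae : ∀ᵐ x : Space n, x ≠ 0 := by simp [ae_iff, measure_singleton]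
  obtain ⟨C, hC0, hC⟩ := exists_integral_mul_norm_add_rpow_le hn hα hαn hτ
  have hJ : Integrable fun z : Space n => (1 + ‖z‖) ^ (-((n : ℝ) + τ)) :=
    integrable_one_add_norm (E := Space n) (r := (n : ℝ) + τ) (by simp [hτ])
  set J := ∫ z : Space n, (1 + ‖z‖) ^ (-((n : ℝ) + τ)) with hJd
  have hJ0 : 0 ≤ J := integral_nonneg fun z => by positivity
  refine ⟨J + C, by positivity, fun g hg hgi => ?_⟩
  have hsl : ∀ y : Space n, y ≠ 0 → (Integrable fun z : Space n => ‖g y‖ *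
      ((1 + ‖z‖) ^ (-(n + τ)) * (‖y‖ ^ (α - n) + ‖z + y‖ ^ (α - n)))) ∧
      ∫ z : Space n, ‖g y‖ * ((1 + ‖z‖) ^ (-(n + τ)) * (‖y‖ ^ (α - n) + ‖z + y‖ ^ (α - n))) ≤
        (J + C) * (‖g y‖ * ‖y‖ ^ (α - n)) := by
    intro y hy
    obtain ⟨h1, h2⟩ := hC y hy
    simp only [mul_add]
    have h3 := hJ.mul_const (‖y‖ ^ (α - n))
    refine ⟨(h3.const_mul _).add (h1.const_mul _), ?_⟩
    rw [integral_add (h3.const_mul _) (h1.const_mul _), integral_const_mul, integral_const_mul,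
      integral_mul_const, ← hJd]
    calc _ ≤ ‖g y‖ * (J * ‖y‖ ^ (α - n)) + ‖g y‖ * (C * ‖y‖ ^ (α - n)) := by gcongr
      _ = _ := by ring
  have hm : AEStronglyMeasurable (fun q : Space n × Space n => ‖g q.2‖ * ((1 + ‖q.1‖) ^ (-(n + τ)) *
        (‖q.2‖ ^ (α - n) + ‖q.1 + q.2‖ ^ (α - n)))) (volume.prod volume) := by
    refine hg.norm.comp_snd.mul ?_
    exact (by fun_prop : Measurable fun q : Space n × Space n => (1 + ‖q.1‖) ^ (-(n + τ)) *
        (‖q.2‖ ^ (α - n) + ‖q.1 + q.2‖ ^ (α - n))).aestronglyMeasurable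
  have hint : Integrable (fun q : Space n × Space n => ‖g q.2‖ * ((1 + ‖q.1‖) ^ (-(n + τ)) *
        (‖q.2‖ ^ (α - n) + ‖q.1 + q.2‖ ^ (α - n)))) (volume.prod volume) := by
    rw [integrable_prod_iff' hm]
    refine ⟨?_, ?_⟩
    · filter_upwards [hae] with y hy
      exact (hsl y hy).1
    · refine (hgi.const_mul (J + C)).mono' hm.norm.prod_swap.integral_prod_right' ?_
      filter_upwards [hae] with y hy
      rw [Real.norm_of_nonneg (integral_nonneg fun _ => norm_nonneg _)]
      refine (le_of_eq ?_).trans (hsl y hy).2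
      refine integral_congr_ae (Eventually.of_forall fun z => ?_)
      simp only
      rw [Real.norm_of_nonneg (by positivity)]
  refine ⟨hint, ?_⟩
  rw [integral_integral_swap hint, ← integral_const_mul]
  refine integral_mono_ae ?_ (hgi.const_mul _) ?_
  · exact hint.swap.integral_prod_left
  · filter_upwards [hae] with y hy
    exact (hsl y hy).2

/-- Fubini turns the pairing into an integral of the damped v(z) against ∫ f(x) 𝓕 θ(x+z) dx. In the
latter the character is split as Taylor polynomial plus remainder. The polynomial contributes
nothing in the limit, by the vanishing moments; the remainder becomes an integral of g with a gain
‖z‖^β, and v(z)‖z‖^β is still O((1+‖z‖)^(-n-τ)). -/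
theorem exists_tendsto_integral_lowCutoff_mul_fourier_damp {n k : ℕ} (hn : 1 ≤ n)
    {α β lam τ A : ℝ} (hα : 0 < α) (hαn : α < n) (hk : 1 ≤ k) (hkβ : (k : ℝ) - 1 < β)
    (hβk : β ≤ k) (hβ : lam - α ≤ β) (hlam : 0 ≤ lam) (hlamk : lam ≤ k) (hτ : 0 < τ) (hA : 0 ≤ A)
    {v : Space n → ℂ} (hvc : Continuous v)
    (hv : ∀ z, ‖v z‖ ≤ A * (1 + ‖z‖) ^ (-(n + τ + β)))
    (hmom : ∀ ξ, ∫ z, v z * characterTaylor k (inner ℝ ξ z) = 0) :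
    ∃ C : ℝ, 0 ≤ C ∧ ∀ f g : Space n → ℂ, IsTempered f → AEStronglyMeasurable g volume →
      IsRieszPotential lam f g → (Integrable fun y => ‖g y‖ * ‖y‖ ^ (α - n)) →
      ∃ L : ℂ, Tendsto (fun s => ∫ x, f x * 𝓕 (fun ξ => lowCutoff ξ * 𝓕 (damp v s) ξ) x)
          (𝓝[>] 0) (𝓝 L) ∧ ‖L‖ ≤ C * ∫ y, ‖g y‖ * ‖y‖ ^ (α - n) := by
  have : Nonempty (Fin n) := ⟨⟨0, hn⟩⟩
  have hae : ∀ᵐ x : Space n, x ≠ 0 := by simp [ae_iff, measure_singleton]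
  have hae' : ∀ z : Space n, ∀ᵐ x : Space n, x + z ≠ 0 := fun z => by
    have : ∀ᵐ x : Space n, x ≠ -z := by simp [ae_iff, measure_singleton]
    filter_upwards [this] with x hx h
    exact hx (eq_neg_of_add_eq_zero_left h)
  have hk1 : (1 : ℝ) ≤ k := by exact_mod_cast hk
  have hβ0 : 0 < β := by linarith
  have hz1 : ∀ z : Space n, (1 : ℝ) ≤ 1 + ‖z‖ := fun z => by linarith [norm_nonneg z]
  obtain ⟨CQ, hCQ0, hCQ⟩ := exists_norm_fourier_remainderSymbol_le (n := n) (k := k) hn hα hαn hk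
    hkβ.le hβk hβ
  obtain ⟨CP, hCP0, hCP⟩ := exists_integrable_prod_remainder hn hα hαn hτ
  refine ⟨A * CQ * CP, by positivity, fun f g hf hg hfg hgi => ?_⟩
  have hfm := hf.aestronglyMeasurable
  obtain ⟨N, hN⟩ := hf
  have hfN := IsTempered.integrable_norm hN
  obtain ⟨Cc, hCc0, hCc⟩ := exists_norm_fourier_lowCutoff_mul_character_le n N
  obtain ⟨Ct, hCt0, hCt⟩ := exists_norm_fourier_lowCutoff_mul_characterTaylor_le n N (k := k)
  set T : ℝ → ℂ := characterTaylor k with hT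
  set r : ℝ → ℂ := fun t => character t - characterTaylor k t with hr
  have hrc : Continuous r := by fun_prop
  have hTc : Continuous T := by fun_prop
  have hvA : ∀ z, ‖v z‖ ≤ A := fun z => (hv z).trans <| mul_le_of_le_one_right hA <|
    Real.rpow_le_one_of_one_le_of_nonpos (hz1 z) (by have : (0:ℝ) ≤ n := n.cast_nonneg; linarith)
  have hvβ := integrable_mul_norm_rpow hτ hvc.aestronglyMeasurable hv
  have hvk : Integrable fun z => ‖v z‖ * (1 + ‖z‖) ^ (k - 1) := by
    refine hvβ.mono' (by fun_prop : Continuous fun z => ‖v z‖ * (1 + ‖z‖) ^ (k - 1)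
      ).aestronglyMeasurable (Eventually.of_forall fun z => ?_)
    rw [Real.norm_of_nonneg (by positivity)]
    gcongr
    rw [← Real.rpow_natCast]
    refine Real.rpow_le_rpow_of_exponent_le (hz1 z) ?_
    rw [Nat.cast_sub hk]; simpa using hkβ.le
  have hsplit : ∀ z x : Space n, lowKernel character z x = lowKernel T z x + lowKernel r z x := by
    intro z x
    rw [← lowKernel_add hTc hrc]
    congr 1
    ext t
    simp [hr, hT]
  -- The growth N+k is too large for v itself; it is only integrated against the damped v, to
  -- justify Fubini.
  have hrb : ∀ z x : Space n,
      ‖lowKernel r z x‖ ≤ (Cc + Ct) * (1 + ‖z‖) ^ (N + k) * ((1 + ‖x‖) ^ N)⁻¹ := by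
    intro z x
    have h1 : lowKernel r z x = lowKernel character z x - lowKernel T z x := by
      rw [hsplit]; ring
    rw [h1]
    calc _ ≤ ‖lowKernel character z x‖ + ‖lowKernel T z x‖ := norm_sub_le _ _
      _ ≤ Cc * (1 + ‖z‖) ^ (N + k) * ((1 + ‖x‖) ^ N)⁻¹ +
          Ct * (1 + ‖z‖) ^ (N + k) * ((1 + ‖x‖) ^ N)⁻¹ := by
        gcongr
        · refine (hCc z x).trans ?_
          gcongr
          · exact hz1 z
          · omega
        · refine (hCt z x).trans ?_
          gcongr
          · exact hz1 z
          · omega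
      _ = _ := by ring
  set G : Space n → ℂ := fun z => ∫ x, f x * lowKernel r z x with hG
  have hGQ : ∀ z, G z = ∫ y, g y * 𝓕 (remainderSymbol lam k z) y := fun z =>
    integral_mul_lowKernel_character_sub hlam hlamk hfg z
  have hGm : AEStronglyMeasurable G volume := by
    have : AEStronglyMeasurable (fun q : Space n × Space n => f q.2 * lowKernel r q.1 q.2)
        (volume.prod volume) :=
      hfm.comp_snd.mul (stronglyMeasurable_lowKernel hrc).aestronglyMeasurable
    exact this.integral_prod_right'
  have hmz : ∀ (h : ℝ → ℂ), Continuous h → ∀ x : Space n,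
      AEStronglyMeasurable (fun z => lowKernel h z x) volume := fun h hh x =>
    ((stronglyMeasurable_lowKernel hh).comp_measurable
      (measurable_id.prodMk measurable_const)).aestronglyMeasurable
  -- Here s > 0 is essential: only the Gaussian makes the double integrals with the full character
  -- converge absolutely.
  have hid : ∀ s : ℝ, 0 < s → ∫ x, f x * 𝓕 (fun ξ => lowCutoff ξ * 𝓕 (damp v s) ξ) x =
      (∫ x, f x * ∫ z, damp v s z * lowKernel T z x) + ∫ z, damp v s z * G z := by
    intro s hs
    have hVm := (continuous_damp hvc s).aestronglyMeasurable (μ := volume)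
    have hVi := integrable_damp hvc.aestronglyMeasurable hvA hs
    have hV1 : Integrable (damp v s) := by
      have := hVi 0
      simp only [pow_zero, mul_one] at this
      exact (integrable_norm_iff hVm).1 this
    have hI : ∀ (h : ℝ → ℂ) (M : ℕ) (C : ℝ), Continuous h →
        (∀ z x : Space n, ‖lowKernel h z x‖ ≤ C * (1 + ‖z‖) ^ M * ((1 + ‖x‖) ^ N)⁻¹) →
        ∀ x, Integrable fun z => damp v s z * lowKernel h z x := by
      intro h M C hh hb x
      refine ((hVi M).const_mul (C * ((1 + ‖x‖) ^ N)⁻¹)).mono' (hVm.mul (hmz h hh x))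
        (Eventually.of_forall fun z => ?_)
      rw [norm_mul]
      calc _ ≤ ‖damp v s z‖ * (C * (1 + ‖z‖) ^ M * ((1 + ‖x‖) ^ N)⁻¹) := by gcongr; exact hb z x
        _ = _ := by ring
    have hprod := integrable_prod_mul_lowKernel hrc hrb hfm hfN hVm (hVi (N + k))
    have hprodT := integrable_prod_mul_lowKernel hTc hCt hfm hfN hVm (hVi (k - 1))
    have h1 := hprodT.integral_prod_left
    have h2 := hprod.integral_prod_left
    simp only [integral_const_mul] at h1 h2
    have h3 : (∫ z, damp v s z * G z) = ∫ x, f x * ∫ z, damp v s z * lowKernel r z x := by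
      simp only [hG, ← integral_const_mul]
      rw [integral_integral_swap]
      · refine integral_congr_ae (Eventually.of_forall fun x =>
          integral_congr_ae (Eventually.of_forall fun z => ?_))
        simp only
        ring
      · refine hprod.swap.congr (Eventually.of_forall fun q => ?_)
        simp only [Function.comp, Function.uncurry, Prod.swap]
        ring
    rw [h3, ← integral_add h1 h2]
    refine integral_congr_ae (Eventually.of_forall fun x => ?_)
    simp only
    rw [fourier_lowCutoff_mul_fourier hV1, ← mul_add,
      ← integral_add (hI T _ _ hTc hCt x) (hI r _ _ hrc hrb x)]
    simp only [hsplit, mul_add]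
  have hT0 : Tendsto (fun s => ∫ x, f x * ∫ z, damp v s z * lowKernel T z x) (𝓝[>] 0) (𝓝 0) := by
    refine tendsto_integral_mul_integral_damp_mul_lowKernel hTc hCt hfm hfN hvc hvA hvk
      fun x => ?_
    rw [integral_mul_lowKernel (m := fun z => Real.exp (2 * Real.pi) * (1 + ‖z‖) ^ (k - 1))
      hvc.aestronglyMeasurable hTc]
    · have : (fun ξ : Space n => lowCutoff ξ * ∫ z, v z * T (inner ℝ ξ z)) = fun _ => 0 := by
        ext ξ
        rw [hT, hmom, mul_zero]
      rw [this, Real.fourier_eq']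
      simp
    · refine (hvk.const_mul (Real.exp (2 * Real.pi))).congr (Eventually.of_forall fun z => ?_)
      simp only
      ring
    · intro ξ z hξ
      exact norm_characterTaylor_le hk ((abs_real_inner_le_norm _ _).trans
        (mul_le_of_le_one_left (norm_nonneg _) hξ))
  obtain ⟨hH, hHle⟩ := hCP g hg hgi
  -- Stated for every c with ‖c‖ ≤ ‖v z‖, so that it serves both as the majorant for the damped
  -- integrals and as the bound for their limit.
  have hdom : ∀ᵐ z : Space n, ∀ c : ℂ, ‖c‖ ≤ ‖v z‖ → ‖c * G z‖ ≤ A * CQ * ∫ y, ‖g y‖ *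
      ((1 + ‖z‖) ^ (-(n + τ)) * (‖y‖ ^ (α - n) + ‖z + y‖ ^ (α - n))) := by
    filter_upwards [hae, hH.prod_right_ae] with z hz hzi c hc
    rw [hGQ, ← integral_const_mul, ← integral_const_mul]
    refine norm_integral_le_of_norm_le (hzi.const_mul _) ?_
    filter_upwards [hae, hae' z] with y hy hyz
    have hz0 : 0 < 1 + ‖z‖ := by positivity
    have hvz : ‖v z‖ * ‖z‖ ^ β ≤ A * (1 + ‖z‖) ^ (-(n + τ)) := by
      calc _ ≤ A * (1 + ‖z‖) ^ (-(n + τ + β)) * (1 + ‖z‖) ^ β := by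
            gcongr
            · exact hv z
            · linarith
        _ = _ := by
            rw [mul_assoc, ← Real.rpow_add hz0]
            congr 2; ring
    rw [norm_mul, norm_mul]
    calc _ ≤ ‖v z‖ * (‖g y‖ * (CQ * ‖z‖ ^ β * (‖y‖ ^ (α - n) + ‖z + y‖ ^ (α - n)))) := by
          gcongr
          exact (hCQ z hz).2 y hy hyz
      _ = ‖v z‖ * ‖z‖ ^ β * (‖g y‖ * CQ * (‖y‖ ^ (α - n) + ‖z + y‖ ^ (α - n))) := by ring
      _ ≤ A * (1 + ‖z‖) ^ (-(n + τ)) *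
          (‖g y‖ * CQ * (‖y‖ ^ (α - n) + ‖z + y‖ ^ (α - n))) := by gcongr
      _ = _ := by ring
  have hDi := hH.integral_prod_left.const_mul (A * CQ)
  refine ⟨∫ z, v z * G z, ?_, ?_⟩
  · have h1 : Tendsto (fun s => ∫ z, damp v s z * G z) (𝓝[>] 0) (𝓝 (∫ z, v z * G z)) := by
      refine tendsto_integral_filter_of_dominated_convergence _
        (Eventually.of_forall fun s => (continuous_damp hvc s).aestronglyMeasurable.mul hGm)
        (Eventually.of_forall fun s => ?_) hDi
        (Eventually.of_forall fun z => (tendsto_damp v z).mul_const _)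
      filter_upwards [hdom] with z hz
      exact hz _ (norm_damp_le v s z)
    have h2 := hT0.add h1
    rw [zero_add] at h2
    refine h2.congr' ?_
    filter_upwards [self_mem_nhdsWithin] with s hs
    exact (hid s hs).symm
  · refine (norm_integral_le_of_norm_le hDi ?_).trans ?_
    · filter_upwards [hdom] with z hz
      exact hz _ le_rfl
    · rw [integral_const_mul, mul_assoc (A * CQ)]
      gcongr

/-! ### Mollifiers. -/

/-- A smooth even mollifier at scale `r`. -/
structure IsMollifier {n : ℕ} (B r : ℝ) (ρ : Space n → ℝ) : Prop where
  contDiff : ContDiff ℝ ∞ ρ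
  nonneg : ∀ x, 0 ≤ ρ x
  even : ∀ x, ρ (-x) = ρ x
  eq_zero : ∀ x, r < ‖x‖ → ρ x = 0
  le : ∀ x, ρ x ≤ B * r⁻¹ ^ n
  integral_eq : ∫ x, ρ x = 1
  pos : 0 < r

namespace IsMollifier

variable {n : ℕ} {B r : ℝ} {ρ : Space n → ℝ}

theorem hasCompactSupport (hρ : IsMollifier B r ρ) : HasCompactSupport ρ :=
  HasCompactSupport.intro (isCompact_closedBall (0 : Space n) r) fun x hx =>
    hρ.eq_zero x (by simpa using hx)

theorem integrable (hρ : IsMollifier B r ρ) : Integrable ρ :=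
  hρ.contDiff.continuous.integrable_of_hasCompactSupport hρ.hasCompactSupport

/-- A mollifier as a Schwartz function. -/
def schwartz (hρ : IsMollifier B r ρ) : 𝓢(Space n, ℂ) :=
  (hρ.hasCompactSupport.comp_left (g := fun t : ℝ => (t : ℂ)) (by simp)).toSchwartzMap
    (Complex.ofRealCLM.contDiff.comp hρ.contDiff)

theorem schwartz_apply (hρ : IsMollifier B r ρ) (x : Space n) : hρ.schwartz x = (ρ x : ℂ) := rfl

theorem fourier_fourier (hρ : IsMollifier B r ρ) (x : Space n) :
    𝓕 (𝓕 (hρ.schwartz : Space n → ℂ)) x = (ρ x : ℂ) := by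
  have h1 : 𝓕⁻ (𝓕 (hρ.schwartz : Space n → ℂ)) = (hρ.schwartz : Space n → ℂ) := by
    rw [← SchwartzMap.fourier_coe, ← SchwartzMap.fourierInv_coe,
      FourierTransform.fourierInv_fourier_eq]
  have h2 : hρ.schwartz x = hρ.schwartz (-x) := by
    rw [schwartz_apply, schwartz_apply, hρ.even]
  rw [← schwartz_apply hρ, h2, ← h1, Real.fourierInv_eq_fourier_neg, neg_neg]
  rw [h1]

theorem norm_integral_mul_le {D : ℝ} (hρ : IsMollifier B r ρ) {h : Space n → ℂ}
    (hh : ∀ z, ‖z‖ ≤ r → ‖h z‖ ≤ D) : ‖∫ z, (ρ z : ℂ) * h z‖ ≤ D := by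
  refine (norm_integral_le_of_norm_le (hρ.integrable.mul_const D)
    (Eventually.of_forall fun z => ?_)).trans (le_of_eq ?_)
  · rw [norm_mul, Complex.norm_real, Real.norm_of_nonneg (hρ.nonneg z)]
    rcases le_or_gt ‖z‖ r with hz | hz
    · exact mul_le_mul_of_nonneg_left (hh z hz) (hρ.nonneg z)
    · rw [hρ.eq_zero z hz]; simp
  · rw [integral_mul_const, hρ.integral_eq, one_mul]

end IsMollifier

/-- If ‖y‖ ≥ 2r, the kernel is evaluated only at ‖x‖ ≥ ‖y‖/2. Otherwise the mollifier is at most B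
r^(-n) and is supported in ‖x‖ < 4r, where the power integrates to a multiple of r^α; and r^(α-n) is
controlled by ‖y‖^(α-n), as ‖y‖ < 2r. The constant does not depend on r. -/
theorem exists_norm_integral_mul_mollifier_le {n : ℕ} (hn : 1 ≤ n) {α : ℝ} (hα : 0 < α)
    (hαn : α < n) {B : ℝ} (hB : 0 ≤ B) : ∃ C : ℝ, 0 ≤ C ∧
      ∀ (r : ℝ) (ρ : Space n → ℝ) (κ : Space n → ℂ) (A : ℝ),
      IsMollifier B r ρ → 0 ≤ A → (∀ x, x ≠ 0 → ‖κ x‖ ≤ A * ‖x‖ ^ (α - n)) →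
      ∀ y, y ≠ 0 → ‖∫ x, κ x * (ρ (x + y) : ℂ)‖ ≤ C * A * ‖y‖ ^ (α - n) := by
  have : Nonempty (Fin n) := ⟨⟨0, hn⟩⟩
  have hae : ∀ᵐ x : Space n, x ≠ 0 := by simp [ae_iff, measure_singleton]
  have hfr : Module.finrank ℝ (Space n) = n := by simp
  set g : Space n → ℝ := (Metric.ball (0 : Space n) 1).indicator (fun x => ‖x‖ ^ (-(n - α)))
    with hg
  have hgi : Integrable g := IntegrableOn.integrable_indicator
    (integrableOn_ball_norm_rpow (by rw [hfr]; linarith) 1) measurableSet_ball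
  have hg0 : ∀ z, 0 ≤ g z := fun z => Set.indicator_nonneg (fun x _ => by positivity) _
  have hI0 : 0 ≤ ∫ z, g z := integral_nonneg hg0
  refine ⟨2 ^ (n - α) + B * 4 ^ (n : ℝ) * ∫ z, g z, by positivity,
    fun r ρ κ A hρ hA hκ y hy => ?_⟩
  have hr := hρ.pos
  have hy0 : 0 < ‖y‖ := norm_pos_iff.2 hy
  rcases le_or_gt (2 * r) ‖y‖ with h | h
  · refine (norm_integral_le_of_norm_le ((hρ.integrable.comp_add_right y).const_mul
      (2 ^ (n - α) * A * ‖y‖ ^ (α - n))) ?_).trans ?_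
    · filter_upwards [hae] with x hx
      rw [norm_mul, Complex.norm_real, Real.norm_of_nonneg (hρ.nonneg _)]
      rcases le_or_gt ‖x + y‖ r with hxy | hxy
      · refine mul_le_mul_of_nonneg_right ((hκ x hx).trans ?_) (hρ.nonneg _)
        have h1 : ‖y‖ / 2 ≤ ‖x‖ := by
          have : ‖y‖ ≤ ‖x + y‖ + ‖x‖ := by
            calc ‖y‖ = ‖(x + y) - x‖ := by congr 1; abel
              _ ≤ _ := norm_sub_le _ _
          linarith
        calc A * ‖x‖ ^ (α - n) ≤ A * (‖y‖ / 2) ^ (α - n) := by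
              gcongr A * ?_
              exact Real.rpow_le_rpow_of_nonpos (by positivity) h1 (by linarith)
          _ = _ := by
              rw [Real.div_rpow hy0.le (by norm_num), div_eq_mul_inv,
                ← Real.rpow_neg (by norm_num), neg_sub]
              ring
      · rw [hρ.eq_zero _ hxy]; simp
    · rw [integral_const_mul, integral_add_right_eq_self (fun x => ρ x), hρ.integral_eq, mul_one,
        add_mul, add_mul]
      exact le_add_of_nonneg_right (by positivity)
  · have hgs : Integrable fun x : Space n => g ((4 * r)⁻¹ • x) :=
      hgi.comp_smul (by positivity)
    refine (norm_integral_le_of_norm_le (hgs.const_mul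
      (A * ((4 * r) ^ (α - n) * (B * r⁻¹ ^ n)))) ?_).trans ?_
    · filter_upwards [hae] with x hx
      rw [norm_mul, Complex.norm_real, Real.norm_of_nonneg (hρ.nonneg _)]
      rcases le_or_gt ‖x + y‖ r with hxy | hxy
      · have h1 : ‖x‖ < 4 * r := by
          have : ‖x‖ ≤ ‖x + y‖ + ‖y‖ := by
            calc ‖x‖ = ‖(x + y) - y‖ := by congr 1; abel
              _ ≤ _ := norm_sub_le _ _
          linarith
        have h2 : g ((4 * r)⁻¹ • x) = ((4 * r)⁻¹ * ‖x‖) ^ (α - n) := by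
          rw [hg, Set.indicator_of_mem, norm_smul, Real.norm_of_nonneg (by positivity), neg_sub]
          rw [mem_ball_zero_iff, norm_smul, Real.norm_of_nonneg (by positivity),
            inv_mul_lt_iff₀ (by positivity)]
          linarith
        calc _ ≤ A * ‖x‖ ^ (α - n) * (B * r⁻¹ ^ n) := by
              gcongr
              · exact hρ.nonneg _
              · exact hκ x hx
              · exact hρ.le _
          _ = A * ((4 * r) * ((4 * r)⁻¹ * ‖x‖)) ^ (α - n) * (B * r⁻¹ ^ n) := by
              congr 3; field_simp
          _ = _ := by
              rw [Real.mul_rpow (by positivity) (by positivity), h2]; ring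
      · rw [hρ.eq_zero _ hxy, mul_zero]
        have := hg0 ((4 * r)⁻¹ • x)
        positivity
    · rw [integral_const_mul, Measure.integral_comp_smul, hfr, abs_of_pos (by positivity),
        smul_eq_mul]
      have h1 : (4 * r) ^ (α - n) ≤ ‖y‖ ^ (α - n) :=
        Real.rpow_le_rpow_of_nonpos hy0 (by linarith) (by linarith)
      have h2 : r⁻¹ ^ n * (((4 * r)⁻¹ ^ n)⁻¹ : ℝ) = 4 ^ (n : ℝ) := by
        rw [Real.rpow_natCast, inv_pow, inv_pow, inv_inv, mul_pow]
        field_simp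
      calc _ = A * (4 * r) ^ (α - n) * B * (r⁻¹ ^ n * ((4 * r)⁻¹ ^ n)⁻¹) * ∫ z, g z := by ring
        _ = B * 4 ^ (n : ℝ) * (∫ z, g z) * A * (4 * r) ^ (α - n) := by rw [h2]; ring
        _ ≤ B * 4 ^ (n : ℝ) * (∫ z, g z) * A * ‖y‖ ^ (α - n) := by gcongr
        _ ≤ _ := by
          rw [add_mul, add_mul]
          exact le_add_of_nonneg_left (by positivity)

/-! ### Truncated Riesz symbols and the value at the origin. -/

/-- The symbol `|ξ| ^ (-lam)` truncated to `1/32 ≤ |ξ| ≤ 2/c`. -/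
def annularSymbol {n : ℕ} (lam c : ℝ) (ξ : Space n) : ℂ :=
  ((‖ξ‖ ^ (-lam) * (cutoff (c * ‖ξ‖) - cutoff (32 * ‖ξ‖)) : ℝ) : ℂ)

section AnnularSymbol

variable {n : ℕ} {lam c : ℝ}

theorem annularSymbol_of_lt (hc1 : c ≤ 1) {ξ : Space n} (h : ‖ξ‖ < 1 / 32) :
    annularSymbol lam c ξ = 0 := by
  have h0 := norm_nonneg ξ
  rw [annularSymbol, cutoff_of_le_one (by nlinarith), cutoff_of_le_one (by linarith)]
  simp

theorem norm_annularSymbol_le (hlam : 0 ≤ lam) (hc1 : c ≤ 1) (ξ : Space n) :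
    ‖annularSymbol lam c ξ‖ ≤ 32 ^ lam := by
  rcases lt_or_ge ‖ξ‖ (1 / 32) with h | h
  · rw [annularSymbol_of_lt hc1 h, norm_zero]; positivity
  · rw [annularSymbol, Complex.norm_real, norm_mul, Real.norm_of_nonneg (by positivity)]
    have h1 : ‖ξ‖ ^ (-lam) ≤ 32 ^ lam := by
      calc ‖ξ‖ ^ (-lam) ≤ (1 / 32) ^ (-lam) :=
            Real.rpow_le_rpow_of_nonpos (by norm_num) h (by linarith)
        _ = 32 ^ lam := by
            rw [one_div, Real.inv_rpow (by norm_num), ← Real.rpow_neg (by norm_num), neg_neg]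
    have h2 : ‖cutoff (c * ‖ξ‖) - cutoff (32 * ‖ξ‖)‖ ≤ 1 := by
      rw [Real.norm_eq_abs, abs_le]
      constructor <;> linarith [cutoff_nonneg (c * ‖ξ‖), cutoff_le_one (c * ‖ξ‖),
        cutoff_nonneg (32 * ‖ξ‖), cutoff_le_one (32 * ‖ξ‖)]
    calc _ ≤ (32 : ℝ) ^ lam * 1 := by gcongr
      _ = _ := mul_one _

theorem contDiff_annularSymbol : ContDiff ℝ ∞ (annularSymbol lam c : Space n → ℂ) :=
  contDiff_rpow_mul_cutoff_sub _ _ _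

theorem hasCompactSupport_annularSymbol (hc : 0 < c) (hc1 : c ≤ 1) :
    HasCompactSupport (annularSymbol lam c : Space n → ℂ) := by
  refine HasCompactSupport.intro (isCompact_closedBall (0 : Space n) (2 / c)) fun ξ hξ => ?_
  rw [mem_closedBall_zero_iff, not_le, div_lt_iff₀ hc] at hξ
  have h0 := norm_nonneg ξ
  rw [annularSymbol, cutoff_of_two_le (by linarith), cutoff_of_two_le (by nlinarith)]; simp

/-- Away from |ξ| < 1/32 one has |ξ|^(-lam) ≤ 32^(lam-α) |ξ|^(-α), so this is a symbol of order -α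
uniformly in c. -/
theorem exists_norm_fourier_annularSymbol_le (hn : 1 ≤ n) {α : ℝ} (hα : 0 < α)
    (hαn : α < n) (hlam : α ≤ lam) : ∃ C : ℝ, 0 ≤ C ∧ ∀ c : ℝ, 0 < c → c ≤ 1 →
      ∀ y : Space n, y ≠ 0 → ‖𝓕 (annularSymbol lam c : Space n → ℂ) y‖ ≤ C * ‖y‖ ^ (α - n) := by
  obtain ⟨C₀, hC₀, hF⟩ := exists_norm_fourier_le_of_symbolBound (K := n) hn hαn (by linarith)
  obtain ⟨Cκ, hCκ0, hCκ⟩ := exists_symbolBound_cutoff_norm (n := n) n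
  obtain ⟨Cr, hCr0, hCr⟩ := exists_symbolBound_norm_rpow (n := n) n (-lam)
  set A := 2 ^ n * Cr * (1 + (Cκ + (1 + Cκ))) * 32 ^ (lam - α) with hA
  have hA0 : 0 ≤ A := by positivity
  refine ⟨C₀ * A, by positivity, fun c hc hc1 y hy => hF _ A hA0
    (contDiff_annularSymbol.continuous.integrable_of_hasCompactSupport
      (hasCompactSupport_annularSymbol hc hc1)) (fun ξ hξ => ?_) y hy⟩
  have hξ0 : 0 < ‖ξ‖ := norm_pos_iff.2 hξ
  rcases lt_or_ge ‖ξ‖ (1 / 32) with h | h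
  · refine ((symbolBound_const n (0 : ℂ) ξ).mono (by rw [norm_zero]; positivity)).congr ?_
    filter_upwards [(continuous_norm.tendsto ξ).eventually (gt_mem_nhds h)] with z hz
    exact annularSymbol_of_lt hc1 hz
  · have h1 := (hCr ξ hξ).mul (((hCκ 32 (by norm_num) ξ hξ).add (hCκ c hc ξ hξ).one_sub).one_sub)
    refine (h1.mono ?_).congr (Eventually.of_forall fun z => ?_)
    · have h2 : ‖ξ‖ ^ (-lam) ≤ 32 ^ (lam - α) * ‖ξ‖ ^ (-α) := by
        calc ‖ξ‖ ^ (-lam) = ‖ξ‖ ^ (-(lam - α)) * ‖ξ‖ ^ (-α) := by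
              rw [← Real.rpow_add hξ0]; congr 1; ring
          _ ≤ (1 / 32) ^ (-(lam - α)) * ‖ξ‖ ^ (-α) := by
              gcongr ?_ * _
              exact Real.rpow_le_rpow_of_nonpos (by norm_num) h (by linarith)
          _ = _ := by
              rw [one_div, Real.inv_rpow (by norm_num), ← Real.rpow_neg (by norm_num), neg_neg]
      calc _ ≤ 2 ^ n * (Cr * (32 ^ (lam - α) * ‖ξ‖ ^ (-α))) * (1 + (Cκ + (1 + Cκ))) := by gcongr
        _ = _ := by rw [hA]; ring
    · simp only [annularSymbol]
      push_cast
      ring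

theorem fourier_annularSymbol_mul (hc : 0 < c) (hc1 : c ≤ 1) {B r : ℝ} {ρ : Space n → ℝ}
    (hρ : IsMollifier B r ρ) (y : Space n) :
    𝓕 (fun ξ => annularSymbol lam c ξ * 𝓕 (hρ.schwartz : Space n → ℂ) ξ) y =
      ∫ x, 𝓕 (annularSymbol lam c : Space n → ℂ) x * (ρ (x + y) : ℂ) := by
  set a : 𝓢(Space n, ℂ) := (hasCompactSupport_annularSymbol (n := n) (lam := lam) hc
    hc1).toSchwartzMap contDiff_annularSymbol with ha
  have haa : (a : Space n → ℂ) = annularSymbol lam c := rfl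
  have h2 : ∀ ξ, 𝓕 (𝓕 (annularSymbol lam c : Space n → ℂ)) ξ = annularSymbol lam c ξ := by
    intro ξ
    have h1 : 𝓕⁻ (𝓕 (a : Space n → ℂ)) = a := by
      rw [← SchwartzMap.fourier_coe, ← SchwartzMap.fourierInv_coe,
        FourierTransform.fourierInv_fourier_eq]
    have h3 : annularSymbol lam c ξ = annularSymbol lam c (-ξ) := by simp [annularSymbol]
    rw [h3, ← haa]
    nth_rw 2 [← h1]
    rw [Real.fourierInv_eq_fourier_neg, neg_neg]
  have hk : Integrable (𝓕 (annularSymbol lam c : Space n → ℂ)) := by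
    rw [← haa, ← SchwartzMap.fourier_coe]
    exact SchwartzMap.integrable _
  have hψ : Integrable (𝓕 (hρ.schwartz : Space n → ℂ)) := by
    rw [← SchwartzMap.fourier_coe]
    exact SchwartzMap.integrable _
  have h4 := fourier_fourier_mul hk hψ y
  simp only [h2, hρ.fourier_fourier] at h4
  exact h4

end AnnularSymbol

/-- The outer truncation makes the symbol integrable, and the transform becomes the kernel of the
truncated symbol averaged against ρ. Both bounds are uniform, and c → 0 by dominated convergence. -/
theorem exists_norm_fourier_highPart_mollifier_le {n : ℕ} (hn : 1 ≤ n) {α lam : ℝ} (hα : 0 < α)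
    (hαn : α < n) (hlam : α ≤ lam) {B : ℝ} (hB : 0 ≤ B) : ∃ C : ℝ, 0 ≤ C ∧
      ∀ (r : ℝ) (ρ : Space n → ℝ) (hρ : IsMollifier B r ρ) (y : Space n), y ≠ 0 →
      ‖𝓕 (fun ξ => ((‖ξ‖ ^ (-lam) : ℝ) : ℂ) * ((1 - lowCutoff ξ) *
        𝓕 (hρ.schwartz : Space n → ℂ) ξ)) y‖ ≤ C * ‖y‖ ^ (α - n) := by
  obtain ⟨C₁, hC₁0, hC₁⟩ := exists_norm_integral_mul_mollifier_le hn hα hαn hB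
  obtain ⟨C₂, hC₂0, hC₂⟩ := exists_norm_fourier_annularSymbol_le hn hα hαn hlam
  refine ⟨C₁ * C₂, by positivity, fun r ρ hρ y hy => ?_⟩
  have hψ : Integrable (𝓕 (hρ.schwartz : Space n → ℂ)) := by
    rw [← SchwartzMap.fourier_coe]
    exact SchwartzMap.integrable _
  have hlim : Tendsto (fun c : ℝ =>
      𝓕 (fun ξ => annularSymbol lam c ξ * 𝓕 (hρ.schwartz : Space n → ℂ) ξ) y) (𝓝[>] 0)
      (𝓝 (𝓕 (fun ξ => ((‖ξ‖ ^ (-lam) : ℝ) : ℂ) * ((1 - lowCutoff ξ) *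
        𝓕 (hρ.schwartz : Space n → ℂ) ξ)) y)) := by
    simp only [Real.fourier_eq' _ y]
    refine tendsto_integral_filter_of_dominated_convergence
      (fun ξ => 32 ^ lam * ‖𝓕 (hρ.schwartz : Space n → ℂ) ξ‖) ?_ ?_ (hψ.norm.const_mul _)
      (Eventually.of_forall fun ξ => ?_)
    · refine Eventually.of_forall fun c => ?_
      simp only [smul_eq_mul]
      exact (by fun_prop : Continuous fun ξ : Space n => Complex.exp
        (((-2 * Real.pi * inner ℝ ξ y : ℝ) : ℂ) * Complex.I)).aestronglyMeasurable.mul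
        (contDiff_annularSymbol.continuous.aestronglyMeasurable.mul hψ.1)
    · filter_upwards [Ioc_mem_nhdsGT (zero_lt_one' ℝ)] with c hc
      refine Eventually.of_forall fun ξ => ?_
      rw [norm_smul, Complex.norm_exp_ofReal_mul_I, one_mul, norm_mul]
      gcongr
      exact norm_annularSymbol_le (hα.le.trans hlam) hc.2 ξ
    · refine Tendsto.const_smul ?_ _
      rw [← mul_assoc]
      refine Tendsto.mul_const _ ?_
      have h1 : Tendsto (fun c : ℝ => cutoff (c * ‖ξ‖)) (𝓝[>] 0) (𝓝 1) := by
        have h2 : Continuous fun c : ℝ => cutoff (c * ‖ξ‖) :=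
          (contDiff_cutoff (m := ⊤)).continuous.comp (by fun_prop)
        have h3 := h2.tendsto 0
        rw [zero_mul, cutoff_of_le_one zero_le_one] at h3
        exact h3.mono_left nhdsWithin_le_nhds
      have h4 := (Complex.continuous_ofReal.tendsto _).comp
        ((h1.sub_const (cutoff (32 * ‖ξ‖))).const_mul (‖ξ‖ ^ (-lam)))
      simp only [Complex.ofReal_mul, Complex.ofReal_sub, Complex.ofReal_one] at h4
      refine h4.congr fun c => ?_
      simp [annularSymbol]
  refine le_of_tendsto hlim.norm ?_
  filter_upwards [Ioc_mem_nhdsGT (zero_lt_one' ℝ)] with c hc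
  rw [fourier_annularSymbol_mul hc.1 hc.2 hρ]
  exact hC₁ r ρ _ C₂ hρ hC₂0 (hC₂ c hc.1 hc.2) y hy

/-- The transform in the integrand is an average of translates of 𝓕 θ by vectors of length at most r
i ≤ 1. It converges pointwise by continuity and keeps a majorant (1+‖x‖)^(-N) that f can be
integrated against. -/
theorem tendsto_integral_mul_fourier_lowCutoff_mul_mollifier {n : ℕ} {f : Space n → ℂ}
    (hf : IsTempered f) {B : ℝ} {r : ℕ → ℝ} {ρ : ℕ → Space n → ℝ}
    (hρ : ∀ i, IsMollifier B (r i) (ρ i)) (hr1 : ∀ i, r i ≤ 1) (hr : Tendsto r atTop (𝓝 0)) :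
    Tendsto (fun i => ∫ x, f x *
        𝓕 (fun ξ => lowCutoff ξ * 𝓕 ((hρ i).schwartz : Space n → ℂ) ξ) x) atTop
      (𝓝 (∫ x, f x * 𝓕 (lowCutoff : Space n → ℂ) x)) := by
  have hfm := hf.aestronglyMeasurable
  obtain ⟨N, hN⟩ := hf
  have hfN := IsTempered.integrable_norm hN
  obtain ⟨C, hC0, hC⟩ := exists_norm_fourier_lowCutoff_mul_character_le n N
  set θ' : Space n → ℂ := 𝓕 (lowCutoff : Space n → ℂ) with hθ'
  have hθc : Continuous θ' :=
    VectorFourier.fourierIntegral_continuous Real.continuous_fourierChar continuous_inner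
      integrable_lowCutoff
  have hb : ∀ z x : Space n, ‖z‖ ≤ 1 → ‖θ' (x + z)‖ ≤ C * 2 ^ N * ((1 + ‖x‖) ^ N)⁻¹ := by
    intro z x hz
    have h := hC z x
    rw [← lowKernel, lowKernel_character] at h
    refine h.trans ?_
    gcongr
    linarith
  have hid : ∀ i x, 𝓕 (fun ξ => lowCutoff ξ * 𝓕 ((hρ i).schwartz : Space n → ℂ) ξ) x =
      ∫ z, (ρ i z : ℂ) * θ' (x + z) := by
    intro i x
    rw [fourier_lowCutoff_mul_fourier (SchwartzMap.integrable _)]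
    simp only [lowKernel_character, IsMollifier.schwartz_apply, hθ']
  simp only [hid]
  refine tendsto_integral_of_dominated_convergence
    (fun x => ‖f x‖ * (C * 2 ^ N * ((1 + ‖x‖) ^ N)⁻¹)) (fun i => ?_) ?_ (fun i => ?_) ?_
  · refine hfm.mul ?_
    have h1 : Continuous fun q : Space n × Space n => (ρ i q.2 : ℂ) * θ' (q.1 + q.2) := by
      have := (hρ i).contDiff.continuous
      fun_prop
    exact h1.stronglyMeasurable.integral_prod_right'.aestronglyMeasurable
  · refine (hfN.const_mul (C * 2 ^ N)).congr (Eventually.of_forall fun x => ?_)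
    simp only
    ring
  · refine Eventually.of_forall fun x => ?_
    rw [norm_mul]
    gcongr
    exact (hρ i).norm_integral_mul_le fun z hz => hb z x (hz.trans (hr1 i))
  · refine Eventually.of_forall fun x => Tendsto.const_mul _ ?_
    rw [Metric.tendsto_atTop]
    intro ε hε
    obtain ⟨d, hd0, hd⟩ := Metric.continuous_iff.1 hθc x (ε / 2) (by positivity)
    obtain ⟨M, hM⟩ := (Metric.tendsto_atTop.1 hr) d hd0
    refine ⟨M, fun i hi => ?_⟩
    have hri := hM i hi
    rw [Real.dist_0_eq_abs, abs_of_pos (hρ i).pos] at hri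
    have hc : θ' x = ∫ z, (ρ i z : ℂ) * θ' x := by
      rw [integral_mul_const, integral_complex_ofReal, (hρ i).integral_eq]; simp
    have hI : Integrable fun z => (ρ i z : ℂ) * θ' (x + z) := by
      refine Continuous.integrable_of_hasCompactSupport ?_ ?_
      · have := (hρ i).contDiff.continuous
        fun_prop
      · exact ((hρ i).hasCompactSupport.comp_left (g := fun t : ℝ => (t : ℂ))
          (by simp)).mul_right
    have hI2 : Integrable fun z => (ρ i z : ℂ) * θ' x := (hρ i).integrable.ofReal.mul_const _
    rw [dist_eq_norm, hc, ← integral_sub hI hI2]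
    simp only [← mul_sub]
    refine ((hρ i).norm_integral_mul_le fun z hz => ?_).trans_lt (half_lt_self hε)
    have := hd (x + z) (by rw [dist_eq_norm, add_sub_cancel_left]; linarith)
    rw [dist_eq_norm] at this
    exact this.le

/-- The value of `f = I_lam g` at the origin, obtained by mollification, differs from the low
frequency part by at most the Riesz potential of `|g|`. -/
theorem exists_norm_sub_integral_mul_fourier_lowCutoff_le {n : ℕ} (hn : 1 ≤ n) {α lam : ℝ}
    (hα : 0 < α) (hαn : α < n) (hlam : α ≤ lam) {B : ℝ} (hB : 0 ≤ B) : ∃ C : ℝ, 0 ≤ C ∧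
      ∀ (f g : Space n → ℂ), IsTempered f → IsRieszPotential lam f g →
      (Integrable fun y => ‖g y‖ * ‖y‖ ^ (α - n)) →
      ∀ (r : ℕ → ℝ) (ρ : ℕ → Space n → ℝ), (∀ i, IsMollifier B (r i) (ρ i)) → (∀ i, r i ≤ 1) →
      Tendsto r atTop (𝓝 0) →
      ∀ c : ℂ, Tendsto (fun i => ∫ x, f x * (ρ i x : ℂ)) atTop (𝓝 c) →
        ‖c - ∫ x, f x * 𝓕 (lowCutoff : Space n → ℂ) x‖ ≤
          C * ∫ y, ‖g y‖ * ‖y‖ ^ (α - n) := by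
  have : Nonempty (Fin n) := ⟨⟨0, hn⟩⟩
  have hae : ∀ᵐ x : Space n, x ≠ 0 := by simp [ae_iff, measure_singleton]
  obtain ⟨C, hC0, hC⟩ := exists_norm_fourier_highPart_mollifier_le hn hα hαn hlam hB
  refine ⟨C, hC0, fun f g hf hfg hgi r ρ hρ hr1 hr c hc => ?_⟩
  refine le_of_tendsto (hc.sub
    (tendsto_integral_mul_fourier_lowCutoff_mul_mollifier hf hρ hr1 hr)).norm
    (Eventually.of_forall fun i => ?_)
  -- With the transform of the mollifier as test function, the second transform restores the
  -- mollifier because it is even.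
  have h1 := integral_mul_fourier_eq hf hfg (𝓕 (hρ i).schwartz)
  rw [SchwartzMap.fourier_coe] at h1
  simp only [(hρ i).fourier_fourier] at h1
  rw [h1, add_sub_cancel_left, ← integral_const_mul]
  refine norm_integral_le_of_norm_le (hgi.const_mul C) ?_
  filter_upwards [hae] with y hy
  rw [norm_mul]
  calc _ ≤ ‖g y‖ * (C * ‖y‖ ^ (α - n)) := by gcongr; exact hC _ _ (hρ i) y hy
    _ = _ := by ring

/-! ### The damped kernel and its low-frequency splitting. -/

section DampedKernel

variable {n : ℕ}

theorem hasTemperateGrowth_fourier_of_support {m : Space n → ℂ} (hm : Integrable m)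
    (h : ∀ ξ, 1 < ‖ξ‖ → m ξ = 0) : Function.HasTemperateGrowth (𝓕 m) := by
  refine hasTemperateGrowth_fourier (fun k => ?_) hm.1
  refine hm.norm.mono' ((by fun_prop : Continuous fun ξ : Space n => ‖ξ‖ ^ k
    ).aestronglyMeasurable.mul hm.1.norm) (Eventually.of_forall fun ξ => ?_)
  rw [Real.norm_of_nonneg (by positivity)]
  rcases le_or_gt ‖ξ‖ 1 with hξ | hξ
  · exact mul_le_of_le_one_left (norm_nonneg _) (pow_le_one₀ (norm_nonneg _) hξ)
  · rw [h ξ hξ]; simp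

/-- The damped function `damp v s` as a Schwartz function. -/
theorem exists_schwartz_eq_damp {v : Space n → ℂ} (hv : v.HasTemperateGrowth) {s : ℝ}
    (hs : 0 < s) : ∃ V : 𝓢(Space n, ℂ), (V : Space n → ℂ) = damp v s := by
  let e : Space n ≃L[ℝ] Space n := ContinuousLinearEquiv.smulLeft (Units.mk0 s hs.ne')
  refine ⟨SchwartzMap.smulLeftCLM ℂ v
    (SchwartzMap.compCLMOfContinuousLinearEquiv ℝ e gaussian), ?_⟩
  ext z
  rw [SchwartzMap.smulLeftCLM_apply_apply hv]
  have he : e z = s • z := rfl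
  simp only [SchwartzMap.compCLMOfContinuousLinearEquiv_apply, Function.comp, smul_eq_mul, damp, he,
    gaussian_apply]
  rw [norm_smul, mul_pow, Real.norm_eq_abs, sq_abs]
  simp

theorem fourier_damp_fourier {h : Space n → ℂ} (hh : Integrable h) {s : ℝ} (hs : 0 < s)
    (ξ : Space n) : 𝓕 (damp (𝓕 h) s) ξ = ∫ η, h η * heatKernel s (ξ + η) := by
  have he : Integrable fun y : Space n => ((Real.exp (-s ^ 2 * ‖y‖ ^ 2) : ℝ) : ℂ) := by
    have := integrable_damp (v := fun _ : Space n => (1 : ℂ)) aestronglyMeasurable_const (A := 1)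
      (by simp) hs 0
    simp only [pow_zero, mul_one] at this
    rw [integrable_norm_iff (continuous_damp continuous_const s).aestronglyMeasurable] at this
    refine this.congr (Eventually.of_forall fun y => ?_)
    simp only [damp, one_mul]
  have h1 := fourier_fourier_mul hh he ξ
  simp only [fourier_exp_neg_norm_sq hs] at h1
  simp_rw [add_comm ξ]
  exact h1

theorem fourier_coe_add (φ ψ : 𝓢(Space n, ℂ)) (x : Space n) :
    𝓕 ((φ + ψ : 𝓢(Space n, ℂ)) : Space n → ℂ) x =
      𝓕 (φ : Space n → ℂ) x + 𝓕 (ψ : Space n → ℂ) x :=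
  fourier_add_of_integrable φ.integrable ψ.integrable x

theorem IsTempered.integral_mul_fourier_add {f : Space n → ℂ} (hf : IsTempered f)
    (φ ψ : 𝓢(Space n, ℂ)) : ∫ x, f x * 𝓕 ((φ + ψ : 𝓢(Space n, ℂ)) : Space n → ℂ) x =
      (∫ x, f x * 𝓕 (φ : Space n → ℂ) x) + ∫ x, f x * 𝓕 (ψ : Space n → ℂ) x := by
  rw [← integral_add (hf.integrable_mul_fourier φ) (hf.integrable_mul_fourier ψ)]
  simp only [fourier_coe_add, mul_add]

/-- The low frequency part of the pairing of `f` with the damped Fourier transform of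
`m = 1 + (m - u - 1) + u`. -/
theorem integral_mul_fourier_lowCutoff_mul_fourier_damp {f m u : Space n → ℂ} (hf : IsTempered f)
    (hm : Integrable m) (hm0 : ∀ ξ, 1 < ‖ξ‖ → m ξ = 0) (hu : Integrable u)
    (hu0 : ∀ ξ, 1 < ‖ξ‖ → u ξ = 0) {s : ℝ} (hs : 0 < s) :
    ∫ x, f x * 𝓕 (fun ξ => lowCutoff ξ * 𝓕 (damp (𝓕 m) s) ξ) x =
      (∫ x, f x * 𝓕 (lowCutoff : Space n → ℂ) x) +
        (∫ x, f x * 𝓕 (fun ξ => lowCutoff ξ *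
          ∫ η, (m η - u η - 1) * heatKernel s (ξ + η)) x) +
        ∫ x, f x * 𝓕 (fun ξ => lowCutoff ξ * 𝓕 (damp (𝓕 u) s) ξ) x := by
  obtain ⟨Vm, hVm⟩ := exists_schwartz_eq_damp (hasTemperateGrowth_fourier_of_support hm hm0) hs
  obtain ⟨Vu, hVu⟩ := exists_schwartz_eq_damp (hasTemperateGrowth_fourier_of_support hu hu0) hs
  have hheat : ∀ ξ : Space n, Integrable fun η => heatKernel s (ξ + η) := fun ξ =>
    (integrable_heatKernel hs).comp_add_left ξ
  have hheat1 : ∀ ξ : Space n, ∫ η : Space n, heatKernel s (ξ + η) = 1 := fun ξ => by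
    rw [integral_add_left_eq_self (fun η : Space n => heatKernel s η), integral_heatKernel hs]
  set S₁ := lowPart (𝓕 Vm) with hS₁
  set S₂ : 𝓢(Space n, ℂ) := (hasCompactSupport_lowCutoff (n := n)).toSchwartzMap
    contDiff_lowCutoff with hS₂
  set S₃ := lowPart (𝓕 Vu) with hS₃
  have e₁ : (S₁ : Space n → ℂ) = fun ξ => lowCutoff ξ * 𝓕 (damp (𝓕 m) s) ξ := by
    rw [hS₁, coe_lowPart, SchwartzMap.fourier_coe, hVm]
  have e₂ : (S₂ : Space n → ℂ) = lowCutoff := rfl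
  have e₃ : (S₃ : Space n → ℂ) = fun ξ => lowCutoff ξ * 𝓕 (damp (𝓕 u) s) ξ := by
    rw [hS₃, coe_lowPart, SchwartzMap.fourier_coe, hVu]
  have e₄ : ((S₁ - S₂ - S₃ : 𝓢(Space n, ℂ)) : Space n → ℂ) = fun ξ => lowCutoff ξ *
      ∫ η, (m η - u η - 1) * heatKernel s (ξ + η) := by
    ext ξ
    rw [sub_apply, sub_apply, e₁, e₂, e₃]
    beta_reduce
    obtain ⟨Cb, hCb⟩ : ∃ Cb : ℝ, ∀ η : Space n, ‖heatKernel s (ξ + η)‖ ≤ Cb := by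
      refine ⟨∫ y : Space n, ‖((Real.exp (-s ^ 2 * ‖y‖ ^ 2) : ℝ) : ℂ)‖, fun η => ?_⟩
      rw [← fourier_exp_neg_norm_sq hs]
      exact norm_fourier_le_integral_norm _ _
    have hi : ∀ {h : Space n → ℂ}, Integrable h →
        Integrable fun η => h η * heatKernel s (ξ + η) := fun hh =>
      hh.mul_bdd ((continuous_heatKernel s).comp
        (continuous_const.add continuous_id)).aestronglyMeasurable (Eventually.of_forall hCb)
    have hsplit : ∫ η, (m η - u η - 1) * heatKernel s (ξ + η) =
        (∫ η, m η * heatKernel s (ξ + η)) - (∫ η, u η * heatKernel s (ξ + η)) - 1 := by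
      simp only [sub_mul, one_mul]
      refine (integral_sub ((hi hm).sub (hi hu)) (hheat ξ)).trans ?_
      simp only [Pi.sub_apply]
      rw [integral_sub (hi hm) (hi hu), hheat1]
    rw [hsplit, fourier_damp_fourier hm hs, fourier_damp_fourier hu hs]
    ring
  rw [← e₁, ← e₃, ← e₄, ← e₂, ← hf.integral_mul_fourier_add, ← hf.integral_mul_fourier_add]
  rw [show S₂ + (S₁ - S₂ - S₃) + S₃ = S₁ by abel]

theorem fourier_neg_of_radial {m : Space n → ℂ} (hm : ∀ ξ η, ‖ξ‖ = ‖η‖ → m ξ = m η)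
    (y : Space n) : 𝓕 m (-y) = 𝓕 m y := fourier_comp_norm_eq m hm (norm_neg y)

theorem multiplier_eq_zero {δ γ : ℝ} (hγ : 0 < γ) {ξ : Space n} (hξ : 1 < ‖ξ‖) :
    multiplier δ γ 1 ξ = 0 := by
  rw [multiplier_one, posPow_of_nonpos, Complex.ofReal_zero]
  have := Real.one_lt_rpow hξ hγ
  linarith

theorem multiplier_radial (δ γ : ℝ) (ξ η : Space n) (h : ‖ξ‖ = ‖η‖) :
    multiplier δ γ 1 ξ = multiplier δ γ 1 η := by
  rw [multiplier, multiplier, h]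

theorem continuous_fourier {m : Space n → ℂ} (hm : Integrable m) : Continuous (𝓕 m) :=
  VectorFourier.fourierIntegral_continuous Real.continuous_fourierChar continuous_inner hm

end DampedKernel

/-! ### The estimate at the origin. -/

/-- The convergence at the origin, for `R = 1`. -/
theorem exists_tendsto_integral_mul_damp_kernel {n : ℕ} (hn : 1 ≤ n) {δ γ lam B : ℝ}
    (hδ : -1 < δ) (hδn : δ < ((n : ℝ) - 1) / 2) (hγ : 0 < γ)
    (hlam : ((n : ℝ) - 1) / 2 - δ ≤ lam) (hlamγ : lam ≤ γ) (hB : 0 ≤ B) :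
    ∃ C : ℝ, 0 ≤ C ∧ ∀ f g : Space n → ℂ, IsTempered f → AEStronglyMeasurable g volume →
      IsRieszPotential lam f g →
      (Integrable fun y => ‖g y‖ * ‖y‖ ^ (((n : ℝ) - 1) / 2 - δ - n)) →
      ∀ (r : ℕ → ℝ) (ρ : ℕ → Space n → ℝ), (∀ i, IsMollifier B (r i) (ρ i)) → (∀ i, r i ≤ 1) →
      Tendsto r atTop (𝓝 0) →
      ∀ c : ℂ, Tendsto (fun i => ∫ x, f x * (ρ i x : ℂ)) atTop (𝓝 c) →
      ∃ L : ℂ, Tendsto (fun s => ∫ x, f x * damp (kernel δ γ 1) s x) (𝓝[>] 0) (𝓝 L) ∧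
        ‖L - c‖ ≤ C * ∫ y, ‖g y‖ * ‖y‖ ^ (((n : ℝ) - 1) / 2 - δ - n) := by
  have hn1 : (1 : ℝ) ≤ n := by exact_mod_cast hn
  set α : ℝ := ((n : ℝ) - 1) / 2 - δ with hα
  have hα0 : 0 < α := by linarith
  have hαn : α < n := by linarith
  have hlam0 : 0 < lam := by linarith
  set k := ⌈lam⌉₊ with hk
  have hk1 : 1 ≤ k := Nat.ceil_pos.2 hlam0
  have hlamk : lam ≤ k := Nat.le_ceil lam
  have hklam : (k : ℝ) - 1 < lam := by have := Nat.ceil_lt_add_one hlam0.le; linarith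
  -- The choice β = lam - d/2 puts β strictly between max(lam - α, k-1) and lam. So the moments
  -- below k vanish, the remainder symbol has order at least -α, and τ = γ - β > 0 even when lam =
  -- γ.
  set d := min α (lam - k + 1) with hd
  have hd0 : 0 < d := lt_min hα0 (by linarith)
  have hd1 : d ≤ α := min_le_left _ _
  have hd2 : d ≤ lam - k + 1 := min_le_right _ _
  set β := lam - d / 2 with hβ
  set τ := γ - β with hτ
  have hτ0 : 0 < τ := by linarith
  set m : Space n → ℂ := multiplier δ γ 1 with hm
  set u : Space n → ℂ := originPart δ γ with hu
  have hmi : Integrable m := integrable_multiplier hn hδ hγ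
  have hui : Integrable u := integrable_originPart δ hγ
  have hm0 : ∀ ξ, 1 < ‖ξ‖ → m ξ = 0 := fun ξ h => multiplier_eq_zero hγ h
  have hu0 : ∀ ξ, 1 < ‖ξ‖ → u ξ = 0 := fun ξ h => originPart_of_le (by linarith)
  obtain ⟨A₁, hA₁0, hA₁⟩ := exists_norm_fourier_multiplier_le hn hδ hγ (by linarith)
  obtain ⟨A₂, hA₂0, hA₂⟩ := exists_norm_fourier_originPart_le hn δ hγ
  obtain ⟨D, hD0, hD⟩ := exists_symbolBound_originPart (n := n) 0 δ hγ
  have hvc : Continuous (𝓕 u) := continuous_fourier hui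
  have hv : ∀ z, ‖𝓕 u z‖ ≤ A₂ * (1 + ‖z‖) ^ (-(n + τ + β)) := fun z => by
    have := hA₂ z
    rwa [show (n : ℝ) + γ = n + τ + β by rw [hτ]; ring] at this
  have hvi : Integrable (𝓕 u) := by
    refine ((integrable_one_add_norm (E := Space n) (r := (n : ℝ) + γ) (by simp [hγ])).const_mul
      A₂).mono' hvc.aestronglyMeasurable (Eventually.of_forall hA₂)
  -- By inversion the second transform returns u at -ξ, and u is O(|ξ|^γ) with γ = τ + β.
  have hFv : ∀ ξ, ‖𝓕 (𝓕 u) ξ‖ ≤ D * ‖ξ‖ ^ (τ + β) := by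
    intro ξ
    have h1 := (continuous_originPart δ hγ).fourierInv_fourier_eq hui hvi
    have h2 : 𝓕 (𝓕 u) ξ = u (-ξ) := by
      rw [hu, ← congrFun h1 (-ξ), Real.fourierInv_eq_fourier_neg, neg_neg]
    rw [h2, show τ + β = γ by rw [hτ]; ring]
    rcases eq_or_ne ξ 0 with rfl | hξ
    · have : u (-0) = 0 := by
        rw [hu, neg_zero, originPart, multiplier_one, norm_zero, Real.zero_rpow hγ.ne',
          posPow_of_pos (by norm_num)]
        simp
      rw [this, norm_zero]; positivity
    · have := (hD (-ξ) (neg_ne_zero.2 hξ)).norm_le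
      rwa [norm_neg] at this
  have hmom := integral_mul_characterTaylor_eq_zero (k := k) (β := β) hk1 (by linarith)
    (by linarith) hτ0 hvc.aestronglyMeasurable hv hD0 hFv
  obtain ⟨C₁, hC₁0, hC₁⟩ := exists_tendsto_integral_lowCutoff_mul_fourier_damp (k := k) (β := β)
    hn hα0 hαn hk1 (by linarith) (by linarith) (by linarith) hlam0.le hlamk hτ0 hA₂0 hvc hv hmom
  obtain ⟨C₂, hC₂0, hC₂⟩ := exists_norm_sub_integral_mul_fourier_lowCutoff_le hn hα0 hαn hlam hB
  obtain ⟨κ, hκi, hκ, hFκ⟩ := exists_fourier_eq_rpow_mul_one_sub_cutoff (n := n) hlam0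
    (show (0 : ℝ) < 32 by norm_num)
  set K := ∫ x, ‖(((1 + ‖x‖) ^ n : ℝ) : ℂ) * κ x‖ with hK
  have hK0 : 0 ≤ K := integral_nonneg fun _ => norm_nonneg _
  refine ⟨C₁ + C₂ + A₁ * K, by positivity, fun f g hf hg hfg hgi r ρ hρ hr1 hr c hc => ?_⟩
  have hkm : (kernel δ γ 1 : Space n → ℂ) = 𝓕 m := kernel_eq_fourier δ γ 1
  obtain ⟨L₁, hL₁, hL₁b⟩ := hC₁ f g hf hg hfg hgi
  have hcb := hC₂ f g hf hfg hgi r ρ hρ hr1 hr c hc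
  have hBc : Continuous (𝓕 m) := continuous_fourier hmi
  have hA₁' : ∀ y, ‖𝓕 m y‖ ≤ A₁ * (1 + ‖y‖) ^ (-((n : ℝ) - α)) := fun y => by
    have := hA₁ y
    rwa [show ((n : ℝ) + 1) / 2 + δ = n - α by rw [hα]; ring] at this
  obtain ⟨hL₂, hL₂b⟩ := tendsto_integral_mul_integral_mul (α := α) (s := n - α) (g := g)
    (b := damp (𝓕 m)) (b₀ := 𝓕 m) hn hκi hκ (by linarith) (by linarith) (by ring) hA₁0 hg hgi
    (continuous_damp hBc) (fun t y => (norm_damp_le _ _ _).trans (hA₁' y)) (tendsto_damp _)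
  have hw : Integrable fun η : Space n => (((1 + ‖η‖) ^ (n + 1))⁻¹ : ℝ) * ‖m η - u η - 1‖ := by
    have h1 : Integrable fun η : Space n => ‖m η - u η‖ + (1 + ‖η‖) ^ (-((n : ℝ) + 1)) :=
      (hmi.sub hui).norm.add
        (integrable_one_add_norm (E := Space n) (r := (n : ℝ) + 1) (by simp))
    refine h1.mono' ?_ (Eventually.of_forall fun η => ?_)
    · exact (by fun_prop (disch := intros; positivity) : Continuous fun η : Space n =>
        ((1 + ‖η‖) ^ (n + 1))⁻¹).aestronglyMeasurable.mul
          ((hmi.1.sub hui.1).sub aestronglyMeasurable_const).norm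
    · have h2 : ((1 + ‖η‖) ^ (n + 1))⁻¹ ≤ 1 :=
        inv_le_one_of_one_le₀ (one_le_pow₀ (by linarith [norm_nonneg η]))
      rw [Real.norm_of_nonneg (by positivity), show -((n : ℝ) + 1) = -((n + 1 : ℕ) : ℝ) by
        push_cast; ring, Real.rpow_neg (by positivity), Real.rpow_natCast]
      calc _ ≤ ((1 + ‖η‖) ^ (n + 1))⁻¹ * (‖m η - u η‖ + ‖(1 : ℂ)‖) := by
            gcongr; exact norm_sub_le _ _
        _ = ((1 + ‖η‖) ^ (n + 1))⁻¹ * ‖m η - u η‖ + ((1 + ‖η‖) ^ (n + 1))⁻¹ := by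
            rw [norm_one]; ring
        _ ≤ _ := by
            gcongr
            exact mul_le_of_le_one_left (norm_nonneg _) h2
  -- For |η| < 1/8 the cutoff in u equals 1, so u = m - 1 there.
  have hw0 : ∀ η : Space n, ‖η‖ < 1 / 8 → m η - u η - 1 = 0 := fun η hη => by
    rw [hm, hu, originPart, cutoff_of_le_one (by linarith)]
    simp
  have hL₃ := tendsto_integral_fourier_lowCutoff_mul_heatKernel hf hw
    ((hmi.1.sub hui.1).sub aestronglyMeasurable_const) hw0
  -- The limit collects the contributions of the constant 1, of m-u-1 (which is 0), of u, and of the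
  -- high frequencies.
  refine ⟨(∫ x, f x * 𝓕 (lowCutoff : Space n → ℂ) x) + 0 + L₁ +
    ∫ y, g y * ∫ x, κ x * 𝓕 m (x + y), ?_, ?_⟩
  · refine (((tendsto_const_nhds.add hL₃).add hL₁).add hL₂).congr' ?_
    filter_upwards [self_mem_nhdsWithin] with s hs
    have hs : 0 < s := hs
    obtain ⟨V, hV⟩ := exists_schwartz_eq_damp (hasTemperateGrowth_fourier_of_support hmi hm0) hs
    have hFV : ∀ x, 𝓕 (𝓕 (V : Space n → ℂ)) x = damp (𝓕 m) s x := by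
      intro x
      have h1 : 𝓕⁻ (𝓕 (V : Space n → ℂ)) = V := by
        rw [← SchwartzMap.fourier_coe, ← SchwartzMap.fourierInv_coe,
          FourierTransform.fourierInv_fourier_eq]
      have h2 : damp (𝓕 m) s x = damp (𝓕 m) s (-x) := by
        rw [damp, damp, norm_neg, fourier_neg_of_radial (multiplier_radial δ γ)]
      rw [h2, ← hV]
      nth_rw 2 [← h1]
      rw [Real.fourierInv_eq_fourier_neg, neg_neg]
    have h1 := integral_mul_fourier_eq hf hfg (𝓕 V)
    rw [SchwartzMap.fourier_coe] at h1
    simp only [hFV] at h1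
    rw [hkm, h1]
    congr 1
    · rw [hV, integral_mul_fourier_lowCutoff_mul_fourier_damp hf hmi hm0 hui hu0 hs]
    · refine integral_congr_ae (Eventually.of_forall fun y => ?_)
      simp only
      have hVi : Integrable (𝓕 (V : Space n → ℂ)) := by
        rw [← SchwartzMap.fourier_coe]
        exact SchwartzMap.integrable _
      have h2 := fourier_fourier_mul hκi hVi y
      simp only [hFκ, hFV] at h2
      rw [← h2]
      refine congrArg (fun h : Space n → ℂ => g y * 𝓕 h y) (funext fun ξ => ?_)
      rw [← mul_assoc, lowCutoff]
      push_cast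
      ring
  · rw [show (∫ x, f x * 𝓕 (lowCutoff : Space n → ℂ) x) + 0 + L₁ +
        (∫ y, g y * ∫ x, κ x * 𝓕 m (x + y)) - c = L₁ -
        (c - ∫ x, f x * 𝓕 (lowCutoff : Space n → ℂ) x) +
        ∫ y, g y * ∫ x, κ x * 𝓕 m (x + y) by ring]
    refine (norm_add_le _ _).trans ?_
    refine (add_le_add ((norm_sub_le _ _).trans (add_le_add hL₁b hcb)) hL₂b).trans (le_of_eq ?_)
    rw [← hK]
    ring

/-! ### Translation and dilation to the origin. -/

section Affine

variable {n : ℕ}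

theorem integral_comp_affine {E : Type*} [NormedAddCommGroup E] [NormedSpace ℝ E]
    (F : Space n → E) {R : ℝ} (hR : 0 < R) (x : Space n) :
    ∫ z, F (x + R⁻¹ • z) = R ^ n • ∫ w, F w := by
  rw [Measure.integral_comp_inv_smul_of_nonneg volume (fun w => F (x + w)) hR.le,
    integral_add_left_eq_self (fun w => F w), finrank_euclideanSpace, Fintype.card_fin]

theorem integrable_comp_affine {E : Type*} [NormedAddCommGroup E] {F : Space n → E}
    (hF : Integrable F) {R : ℝ} (hR : 0 < R) (x : Space n) :
    Integrable fun z => F (x + R⁻¹ • z) :=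
  (hF.comp_add_left x).comp_smul (inv_ne_zero hR.ne')

/-- The function with Fourier transform `w ↦ 𝓕 ψ (R(w - x))`. -/
def affineSymbol (R : ℝ) (x : Space n) (ψ : Space n → ℂ) (ξ : Space n) : ℂ :=
  ((R⁻¹ ^ n : ℝ) : ℂ) *
    (Complex.exp (((-2 * Real.pi * inner ℝ ξ (-x) : ℝ) : ℂ) * Complex.I) * ψ (R⁻¹ • ξ))

theorem fourier_affineSymbol {R : ℝ} (hR : 0 < R) (x : Space n) (ψ : Space n → ℂ) (w : Space n) :
    𝓕 (affineSymbol R x ψ) w = 𝓕 ψ (R • (w - x)) := by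
  have h1 : affineSymbol R x ψ = fun ξ => ((R⁻¹ ^ n : ℝ) : ℂ) *
    (Complex.exp (((-2 * Real.pi * inner ℝ ξ (-x) : ℝ) : ℂ) * Complex.I) * ψ (R⁻¹ • ξ)) := rfl
  rw [h1, fourier_const_mul, fourier_exp_mul (fun ξ => ψ (R⁻¹ • ξ)),
    fourier_comp_smul ψ (inv_pos.2 hR), inv_inv, finrank_euclideanSpace, Fintype.card_fin,
    ← mul_assoc, ← Complex.ofReal_mul, ← mul_pow, inv_mul_cancel₀ hR.ne', one_pow,
    Complex.ofReal_one, one_mul, sub_eq_add_neg]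

/-- Defined on the other side of the transform: an affine pullback of 𝓕 ψ is visibly Schwartz, and
its inverse transform is the modulated dilate of ψ. -/
theorem exists_schwartz_eq_affineSymbol {R : ℝ} (hR : 0 < R) (x : Space n) (ψ : 𝓢(Space n, ℂ)) :
    ∃ φ : 𝓢(Space n, ℂ), (φ : Space n → ℂ) = affineSymbol R x ψ := by
  let e : Space n ≃L[ℝ] Space n := ContinuousLinearEquiv.smulLeft (Units.mk0 R hR.ne')
  let θ : 𝓢(Space n, ℂ) := SchwartzMap.compSubConstCLM ℝ x
    (SchwartzMap.compCLMOfContinuousLinearEquiv ℝ e (𝓕 ψ))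
  have hF : 𝓕 (affineSymbol R x (ψ : Space n → ℂ)) = θ := by
    ext w
    rw [fourier_affineSymbol hR, ← SchwartzMap.fourier_coe]
    rfl
  refine ⟨𝓕⁻ θ, ?_⟩
  have hc : Continuous (affineSymbol R x (ψ : Space n → ℂ)) := by
    have := ψ.continuous
    unfold affineSymbol
    fun_prop
  have hi : Integrable (affineSymbol R x (ψ : Space n → ℂ)) :=
    (integrable_exp_mul (ψ.integrable.comp_smul (inv_ne_zero hR.ne')) (-x)).const_mul _
  rw [SchwartzMap.fourierInv_coe, ← hF]
  exact hc.fourierInv_fourier_eq hi (by rw [hF]; exact θ.integrable)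

theorem rpow_mul_affineSymbol {R : ℝ} (hR : 0 < R) (x : Space n) (ψ : Space n → ℂ) (lam : ℝ)
    (ξ : Space n) : ((‖ξ‖ ^ (-lam) : ℝ) : ℂ) * affineSymbol R x ψ ξ =
      ((R ^ (-lam) : ℝ) : ℂ) *
        affineSymbol R x (fun ξ => ((‖ξ‖ ^ (-lam) : ℝ) : ℂ) * ψ ξ) ξ := by
  have h1 : ‖ξ‖ ^ (-lam) = R ^ (-lam) * ‖R⁻¹ • ξ‖ ^ (-lam) := by
    rw [norm_smul, Real.norm_of_nonneg (by positivity), Real.mul_rpow (by positivity)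
      (norm_nonneg _), ← mul_assoc, ← Real.mul_rpow hR.le (by positivity), mul_inv_cancel₀ hR.ne',
      Real.one_rpow, one_mul]
  simp only [affineSymbol]
  rw [h1]
  push_cast
  ring

theorem isBigO_affineSymbol {R : ℝ} (hR : 0 < R) (x : Space n) {ψ : Space n → ℂ} {lam : ℝ}
    (h : ψ =O[𝓝 0] fun ξ => ‖ξ‖ ^ lam) : affineSymbol R x ψ =O[𝓝 0] fun ξ => ‖ξ‖ ^ lam := by
  have ht : Tendsto (fun ξ : Space n => R⁻¹ • ξ) (𝓝 0) (𝓝 0) := by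
    have : Continuous fun ξ : Space n => R⁻¹ • ξ := by fun_prop
    simpa using this.tendsto 0
  have h1 := h.comp_tendsto ht
  have h2 : (fun ξ : Space n => ‖R⁻¹ • ξ‖ ^ lam) =O[𝓝 0] fun ξ => ‖ξ‖ ^ lam := by
    refine Asymptotics.IsBigO.of_bound (R⁻¹ ^ lam) (Eventually.of_forall fun ξ => ?_)
    rw [norm_smul, Real.norm_of_nonneg (show (0 : ℝ) ≤ R⁻¹ by positivity),
      Real.mul_rpow (by positivity) (norm_nonneg _), norm_mul,
      Real.norm_of_nonneg (show (0 : ℝ) ≤ R⁻¹ ^ lam by positivity)]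
  have h3 : affineSymbol R x ψ =O[𝓝 0] fun ξ : Space n => ψ (R⁻¹ • ξ) := by
    refine Asymptotics.IsBigO.of_bound (R⁻¹ ^ n) (Eventually.of_forall fun ξ => ?_)
    rw [affineSymbol, norm_mul, norm_mul, Complex.norm_exp_ofReal_mul_I, one_mul, Complex.norm_real,
      Real.norm_of_nonneg (by positivity)]
  exact h3.trans (h1.trans h2)

/-- For R ≥ 1 the weights compare through 1 + ‖x + z/R‖ ≤ (1+‖x‖)(1+‖z‖). -/
theorem IsTempered.comp_affine {f : Space n → ℂ} (hf : IsTempered f) {R : ℝ} (hR : 1 ≤ R)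
    (x : Space n) : IsTempered fun z => f (x + R⁻¹ • z) := by
  have hR0 : 0 < R := by linarith
  obtain ⟨N, hN⟩ := hf
  refine ⟨N, ?_⟩
  have h1 := integrable_comp_affine hN hR0 x
  have heq : (fun z : Space n => ((1 + ‖z‖) ^ N)⁻¹ • f (x + R⁻¹ • z)) = fun z =>
      (((1 + ‖z‖) ^ N)⁻¹ * (1 + ‖x + R⁻¹ • z‖) ^ N) •
        (((1 + ‖x + R⁻¹ • z‖) ^ N)⁻¹ • f (x + R⁻¹ • z)) := by
    ext z
    have : (0 : ℝ) < (1 + ‖x + R⁻¹ • z‖) ^ N := by positivity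
    rw [smul_smul, mul_assoc, mul_inv_cancel₀ this.ne', mul_one]
  have hc : Continuous fun z : Space n => ((1 + ‖z‖) ^ N)⁻¹ * (1 + ‖x + R⁻¹ • z‖) ^ N := by
    refine Continuous.mul (Continuous.inv₀ (by fun_prop) fun z => ?_) (by fun_prop)
    positivity
  rw [heq]
  refine (h1.norm.const_mul ((1 + ‖x‖) ^ N)).mono' (hc.aestronglyMeasurable.smul h1.1)
    (Eventually.of_forall fun z => ?_)
  rw [norm_smul, Real.norm_of_nonneg (by positivity)]
  gcongr
  rw [inv_mul_le_iff₀ (by positivity), ← mul_pow]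
  gcongr
  have h2 : ‖x + R⁻¹ • z‖ ≤ ‖x‖ + ‖z‖ := by
    refine (norm_add_le _ _).trans ?_
    rw [norm_smul, Real.norm_of_nonneg (by positivity)]
    gcongr
    exact mul_le_of_le_one_left (norm_nonneg _) (inv_le_one_of_one_le₀ hR)
  nlinarith [norm_nonneg x, norm_nonneg z, mul_nonneg (norm_nonneg x) (norm_nonneg z)]

/-- The affine map is transposed onto the test function, which remains admissible at the origin; the
homogeneity of |ξ|^(-lam) produces R^(-lam). -/
theorem IsRieszPotential.comp_affine {f g : Space n → ℂ} {lam R : ℝ}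
    (hfg : IsRieszPotential lam f g) (hR : 0 < R) (x : Space n) :
    IsRieszPotential lam (fun z => f (x + R⁻¹ • z))
      fun z => ((R ^ (-lam) : ℝ) : ℂ) * g (x + R⁻¹ • z) := by
  intro ψ hψ
  obtain ⟨φ, hφ⟩ := exists_schwartz_eq_affineSymbol hR x ψ
  have h1 := hfg φ (by
    rw [show (fun ξ => φ ξ) = affineSymbol R x (ψ : Space n → ℂ) from hφ]
    exact isBigO_affineSymbol hR x hψ)
  simp only [hφ] at h1
  simp only [rpow_mul_affineSymbol hR, fourier_const_mul] at h1
  have hη : (fun ξ => affineSymbol R x (ψ : Space n → ℂ) ξ) = affineSymbol R x ψ := rfl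
  simp only [hη, fourier_affineSymbol hR] at h1
  have h2 := integral_comp_affine (fun w => f w * 𝓕 (fun ξ => ψ ξ) (R • (w - x))) hR x
  have h3 := integral_comp_affine (fun w => g w * (((R ^ (-lam) : ℝ) : ℂ) *
    𝓕 (fun ξ => ((‖ξ‖ ^ (-lam) : ℝ) : ℂ) * ψ ξ) (R • (w - x)))) hR x
  simp only [add_sub_cancel_left, smul_inv_smul₀ hR.ne'] at h2 h3
  rw [h2, h1, ← h3]
  refine integral_congr_ae (Eventually.of_forall fun z => ?_)
  simp only
  ring

theorem IsMollifier.scale {B r : ℝ} {ρ : Space n → ℝ} (hρ : IsMollifier B r ρ) {R : ℝ}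
    (hR : 0 < R) : IsMollifier B (R * r) fun x => R⁻¹ ^ n * ρ (R⁻¹ • x) where
  contDiff := contDiff_const.mul (hρ.contDiff.comp (contDiff_const_smul _))
  nonneg x := mul_nonneg (by positivity) (hρ.nonneg _)
  even x := by rw [smul_neg, hρ.even]
  eq_zero x hx := by
    rw [hρ.eq_zero, mul_zero]
    rw [norm_smul, Real.norm_of_nonneg (by positivity), inv_mul_eq_div, lt_div_iff₀ hR]
    linarith
  le x := by
    rw [mul_inv, mul_pow]
    calc _ ≤ R⁻¹ ^ n * (B * r⁻¹ ^ n) := by gcongr; exact hρ.le _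
      _ = _ := by ring
  integral_eq := by
    have h1 := integral_comp_affine ρ hR 0
    simp only [zero_add] at h1
    rw [integral_const_mul, h1, hρ.integral_eq, smul_eq_mul, mul_one, ← mul_pow,
      inv_mul_cancel₀ hR.ne', one_pow]
  pos := mul_pos hR hρ.pos

theorem kernel_eq_smul (δ γ : ℝ) {R : ℝ} (hR : 0 < R) (y : Space n) :
    kernel δ γ R y = ((R ^ n : ℝ) : ℂ) * kernel δ γ 1 (R • y) := by
  have h1 : (multiplier δ γ R : Space n → ℂ) = fun ξ => multiplier δ γ 1 (R⁻¹ • ξ) := by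
    ext ξ
    rw [multiplier_one, multiplier, norm_smul, Real.norm_of_nonneg (by positivity),
      Real.mul_rpow (by positivity) (norm_nonneg _), Real.inv_rpow hR.le, inv_mul_eq_div]
  rw [kernel_eq_fourier, kernel_eq_fourier, h1, fourier_comp_smul _ (inv_pos.2 hR), inv_inv,
    finrank_euclideanSpace, Fintype.card_fin]

/-- Dilation by R brings the kernel to R = 1 and the damping parameter to √ε/R; the evenness of the
kernel turns the convolution into a pairing. -/
theorem regularizedMean_eq (δ γ : ℝ) {R : ℝ} (hR : 0 < R) (f : Space n → ℂ) (x : Space n)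
    {ε : ℝ} (hε : 0 ≤ ε) : regularizedMean δ γ R f x ε =
      ∫ z, f (x + R⁻¹ • z) * damp (kernel δ γ 1) (R⁻¹ * √ε) z := by
  have h1 := integral_comp_affine (fun y => f (x + y) * kernel δ γ 1 (R • y) *
    ((Real.exp (-ε * ‖y‖ ^ 2) : ℝ) : ℂ)) hR 0
  simp only [zero_add, smul_inv_smul₀ hR.ne'] at h1
  have h2 : ∀ z : Space n, -(R⁻¹ * √ε) ^ 2 * ‖z‖ ^ 2 = -ε * ‖R⁻¹ • z‖ ^ 2 := fun z => by
    rw [norm_smul, Real.norm_of_nonneg (by positivity), mul_pow, mul_pow, Real.sq_sqrt hε]; ring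
  simp only [damp, h2, ← mul_assoc]
  rw [h1, ← integral_neg_eq_self, regularizedMean, ← integral_smul]
  refine integral_congr_ae (Eventually.of_forall fun y => ?_)
  simp only
  have h3 : kernel δ γ 1 (R • -y) = kernel δ γ 1 (R • y) := by
    rw [kernel_eq_fourier, smul_neg, fourier_neg_of_radial (multiplier_radial δ γ)]
  rw [kernel_eq_smul δ γ hR, h3, norm_neg, ← sub_eq_add_neg, Complex.real_smul]
  ring

/-- The factor R^(a-lam) is the rate of approximation: with a = (n-1)/2 - δ it is the inverse of the
power of R in the maximal function. -/
theorem integral_norm_mul_norm_rpow_comp_affine (g : Space n → ℂ) {R : ℝ} (hR : 0 < R)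
    (x : Space n) (lam a : ℝ) :
    ∫ z, ‖((R ^ (-lam) : ℝ) : ℂ) * g (x + R⁻¹ • z)‖ * ‖z‖ ^ (a - n) =
      R ^ (a - lam) * ∫ y, ‖g y‖ * ‖x - y‖ ^ (a - n) := by
  have h1 := integral_comp_affine (fun w => ‖g w‖ * ‖R • (w - x)‖ ^ (a - n)) hR x
  simp only [add_sub_cancel_left, smul_inv_smul₀ hR.ne'] at h1
  simp only [norm_mul, Complex.norm_real, mul_assoc]
  rw [integral_const_mul, h1, smul_eq_mul, Real.norm_of_nonneg (by positivity)]
  have h2 : ∀ w, ‖g w‖ * ‖R • (w - x)‖ ^ (a - n) = R ^ (a - n) * (‖g w‖ * ‖x - w‖ ^ (a - n)) := by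
    intro w
    rw [norm_smul, Real.norm_of_nonneg hR.le, Real.mul_rpow hR.le (norm_nonneg _), norm_sub_rev]
    ring
  simp only [h2]
  rw [integral_const_mul, ← mul_assoc, ← mul_assoc, ← Real.rpow_natCast, ← Real.rpow_add hR,
    ← Real.rpow_add hR]
  congr 2
  ring

theorem integrable_norm_mul_norm_rpow_comp_affine {g : Space n → ℂ} {R : ℝ} (hR : 0 < R)
    {x : Space n} (lam : ℝ) {a : ℝ} (hg : Integrable fun y => ‖g y‖ * ‖x - y‖ ^ (a - n)) :
    Integrable fun z => ‖((R ^ (-lam) : ℝ) : ℂ) * g (x + R⁻¹ • z)‖ * ‖z‖ ^ (a - n) := by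
  refine ((integrable_comp_affine hg hR x).const_mul (R ^ (-lam) * R ^ (a - n))).congr
    (Eventually.of_forall fun z => ?_)
  simp only
  rw [sub_add_cancel_left, norm_neg, norm_smul, Real.norm_of_nonneg (by positivity),
    Real.mul_rpow (by positivity) (norm_nonneg _), Real.inv_rpow hR.le, norm_mul, Complex.norm_real,
    Real.norm_of_nonneg (by positivity)]
  field_simp

end Affine

/-! ### Recovery of f by mollification and the pointwise estimate. -/

theorem IsTempered.locallyIntegrable {n : ℕ} {f : Space n → ℂ} (hf : IsTempered f) :
    LocallyIntegrable f volume := by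
  obtain ⟨N, hN⟩ := hf
  have h := hN.locallyIntegrable.continuous_smul
    (by fun_prop : Continuous fun x : Space n => (1 + ‖x‖) ^ N)
  refine h.congr (Eventually.of_forall fun x => ?_)
  simp only
  rw [smul_smul, mul_inv_cancel₀ (by positivity), one_smul]

/-- A sequence of mollifiers that recovers locally integrable functions almost everywhere. -/
theorem exists_mollifier (n : ℕ) : ∃ (B : ℝ) (r : ℕ → ℝ) (ρ : ℕ → Space n → ℝ), 0 ≤ B ∧
    (∀ i, IsMollifier B (r i) (ρ i)) ∧ Tendsto r atTop (𝓝 0) ∧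
    ∀ f : Space n → ℂ, LocallyIntegrable f volume →
      ∀ᵐ x, Tendsto (fun i => ∫ w, f (x + w) * (ρ i w : ℂ)) atTop (𝓝 (f x)) := by
  -- Inner radius half the outer one: the bounded ratio gives both the height bound with 2^n and the
  -- convergence at almost every point.
  let φ : ℕ → ContDiffBump (0 : Space n) := fun i =>
    ⟨1 / (i + 1) / 2, 1 / (i + 1), by positivity, half_lt_self (by positivity)⟩
  have hr : Tendsto (fun i => (φ i).rOut) atTop (𝓝 0) := tendsto_one_div_add_atTop_nhds_zero_nat
  have hK : ∀ i, (φ i).rOut ≤ 2 * (φ i).rIn := fun i => by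
    simp only [φ]; linarith
  refine ⟨2 ^ n / volume.real (Metric.closedBall (0 : Space n) 1), fun i => (φ i).rOut,
    fun i => (φ i).normed volume, by positivity, fun i => ?_, hr, fun f hf => ?_⟩
  · refine ⟨(φ i).contDiff_normed (n := ⊤), (φ i).nonneg_normed, fun x => (φ i).normed_neg x,
      fun x hx => ?_, fun x => ?_, (φ i).integral_normed, (φ i).rOut_pos⟩
    · change (φ i).rOut < ‖x‖ at hx
      change (φ i).normed volume x = 0
      rw [ContDiffBump.normed_def, (φ i).zero_of_le_dist, zero_div]
      rw [dist_zero_right]; exact hx.le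
    · refine ((φ i).normed_le_div_measure_closedBall_rOut volume 2 (hK i) x).trans (le_of_eq ?_)
      rw [Measure.addHaar_real_closedBall' _ _ (φ i).rOut_pos.le, finrank_euclideanSpace,
        Fintype.card_fin, inv_pow]
      have := (φ i).rOut_pos
      field_simp
  · filter_upwards [ContDiffBump.ae_convolution_tendsto_right_of_locallyIntegrable hr
      (Eventually.of_forall hK) hf] with x hx
    refine hx.congr fun i => ?_
    rw [convolution_def, ← integral_neg_eq_self]
    refine integral_congr_ae (Eventually.of_forall fun w => ?_)
    simp only
    rw [sub_neg_eq_add, ContDiffBump.normed_neg, ContinuousLinearMap.lsmul_apply,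
      Complex.real_smul, mul_comm]

/-- The pointwise estimate at a point `x` where `f` is recovered by mollification. -/
theorem exists_tendsto_regularizedMean {n : ℕ} (hn : 1 ≤ n) {δ γ lam B : ℝ}
    (hδ : -1 < δ) (hδn : δ < ((n : ℝ) - 1) / 2) (hγ : 0 < γ)
    (hlam : ((n : ℝ) - 1) / 2 - δ ≤ lam) (hlamγ : lam ≤ γ) (hB : 0 ≤ B) :
    ∃ C : ℝ, 0 ≤ C ∧ ∀ f g : Space n → ℂ, IsTempered f → AEStronglyMeasurable g volume →
      IsRieszPotential lam f g → ∀ (r : ℕ → ℝ) (ρ : ℕ → Space n → ℝ),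
      (∀ i, IsMollifier B (r i) (ρ i)) → Tendsto r atTop (𝓝 0) →
      ∀ x, Tendsto (fun i => ∫ w, f (x + w) * (ρ i w : ℂ)) atTop (𝓝 (f x)) →
      (Integrable fun y => ‖g y‖ * ‖x - y‖ ^ (((n : ℝ) - 1) / 2 - δ - n)) →
      ∀ R : ℝ, 1 < R → ∃ L : ℂ, Tendsto (regularizedMean δ γ R f x) (𝓝[>] 0) (𝓝 L) ∧
        ‖((R ^ (lam + δ - ((n : ℝ) - 1) / 2) : ℝ) : ℂ) * (L - f x)‖ ≤
          C * ∫ y, ‖g y‖ * ‖x - y‖ ^ (((n : ℝ) - 1) / 2 - δ - n) := by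
  obtain ⟨C, hC0, hC⟩ := exists_tendsto_integral_mul_damp_kernel hn hδ hδn hγ hlam hlamγ hB
  refine ⟨C, hC0, fun f g hf hg hfg r ρ hρ hr x hx hgi R hR => ?_⟩
  have hR0 : 0 < R := by linarith
  have hRr : Tendsto (fun i => R * r i) atTop (𝓝 0) := by simpa using hr.const_mul R
  -- After dilation the radii are R r i; the first i₀ indices are discarded so that they are at most
  -- 1.
  obtain ⟨i₀, hi₀⟩ := eventually_atTop.1 (hRr.eventually (ge_mem_nhds one_pos))
  have hgm : AEStronglyMeasurable (fun z => ((R ^ (-lam) : ℝ) : ℂ) * g (x + R⁻¹ • z)) volume := by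
    have h1 : Measure.QuasiMeasurePreserving (fun z : Space n => R⁻¹ • z) volume volume :=
      ⟨by fun_prop, by
        rw [Measure.map_addHaar_smul _ (inv_ne_zero hR0.ne')]
        exact Measure.smul_absolutelyContinuous⟩
    exact aestronglyMeasurable_const.mul (hg.comp_quasiMeasurePreserving
      ((measurePreserving_add_left volume x).quasiMeasurePreserving.comp h1))
  have hc : Tendsto (fun i => ∫ z, f (x + R⁻¹ • z) *
      ((R⁻¹ ^ n * ρ (i + i₀) (R⁻¹ • z) : ℝ) : ℂ)) atTop (𝓝 (f x)) := by
    refine ((tendsto_add_atTop_iff_nat i₀).2 hx).congr fun i => ?_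
    have h1 := integral_comp_affine (fun w => f (x + w) * (ρ (i + i₀) w : ℂ)) hR0 0
    simp only [zero_add] at h1
    have h2 : ∀ z, f (x + R⁻¹ • z) * ((R⁻¹ ^ n * ρ (i + i₀) (R⁻¹ • z) : ℝ) : ℂ) =
        ((R⁻¹ ^ n : ℝ) : ℂ) * (f (x + R⁻¹ • z) * (ρ (i + i₀) (R⁻¹ • z) : ℂ)) := fun z => by
      push_cast; ring
    simp only [h2]
    rw [integral_const_mul, h1, Complex.real_smul, ← mul_assoc, ← Complex.ofReal_mul, ← mul_pow,
      inv_mul_cancel₀ hR0.ne', one_pow, Complex.ofReal_one, one_mul]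
  obtain ⟨L, hL, hLb⟩ := hC _ _ (hf.comp_affine hR.le x) hgm (hfg.comp_affine hR0 x)
    (integrable_norm_mul_norm_rpow_comp_affine hR0 lam hgi) (fun i => R * r (i + i₀))
    (fun i z => R⁻¹ ^ n * ρ (i + i₀) (R⁻¹ • z)) (fun i => (hρ (i + i₀)).scale hR0)
    (fun i => hi₀ _ (Nat.le_add_left _ _)) ((tendsto_add_atTop_iff_nat i₀).2 hRr) (f x) hc
  refine ⟨L, ?_, ?_⟩
  · have hs : Tendsto (fun ε => R⁻¹ * √ε) (𝓝[>] 0) (𝓝[>] 0) := by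
      refine tendsto_nhdsWithin_iff.2 ⟨?_, ?_⟩
      · have : Continuous fun ε => R⁻¹ * √ε := by fun_prop
        have h := this.tendsto 0
        rw [Real.sqrt_zero, mul_zero] at h
        exact h.mono_left nhdsWithin_le_nhds
      · filter_upwards [self_mem_nhdsWithin] with ε hε
        exact mul_pos (inv_pos.2 hR0) (Real.sqrt_pos.2 hε)
    refine (hL.comp hs).congr' ?_
    filter_upwards [self_mem_nhdsWithin] with ε hε
    exact (regularizedMean_eq δ γ hR0 f x (le_of_lt hε)).symm
  · rw [integral_norm_mul_norm_rpow_comp_affine g hR0] at hLb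
    rw [norm_mul, Complex.norm_real, Real.norm_of_nonneg (by positivity)]
    have h3 : R ^ (lam + δ - ((n : ℝ) - 1) / 2) * R ^ (((n : ℝ) - 1) / 2 - δ - lam) = 1 := by
      rw [← Real.rpow_add hR0]
      ring_nf
      exact Real.rpow_zero R
    calc _ ≤ R ^ (lam + δ - ((n : ℝ) - 1) / 2) * (C * (R ^ (((n : ℝ) - 1) / 2 - δ - lam) *
          ∫ y, ‖g y‖ * ‖x - y‖ ^ (((n : ℝ) - 1) / 2 - δ - n))) := by gcongr
      _ = R ^ (lam + δ - ((n : ℝ) - 1) / 2) * R ^ (((n : ℝ) - 1) / 2 - δ - lam) * (C *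
          ∫ y, ‖g y‖ * ‖x - y‖ ^ (((n : ℝ) - 1) / 2 - δ - n)) := by ring
      _ = _ := by rw [h3, one_mul]

theorem ofReal_integral_norm_mul_norm_rpow {n : ℕ} {g : Space n → ℂ}
    (hg : AEStronglyMeasurable g volume) (x : Space n) (a : ℝ)
    (h : ∫⁻ y, ‖g y‖ₑ * ENNReal.ofReal (‖x - y‖ ^ a) ≠ ⊤) :
    (Integrable fun y => ‖g y‖ * ‖x - y‖ ^ a) ∧
      ENNReal.ofReal (∫ y, ‖g y‖ * ‖x - y‖ ^ a) =
        ∫⁻ y, ‖g y‖ₑ * ENNReal.ofReal (‖x - y‖ ^ a) := by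
  have h1 : ∀ y, ENNReal.ofReal (‖g y‖ * ‖x - y‖ ^ a) =
      ‖g y‖ₑ * ENNReal.ofReal (‖x - y‖ ^ a) := fun y => by
    rw [ENNReal.ofReal_mul (norm_nonneg _), ofReal_norm]
  have hm : AEStronglyMeasurable (fun y => ‖g y‖ * ‖x - y‖ ^ a) volume :=
    hg.norm.mul (by fun_prop : Measurable fun y : Space n => ‖x - y‖ ^ a).aestronglyMeasurable
  have hi : Integrable fun y => ‖g y‖ * ‖x - y‖ ^ a := by
    refine ⟨hm, ?_⟩
    rw [hasFiniteIntegral_iff_ofReal (Eventually.of_forall fun y => by positivity)]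
    simp only [h1]
    exact h.lt_top
  refine ⟨hi, ?_⟩
  rw [ofReal_integral_eq_lintegral_ofReal hi (Eventually.of_forall fun y => by positivity)]
  simp only [h1]

end BochnerRiesz

end

/-! ### The maximal estimate. -/

theorem theorem4p1 (n : ℕ) (hn : 1 ≤ n) (δ γ lam : ℝ)
    (hδ : -1 < δ) (hδn : δ < ((n : ℝ) - 1) / 2) (hγ : 0 < γ)
    (hlam : ((n : ℝ) - 1) / 2 - δ ≤ lam) (hlamγ : lam ≤ γ) :
    ∃ C : ℝ≥0, 0 < C ∧
      ∀ p : ℝ≥0∞, 1 ≤ p → p ≠ ∞ →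
        ∀ f g : BochnerRiesz.Space n → ℂ, BochnerRiesz.IsRieszSobolev lam p f g →
          ∀ᵐ x : BochnerRiesz.Space n,
            (BochnerRiesz.majorant δ g x < ∞ →
              ∀ R : ℝ, 1 < R → BochnerRiesz.MeanExists δ γ R f x) ∧
            BochnerRiesz.maximalMean δ γ lam f x ≤ C * BochnerRiesz.majorant δ g x := by
  obtain ⟨B, r, ρ, hB, hρ, hr, hae⟩ := BochnerRiesz.exists_mollifier n
  obtain ⟨D, hD0, hD⟩ := BochnerRiesz.exists_tendsto_regularizedMean hn hδ hδn hγ hlam hlamγ hB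
  have hn1 : (1 : ℝ) ≤ n := by exact_mod_cast hn
  set α : ℝ := ((n : ℝ) - 1) / 2 - δ with hα
  have hα0 : 0 < α := by linarith
  have hαn : α < n := by linarith
  set κ : ℝ := Real.pi ^ (α - (n : ℝ) / 2) * Real.Gamma (((n : ℝ) - α) / 2) / Real.Gamma (α / 2)
    with hκ
  have hκ0 : 0 < κ := by
    have h1 := Real.Gamma_pos_of_pos (show 0 < ((n : ℝ) - α) / 2 by linarith)
    have h2 := Real.Gamma_pos_of_pos (show 0 < α / 2 by linarith)
    have := Real.pi_pos
    positivity
  -- Dividing by κ passes from the bare integral to the normalized Riesz potential; the summand 1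
  -- only ensures positivity.
  refine ⟨(D / κ).toNNReal + 1, by positivity, fun p _ _ f g hfg => ?_⟩
  -- The only exceptional set is the one where mollification fails to recover f. It does not depend
  -- on R, so the supremum needs no further argument.
  filter_upwards [hae f hfg.tempered.locallyIntegrable] with x hx
  by_cases hmaj : BochnerRiesz.majorant δ g x < ∞
  · have hgm := hfg.memLp.1
    have hle : BochnerRiesz.rieszPotentialAbs α g x ≤ BochnerRiesz.majorant δ g x := by
      rw [BochnerRiesz.majorant]
      exact le_self_add.trans' le_add_self
    have hfin : ∫⁻ y, ‖g y‖ₑ * ENNReal.ofReal (‖x - y‖ ^ (α - (n : ℝ))) ≠ ∞ := by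
      intro htop
      have h1 := hle.trans_lt hmaj
      rw [BochnerRiesz.rieszPotentialAbs, htop, ENNReal.mul_top] at h1
      · exact lt_irrefl _ h1
      · exact (ENNReal.ofReal_pos.2 hκ0).ne'
    obtain ⟨hgi, hgI⟩ := BochnerRiesz.ofReal_integral_norm_mul_norm_rpow hgm x _ hfin
    have hlim := hD f g hfg.tempered hgm hfg.potential r ρ hρ hr x hx hgi
    refine ⟨fun _ R hR => ?_, ?_⟩
    · obtain ⟨L, hL, -⟩ := hlim R hR
      exact ⟨L, hL⟩
    · refine iSup₂_le fun R hR => ?_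
      obtain ⟨L, hL, hLb⟩ := hlim R hR
      have hmean : BochnerRiesz.mean δ γ R f x = L := hL.limUnder_eq
      rw [hmean, ← ofReal_norm]
      calc _ ≤ ENNReal.ofReal (D * ∫ y, ‖g y‖ * ‖x - y‖ ^ (α - (n : ℝ))) :=
            ENNReal.ofReal_le_ofReal hLb
        _ = ENNReal.ofReal (D / κ) * BochnerRiesz.rieszPotentialAbs α g x := by
            rw [BochnerRiesz.rieszPotentialAbs, ENNReal.ofReal_mul hD0, hgI, ← mul_assoc,
              ← ENNReal.ofReal_mul (by positivity), ← hκ, div_mul_cancel₀ _ hκ0.ne']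
        _ ≤ _ := by
            gcongr
            rw [ENNReal.coe_add]
            exact le_self_add
  -- Where the majorant is infinite, positivity of the constant makes the right-hand side infinite.
  · refine ⟨fun h => absurd h hmaj, ?_⟩
    rw [not_lt, top_le_iff] at hmaj
    rw [hmaj, ENNReal.mul_top]
    · exact le_top
    · positivity
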